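/- Let $\mathcal K$ and $\mathfrak h$ be finite-dimensional complex Hilbert spaces, $E=E^*\in\mathcal B(\mathcal K)$ and $\nu\in\mathcal B(\mathcal K,\mathcal K\otimes\mathfrak h)$. Put $\Upsilon:=E-\tfrac{i}{2}\nu^*\nu$, so that $\operatorname{Re}\Upsilon=E$ and $-i\Upsilon+i\Upsilon^*=-\nu^*\nu$. Let $Z_R$ be multiplication by the variable $x$ in $\mathcal Z_R:=L^2(\mathbb R,\mathfrak h)$, with domain $\operatorname{Dom}Z_R=\{f: xf\in L^2\}\subset L^1$, and let $\mathcal Z:=\mathcal K\otimes\Gamma_s(\mathcal Z_R)$, where $\Gamma_s$ is the bosonic Fock space with vacuum $\Omega$. Let $I_{\mathcal K}:\mathcal K\to\mathcal Z$, $I_{\mathcal K}\psi=\psi\otimes\Omega$, and let $\mathcal D\subset\mathcal Z$ be the algebraic tensor product of $\mathcal K$ with the finite sums of algebraic symmetric tensors over $\operatorname{Dom}Z_R$. For a linear map $R^*$ from the algebraic tensor product $\mathcal K\otimes\operatorname{Dom}Z_R$ to $\mathcal K$, let $a(R)$ act on $\mathcal D$ as $\sqrt n\,(R^*\otimes\mathrm{Sym}^{n-1})$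 on $n$-particle vectors, and let $a^*(R)$ be its adjoint as a quadratic form. In particular $a(|1\rangle\otimes\nu)$ and $a(e^{itZ_R}|1\rangle\otimes b)$, $b\in\mathfrak h$, belong to $R^*(k\otimes f)=\nu^*\big(k\otimes\int f\big)$ and $R^*(k\otimes f)=\big\langle b\,\big|\int e^{-itx}f(x)\,dx\big\rangle k$. Define quadratic forms on $\mathcal D$ by $$Z^+=\Upsilon+(2\pi)^{-1/2}\big(a(|1\rangle\otimes\nu)+a^*(|1\rangle\otimes\nu)\big)+d\Gamma(Z_R),$$ $$Z^-=\Upsilon^*+(2\pi)^{-1/2}\big(a(|1\rangle\otimes\nu)+a^*(|1\rangle\otimes\nu)\big)+d\Gamma(Z_R).$$ For a decomposition $\nu=\sum_{j\in J}C_j\otimes|b_j\rangle$ with $J$ finite, $C_j\in\mathcal B(\mathcal K)$, $b_j\in\mathfrak h$, put $C_j^+=C_j$, $C_j^-=C_j^*$, and for $t\ge 0$ consider the series of quadratic forms on $\mathcal D$ $$U_t:=e^{-itd\Gamma(Z_R)}\sum_{n=0}^\infty\ \int_{0<t_1<\dots<t_n<t}dt_n\cdots dt_1\sum_{j_1,\dots,j_n\in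 J}\ \sum_{\epsilon_1,\dots,\epsilon_n\in\{+,-\}}(-i)^n(2\pi)^{-n/2}$$ $$\times\, e^{-i(t-t_n)\Upsilon}C_{j_n}^{\epsilon_n}e^{-i(t_n-t_{n-1})\Upsilon}\cdots C_{j_1}^{\epsilon_1}e^{-it_1\Upsilon}\prod_{p:\,\epsilon_p=+}a^*(e^{it_pZ_R}|1\rangle\otimes b_{j_p})\prod_{p:\,\epsilon_p=-}a(e^{it_pZ_R}|1\rangle\otimes b_{j_p}),$$ and $U_{-t}:=U_t^*$. Then: 1. $\mathcal D$ is dense in $\mathcal Z$. For all $\psi,\psi'\in\mathcal D$ and $t\ge0$ the integrands above are integrable and the series for $\langle\psi|U_t\psi'\rangle$ converges; the forms $U_t$ extend to a strongly continuous unitary group $(U_t)_{t\in\mathbb R}$ on $\mathcal Z$, which is the same for every decomposition of $\nu$. 2. For $\psi,\psi'\in\mathcal D$ the function $t\mapsto\langle\psi|U_t\psi'\rangle$ is differentiable on $\mathbb R\setminus\{0\}$ with continuous derivative there. As $t\downarrow0$, both this derivative and $t^{-1}\langle\psi|(U_t-1)\psi'\rangle$ tend to $-i\langle\psi|Z^+\psi'\rangle$;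 as $t\uparrow0$, both tend to $-i\langle\psi|Z^-\psi'\rangle$. 3. $(\mathcal Z,U_t,I_{\mathcal K})$ is a unitary dilation of $e^{-it\Upsilon}$: $I_{\mathcal K}^*U_tI_{\mathcal K}=e^{-it\Upsilon}$ for $t\ge0$. 4. $(\mathcal Z,U_t,I_{\mathcal K})$ is a Langevin–Schrödinger dynamics for the semigroup $e^{tL}$ on $\mathcal B(\mathcal K)$ with $L(S)=i(\Upsilon^*S-S\Upsilon)+\nu^*(S\otimes1)\nu$: $$I_{\mathcal K}^*\,U_{-t}\,(S\otimes1)\,U_t\,I_{\mathcal K}=e^{tL}(S),\qquad t\ge0,\ S\in\mathcal B(\mathcal K).$$ Likewise, the reversed group $U_{-t}$ is a Langevin–Schrödinger dynamics for the semigroup $e^{t\tilde L}$ with $\tilde L(S)=-i(\Upsilon S-S\Upsilon^*)+\nu^*(S\otimes1)\nu$: $$I_{\mathcal K}^*\,U_{t}\,(S\otimes1)\,U_{-t}\,I_{\mathcal K}=e^{t\tilde L}(S),\qquad t\ge0,\ S\in\mathcal B(\mathcal K).$$ -/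

import Mathlib

open MeasureTheory Filter Topology
open scoped TensorProduct DirectSum InnerProductSpace ENNReal ComplexOrder

noncomputable section

namespace WhiteNoise

/-! ### Algebraic symmetric tensors -/

section AlgebraicTensors

variable (n : ℕ) (V : Type*) [AddCommGroup V] [Module ℂ V]

/-- The symmetric tensors in the algebraic tensor power `⨂^n V`: those that are invariant under
all permutations of the factors. -/
def symSubmodule : Submodule ℂ (⨂[ℂ]^n V) where
  carrier := {x | ∀ σ : Equiv.Perm (Fin n), PiTensorProduct.reindex ℂ (fun _ => V) σ x = x}
  add_mem' hx hy σ := by rw [map_add, hx σ, hy σ]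
  zero_mem' σ := map_zero _
  smul_mem' c x hx σ := by rw [map_smul, hx σ]

/-- The space of algebraic symmetric tensors of degree `n` over `V`. -/
def SymTensor : Type _ := ↥(symSubmodule n V)

instance : AddCommGroup (SymTensor n V) := inferInstanceAs (AddCommGroup ↥(symSubmodule n V))

instance : Module ℂ (SymTensor n V) := inferInstanceAs (Module ℂ ↥(symSubmodule n V))

/-- The inclusion of the symmetric tensors into all tensors. -/
def symIncl : SymTensor n V →ₗ[ℂ] ⨂[ℂ]^n V := (symSubmodule n V).subtype

/-- The projection `Sym^n` of the tensor power onto the symmetric tensors,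
`Sym^n x = (n!)⁻¹ ∑ σ, σ x`. -/
def symmetrizer : (⨂[ℂ]^n V) →ₗ[ℂ] SymTensor n V :=
  LinearMap.codRestrict (symSubmodule n V)
    ((n.factorial : ℂ)⁻¹ • ∑ σ : Equiv.Perm (Fin n),
      (PiTensorProduct.reindex ℂ (fun _ => V) σ).toLinearMap)
    (by
      intro x σ
      simp only [LinearMap.smul_apply, LinearMap.sum_apply, map_smul, map_sum,
        LinearEquiv.coe_coe]
      congr 1
      refine Fintype.sum_equiv (Equiv.mulLeft σ) _ _ fun τ => ?_
      exact PiTensorProduct.reindex_reindex (s := fun _ => V) τ σ x)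

/-- A symmetric tensor is its own symmetrization. -/
theorem symmetrizer_symIncl (x : SymTensor n V) : symmetrizer n V (symIncl n V x) = x := by
  obtain ⟨x, hx⟩ := x
  apply Subtype.ext
  change ((n.factorial : ℂ)⁻¹ • ∑ σ : Equiv.Perm (Fin n),
      (PiTensorProduct.reindex ℂ (fun _ => V) σ).toLinearMap) x = x
  have h : ∀ σ ∈ (Finset.univ : Finset (Equiv.Perm (Fin n))),
      (PiTensorProduct.reindex ℂ (fun _ => V) σ).toLinearMap x = x := fun σ _ => hx σ
  rw [LinearMap.smul_apply, LinearMap.sum_apply, Finset.sum_congr rfl h, Finset.sum_const,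
    Finset.card_univ, Fintype.card_perm, Fintype.card_fin, ← Nat.cast_smul_eq_nsmul ℂ, smul_smul,
    inv_mul_cancel₀ (by exact_mod_cast n.factorial_ne_zero), one_smul]

/-- Splitting off the first factor, `f₀ ⊗ f₁ ⊗ ⋯ ⊗ fₙ ↦ f₀ ⊗ (f₁ ⊗ ⋯ ⊗ fₙ)`. -/
def splitFirst : (⨂[ℂ]^(n + 1) V) →ₗ[ℂ] V ⊗[ℂ] (⨂[ℂ]^n V) :=
  PiTensorProduct.lift
    (LinearMap.uncurryLeft (M := fun _ : Fin (n + 1) => V)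
      { toFun := fun v =>
          (TensorProduct.mk ℂ V (⨂[ℂ]^n V) v).compMultilinearMap (PiTensorProduct.tprod ℂ)
        map_add' := fun v w => by ext; simp
        map_smul' := fun c v => by ext; simp })

theorem splitFirst_tprod (f : Fin (n + 1) → V) :
    splitFirst n V (PiTensorProduct.tprod ℂ f)
      = f 0 ⊗ₜ[ℂ] PiTensorProduct.tprod ℂ (Fin.tail f) := by
  simp [splitFirst, LinearMap.uncurryLeft_apply]

/-- The algebraic symmetric Fock space over `V`: finite sums of algebraic symmetric tensors. -/
abbrev AlgFock : Type _ := ⨁ n : ℕ, SymTensor n V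

variable {V} {W : Type*} [AddCommGroup W] [Module ℂ W]

/-- `Γ^n(L) : f₁ ⊗ ⋯ ⊗ fₙ ↦ L f₁ ⊗ ⋯ ⊗ L fₙ` on symmetric tensors. -/
def symMap (L : V →ₗ[ℂ] W) : SymTensor n V →ₗ[ℂ] SymTensor n W :=
  LinearMap.codRestrict (symSubmodule n W)
    (PiTensorProduct.map (fun _ => L) ∘ₗ symIncl n V)
    (by
      intro x σ
      have h := PiTensorProduct.map_reindex (R := ℂ) (fun _ : Fin n => L) σ (symIncl n V x)
      simp only [LinearMap.comp_apply]
      exact h.symm.trans (congrArg _ (x.2 σ)))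

/-- Second quantization `Γ(L)` of a linear map on the algebraic Fock space. -/
def secondQuant (L : V →ₗ[ℂ] W) : AlgFock V →ₗ[ℂ] AlgFock W :=
  DirectSum.lmap fun n => symMap n L

/-- The differential second quantization of an operator `A` with domain `V`: on degree `n` it is
`∑ i, J ⊗ ⋯ ⊗ A ⊗ ⋯ ⊗ J` with `A` in place `i`, where `J : V → W` is the inclusion of
the domain. (The sum preserves symmetry, so the symmetrization changes nothing.) -/
def dGamma (J A : V →ₗ[ℂ] W) : AlgFock V →ₗ[ℂ] AlgFock W :=
  DirectSum.lmap fun n =>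
    symmetrizer n W ∘ₗ (∑ i : Fin n, PiTensorProduct.map (Function.update (fun _ => J) i A))
      ∘ₗ symIncl n V

variable {K : Type*} [AddCommGroup K] [Module ℂ K]

/-- The annihilation operator on degree `n + 1`: `√(n+1) (R* ⊗ Sym^n)`. -/
def annihSector (Rs : K ⊗[ℂ] V →ₗ[ℂ] K) :
    K ⊗[ℂ] SymTensor (n + 1) V →ₗ[ℂ] K ⊗[ℂ] SymTensor n V :=
  (Real.sqrt (n + 1) : ℂ) •
    (TensorProduct.map Rs (symmetrizer n V)
      ∘ₗ (TensorProduct.assoc ℂ K V (⨂[ℂ]^n V)).symm.toLinearMap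
      ∘ₗ LinearMap.lTensor K (splitFirst n V ∘ₗ symIncl (n + 1) V))

/-- The generalized annihilation operator `a(R)` on `K ⊗ Γ(V)`, for a not necessarily bounded map
`R* : K ⊗ V → K`. It vanishes on degree `0`. -/
def annih (Rs : K ⊗[ℂ] V →ₗ[ℂ] K) : K ⊗[ℂ] AlgFock V →ₗ[ℂ] K ⊗[ℂ] AlgFock V :=
  (DirectSum.toModule ℂ ℕ (K ⊗[ℂ] AlgFock V) fun m =>
      match m with
      | 0 => 0
      | n + 1 =>
        LinearMap.lTensor K (DirectSum.lof ℂ ℕ (fun n => SymTensor n V) n) ∘ₗ annihSector n Rs)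
    ∘ₗ (TensorProduct.directSumRight ℂ ℂ K fun n => SymTensor n V).toLinearMap

end AlgebraicTensors

/-! ### The inner product on symmetric tensors and the bosonic Fock space -/

section FockSpace

variable (n : ℕ) (R : Type*) [NormedAddCommGroup R] [InnerProductSpace ℂ R]

variable {R} in
/-- The functional `x ↦ ∏ i, ⟪f i, x i⟫` on the tensor power. -/
def innerLeft (f : Fin n → R) : (⨂[ℂ]^n R) →ₗ[ℂ] ℂ :=
  PiTensorProduct.lift
    ((MultilinearMap.mkPiAlgebra ℂ (Fin n) ℂ).compLinearMap fun i => innerₛₗ ℂ (f i))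

variable {R} in
theorem innerLeft_tprod (f g : Fin n → R) :
    innerLeft n f (PiTensorProduct.tprod ℂ g) = ∏ i, ⟪f i, g i⟫_ℂ := by
  simp [innerLeft]

variable {R} in
/-- Auxiliary: `x ↦ conj (innerLeft g x)` as a conjugate-linear functional. -/
def innerRight (g : Fin n → R) : (⨂[ℂ]^n R) →ₗ⋆[ℂ] ℂ where
  toFun x := (starRingEnd ℂ) (innerLeft n g x)
  map_add' x y := by simp
  map_smul' c x := by simp

variable {R} in
theorem innerRight_tprod (f g : Fin n → R) :
    innerRight n g (PiTensorProduct.tprod ℂ f) = ∏ i, ⟪f i, g i⟫_ℂ := by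
  change (starRingEnd ℂ) (innerLeft n g _) = _
  rw [innerLeft_tprod, map_prod]
  simp

variable {R} in
theorem semilinear_ext {φ ψ : (⨂[ℂ]^n R) →ₗ⋆[ℂ] ℂ}
    (h : ∀ f : Fin n → R, φ (PiTensorProduct.tprod ℂ f) = ψ (PiTensorProduct.tprod ℂ f)) :
    φ = ψ := by
  ext x
  induction x using PiTensorProduct.induction_on with
  | smul_tprod c f => rw [map_smulₛₗ, map_smulₛₗ, h]
  | add x y hx hy => rw [map_add, map_add, hx, hy]

/-- The sesquilinear form on the tensor power with
`⟪f₁ ⊗ ⋯ ⊗ fₙ, g₁ ⊗ ⋯ ⊗ gₙ⟫ = ∏ i, ⟪fᵢ, gᵢ⟫`, written as a linear map of its second argument. -/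
def tensorForm : (⨂[ℂ]^n R) →ₗ[ℂ] (⨂[ℂ]^n R) →ₗ⋆[ℂ] ℂ :=
  PiTensorProduct.lift
    { toFun := fun g => innerRight n g
      map_update_add' := by
        intro _ g i v w
        apply semilinear_ext
        intro f
        simp only [LinearMap.add_apply, innerRight_tprod]
        rw [← Finset.mul_prod_erase _ _ (Finset.mem_univ i),
          ← Finset.mul_prod_erase _ _ (Finset.mem_univ i),
          ← Finset.mul_prod_erase _ _ (Finset.mem_univ i)]
        simp only [Function.update_self, inner_add_right, add_mul]
        congr 2 <;>
        · refine Finset.prod_congr rfl fun j hj => ?_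
          rw [Function.update_of_ne (Finset.ne_of_mem_erase hj),
            Function.update_of_ne (Finset.ne_of_mem_erase hj)]
      map_update_smul' := by
        intro _ g i c v
        apply semilinear_ext
        intro f
        simp only [LinearMap.smul_apply, innerRight_tprod, smul_eq_mul]
        rw [← Finset.mul_prod_erase _ _ (Finset.mem_univ i),
          ← Finset.mul_prod_erase _ _ (Finset.mem_univ i)]
        simp only [Function.update_self, inner_smul_right, mul_assoc]
        congr 2
        refine Finset.prod_congr rfl fun j hj => ?_
        rw [Function.update_of_ne (Finset.ne_of_mem_erase hj),
          Function.update_of_ne (Finset.ne_of_mem_erase hj)] }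

theorem tensorForm_tprod (f g : Fin n → R) :
    tensorForm n R (PiTensorProduct.tprod ℂ g) (PiTensorProduct.tprod ℂ f)
      = ∏ i, ⟪f i, g i⟫_ℂ := by
  rw [tensorForm, PiTensorProduct.lift.tprod]
  exact innerRight_tprod n f g

theorem tensorForm_conj (x y : ⨂[ℂ]^n R) :
    (starRingEnd ℂ) (tensorForm n R x y) = tensorForm n R y x := by
  induction x using PiTensorProduct.induction_on with
  | smul_tprod c f =>
    induction y using PiTensorProduct.induction_on with
    | smul_tprod d g => simp [tensorForm_tprod, map_prod]; ring
    | add y z hy hz => simp only [map_add, LinearMap.add_apply, hy, hz]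
  | add x z hx hz => simp only [map_add, LinearMap.add_apply, hx, hz]

theorem exists_eq_sum_tprod (x : ⨂[ℂ]^n R) :
    ∃ (m : ℕ) (c : Fin m → ℂ) (f : Fin m → Fin n → R),
      x = ∑ k, c k • PiTensorProduct.tprod ℂ (f k) := by
  induction x using PiTensorProduct.induction_on with
  | smul_tprod c f => exact ⟨1, fun _ => c, fun _ => f, by simp⟩
  | add x y hx hy =>
    obtain ⟨m, c, f, rfl⟩ := hx
    obtain ⟨m', c', f', rfl⟩ := hy
    exact ⟨m + m', Fin.append c c', Fin.append f f', by simp [Fin.sum_univ_add]⟩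

theorem posSemidef_prod_gram {m : ℕ} (f : Fin m → Fin n → R) (s : Finset (Fin n)) :
    (Matrix.of fun k l => ∏ i ∈ s, ⟪f k i, f l i⟫_ℂ).PosSemidef := by
  classical
  induction s using Finset.induction_on with
  | empty =>
    have h := Matrix.posSemidef_gram ℂ (fun _ : Fin m => (1 : ℂ))
    have e : (Matrix.of fun k l => ∏ i ∈ (∅ : Finset (Fin n)), ⟪f k i, f l i⟫_ℂ)
        = Matrix.gram ℂ (fun _ : Fin m => (1 : ℂ)) := by
      ext k l
      simp
    rw [e]
    exact h
  | insert a s ha ih =>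
    have h := (Matrix.posSemidef_gram ℂ (fun k => f k a)).hadamard ih
    have e : (Matrix.of fun k l => ∏ i ∈ insert a s, ⟪f k i, f l i⟫_ℂ)
        = (Matrix.gram ℂ (fun k => f k a)).hadamard
          (Matrix.of fun k l => ∏ i ∈ s, ⟪f k i, f l i⟫_ℂ) := by
      ext k l
      simp [Finset.prod_insert ha, Matrix.hadamard]
    rw [e]
    exact h

theorem tensorForm_self_nonneg (x : ⨂[ℂ]^n R) : 0 ≤ (tensorForm n R x x).re := by
  obtain ⟨m, c, f, rfl⟩ := exists_eq_sum_tprod n R x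
  have h := (posSemidef_prod_gram n R f Finset.univ).dotProduct_mulVec_nonneg c
  have e : tensorForm n R (∑ k, c k • PiTensorProduct.tprod ℂ (f k))
      (∑ k, c k • PiTensorProduct.tprod ℂ (f k)) =
      star c ⬝ᵥ (Matrix.of fun k l => ∏ i ∈ Finset.univ, ⟪f k i, f l i⟫_ℂ).mulVec c := by
    simp only [map_sum, LinearMap.sum_apply, map_smul, LinearMap.smul_apply, map_smulₛₗ,
      tensorForm_tprod, dotProduct, Matrix.mulVec, Matrix.of_apply, smul_eq_mul, Pi.star_apply,
      Finset.mul_sum]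
    refine Finset.sum_congr rfl fun k _ => Finset.sum_congr rfl fun l _ => ?_
    simp only [starRingEnd_apply]
    ring
  rw [e]
  exact (Complex.le_def.1 h).1

/-- The inner product of `SymTensor n R`, inherited from the tensor power. -/
abbrev symCore : PreInnerProductSpace.Core ℂ (SymTensor n R) where
  inner x y := tensorForm n R (symIncl n R y) (symIncl n R x)
  conj_inner_symm x y := tensorForm_conj n R _ _
  re_inner_nonneg x := tensorForm_self_nonneg n R _
  add_left x y z := by simp only [map_add]
  smul_left x y c := by simp only [map_smul, map_smulₛₗ, smul_eq_mul]

instance : SeminormedAddCommGroup (SymTensor n R) :=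
  @InnerProductSpace.Core.toSeminormedAddCommGroup ℂ _ _ _ _ (symCore n R)

instance : InnerProductSpace ℂ (SymTensor n R) := InnerProductSpace.ofCore (symCore n R)

theorem inner_symTensor (x y : SymTensor n R) :
    ⟪x, y⟫_ℂ = tensorForm n R (symIncl n R y) (symIncl n R x) := rfl

/-- The `n`-particle space `Γ_s^n(R)`: the Hilbert space of symmetric tensors of degree `n`, as the
completion of the algebraic symmetric tensors. -/
abbrev NParticle : Type _ := UniformSpace.Completion (SymTensor n R)

/-- The bosonic Fock space `Γ_s(R)`, the Hilbert direct sum of the `n`-particle spaces. -/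
abbrev Fock : Type _ := lp (fun n : ℕ => NParticle n R) 2

/-- The embedding of the algebraic Fock space into the Fock space. -/
def fockIncl : AlgFock R →ₗ[ℂ] Fock R :=
  DirectSum.toModule ℂ ℕ (Fock R) fun n =>
    lp.lsingle (𝕜 := ℂ) (E := fun n : ℕ => NParticle n R) 2 n
      ∘ₗ (UniformSpace.Completion.toComplL (𝕜 := ℂ) (E := SymTensor n R)).toLinearMap

/-- The vacuum `1` in degree `0`. -/
def algVacuum : AlgFock R :=
  DirectSum.lof ℂ ℕ (fun n => SymTensor n R) 0
    (symmetrizer 0 R (PiTensorProduct.tprod ℂ Fin.elim0))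

/-- The vacuum vector `Ω` of the Fock space. -/
def vacuum : Fock R := fockIncl R (algVacuum R)

end FockSpace

/-! ### Tensor products with a finite dimensional space, dilations -/

section Dilations

variable {K F Z : Type*} [NormedAddCommGroup K] [InnerProductSpace ℂ K]
  [NormedAddCommGroup F] [InnerProductSpace ℂ F]
  [NormedAddCommGroup Z] [InnerProductSpace ℂ Z]

/-- If `K` is finite dimensional and `F` is a Hilbert space, then `K ⊗ F` is a Hilbert space. -/
instance completeSpace_tensor [FiniteDimensional ℂ K] [CompleteSpace F] :
    CompleteSpace (K ⊗[ℂ] F) := by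
  let b := stdOrthonormalBasis ℂ K
  let p : ∀ i, K ⊗[ℂ] F →L[ℂ] F := fun i =>
    (TensorProduct.lidIsometry ℂ F).toContinuousLinearEquiv.toContinuousLinearMap ∘L
      TensorProduct.mapL (innerSL ℂ (b i)) (ContinuousLinearMap.id ℂ F)
  have hp : ∀ x, ∑ i, b i ⊗ₜ[ℂ] p i x = x := by
    intro x
    induction x using TensorProduct.induction_on with
    | zero => simp
    | tmul k f =>
      have e : ∀ i, p i (k ⊗ₜ[ℂ] f) = ⟪b i, k⟫_ℂ • f := fun i => by simp [p]
      simp only [e, TensorProduct.tmul_smul, TensorProduct.smul_tmul']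
      rw [← TensorProduct.sum_tmul, b.sum_repr']
    | add x y hx hy => simp only [map_add, TensorProduct.tmul_add, Finset.sum_add_distrib, hx, hy]
  refine Metric.complete_of_cauchySeq_tendsto fun u hu => ?_
  have h : ∀ i, ∃ f, Tendsto (fun n => p i (u n)) atTop (𝓝 f) := fun i =>
    cauchySeq_tendsto_of_complete (hu.map (p i).uniformContinuous)
  choose f hf using h
  refine ⟨∑ i, b i ⊗ₜ[ℂ] f i, ?_⟩
  have := tendsto_finsetSum Finset.univ fun i _ =>
    ((TensorProduct.mkL ℂ K F (b i)).continuous.tendsto (f i)).comp (hf i)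
  refine this.congr fun n => ?_
  exact hp (u n)

/-- The embedding `ψ ↦ ψ ⊗ Ω`. -/
def embedVec (Ω : F) : K →L[ℂ] K ⊗[ℂ] F := (TensorProduct.mkL ℂ K F).flip Ω

/-- `S ⊗ 1`. -/
def ampl (F : Type*) [NormedAddCommGroup F] [InnerProductSpace ℂ F] (S : K →L[ℂ] K) :
    K ⊗[ℂ] F →L[ℂ] K ⊗[ℂ] F :=
  TensorProduct.mapL S (ContinuousLinearMap.id ℂ F)

theorem ampl_add (S T : K →L[ℂ] K) : ampl F (S + T) = ampl F S + ampl F T := by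
  ext x
  simp [ampl, TensorProduct.map_add_left]

theorem ampl_smul (c : ℂ) (S : K →L[ℂ] K) : ampl F (c • S) = c • ampl F S := by
  ext x
  simp [ampl, TensorProduct.map_smul_left]

/-- `U` is a strongly continuous one-parameter unitary group. -/
structure IsUnitaryGroup [CompleteSpace Z] (U : ℝ → Z →L[ℂ] Z) : Prop where
  unitary : ∀ t, U t ∈ unitary (Z →L[ℂ] Z)
  zero : U 0 = 1
  add : ∀ s t, U (s + t) = U s * U t
  continuous : ∀ ψ, Continuous fun t => U t ψ

/-- `(Z, U, I)` is a unitary dilation of `Θ` (indexed by `t ≥ 0`). -/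
structure IsUnitaryDilation [CompleteSpace K] [CompleteSpace Z] (U : ℝ → Z →L[ℂ] Z)
    (I : K →L[ℂ] Z) (Θ : ℝ → K →L[ℂ] K) : Prop where
  group : IsUnitaryGroup U
  isometry : Isometry I
  dilation : ∀ t, 0 ≤ t → I.adjoint ∘L U t ∘L I = Θ t

/-- `(K ⊗ F, U, I)` with `I ψ = ψ ⊗ Ω` is a Langevin-Schrödinger dynamics for `Λ`
(indexed by `t ≥ 0`). -/
structure IsLangevinSchrodinger [FiniteDimensional ℂ K] [CompleteSpace K] [CompleteSpace F]
    (U : ℝ → K ⊗[ℂ] F →L[ℂ] K ⊗[ℂ] F) (Ω : F)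
    (Λ : ℝ → (K →L[ℂ] K) →L[ℂ] (K →L[ℂ] K)) : Prop where
  group : IsUnitaryGroup U
  norm_vacuum : ‖Ω‖ = 1
  dilation : ∀ t, 0 ≤ t → ∀ S : K →L[ℂ] K,
    (embedVec (K := K) Ω).adjoint ∘L U (-t) ∘L ampl F S ∘L U t ∘L embedVec Ω = Λ t S

end Dilations

/-! ### The reservoir `L²(ℝ, 𝔥)` and its white noise -/

section Reservoir

variable (𝔥 : Type*) [NormedAddCommGroup 𝔥] [InnerProductSpace ℂ 𝔥]

/-- The one-particle space `L²(ℝ, 𝔥)`. -/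
abbrev OneParticle : Type _ := Lp 𝔥 2 (volume : Measure ℝ)

/-- The domain `{f | x f ∈ L²}` of the operator of multiplication by the variable `x`. -/
def DomX : Submodule ℂ (OneParticle 𝔥) where
  carrier := {f | MemLp (fun x : ℝ => (x : ℂ) • f x) 2 volume}
  add_mem' := by
    intro f g hf hg
    refine (MemLp.add hf hg).ae_eq ?_
    filter_upwards [Lp.coeFn_add f g] with x hx
    rw [hx, Pi.add_apply, Pi.add_apply, smul_add]
  zero_mem' := by
    refine (MemLp.zero (ε := 𝔥)).ae_eq ?_
    filter_upwards [Lp.coeFn_zero 𝔥 2 (volume : Measure ℝ)] with x hx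
    rw [hx, Pi.zero_apply, smul_zero]
  smul_mem' := by
    intro c f hf
    refine (MemLp.const_smul hf c).ae_eq ?_
    filter_upwards [Lp.coeFn_smul c f] with x hx
    rw [hx, Pi.smul_apply, Pi.smul_apply, smul_comm]

variable {𝔥}

theorem memLp_of_mem_domX (f : DomX 𝔥) : MemLp (fun x : ℝ => (x : ℂ) • f.1 x) 2 volume := f.2

/-- The operator `Z_R` of multiplication by the variable `x` on `L²(ℝ, 𝔥)`. -/
def mulX : OneParticle 𝔥 →ₗ.[ℂ] OneParticle 𝔥 where
  domain := DomX 𝔥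
  toFun :=
    { toFun := fun f => MemLp.toLp _ (memLp_of_mem_domX f)
      map_add' := by
        intro f g
        rw [← MemLp.toLp_add]
        refine MemLp.toLp_congr _ _ ?_
        filter_upwards [Lp.coeFn_add f.1 g.1] with x hx
        rw [Submodule.coe_add, hx, Pi.add_apply, Pi.add_apply, smul_add]
      map_smul' := by
        intro c f
        rw [RingHom.id_apply, ← MemLp.toLp_const_smul]
        refine MemLp.toLp_congr _ _ ?_
        filter_upwards [Lp.coeFn_smul c f.1] with x hx
        rw [Submodule.coe_smul, hx, Pi.smul_apply, Pi.smul_apply, smul_comm] }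

/-- `Dom Z_R ⊆ L¹`. -/
theorem integrable_of_mem_domX (f : DomX 𝔥) : Integrable (fun x => f.1 x) volume := by
  have hw : MemLp (fun x : ℝ => (((Real.sqrt (1 + x ^ 2))⁻¹ : ℝ) : ℂ)) 2 volume := by
    have hc : Continuous fun x : ℝ => (Real.sqrt (1 + x ^ 2))⁻¹ :=
      Continuous.inv₀ (by fun_prop) fun x => (Real.sqrt_pos.2 (by positivity)).ne'
    refine MemLp.ofReal (f := fun x : ℝ => (Real.sqrt (1 + x ^ 2))⁻¹) ?_
    refine (memLp_two_iff_integrable_sq hc.aestronglyMeasurable).2 ?_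
    refine integrable_inv_one_add_sq.congr (Eventually.of_forall fun x => ?_)
    simp only [inv_pow]
    rw [Real.sq_sqrt (by positivity)]
  have hg : MemLp (fun x : ℝ => ((Real.sqrt (1 + x ^ 2) : ℝ) : ℂ) • f.1 x) 2 volume := by
    refine MemLp.of_le ((Lp.memLp f.1).norm.add (memLp_of_mem_domX f).norm) ?_ ?_
    · have hc : Continuous fun x : ℝ => ((Real.sqrt (1 + x ^ 2) : ℝ) : ℂ) :=
        Complex.continuous_ofReal.comp (by fun_prop)
      exact hc.aestronglyMeasurable.smul (Lp.memLp f.1).1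
    · refine Eventually.of_forall fun x => ?_
      simp only [Pi.add_apply, norm_smul, Complex.norm_real, Real.norm_eq_abs]
      rw [abs_of_nonneg (Real.sqrt_nonneg _), abs_of_nonneg (by positivity)]
      have h : Real.sqrt (1 + x ^ 2) ≤ 1 + |x| := by
        rw [Real.sqrt_le_left (by positivity)]
        nlinarith [abs_nonneg x, sq_abs x]
      nlinarith [norm_nonneg (f.1 x)]
  have h : MemLp (fun x : ℝ => (((Real.sqrt (1 + x ^ 2))⁻¹ : ℝ) : ℂ) •
      ((Real.sqrt (1 + x ^ 2) : ℝ) : ℂ) • f.1 x) 1 volume := hg.smul hw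
  rw [memLp_one_iff_integrable] at h
  refine h.congr (Eventually.of_forall fun x => ?_)
  simp only [smul_smul, ← Complex.ofReal_mul]
  rw [inv_mul_cancel₀ (Real.sqrt_pos.2 (by positivity)).ne', Complex.ofReal_one, one_smul]

theorem memLp_exp (t : ℝ) {g : ℝ → 𝔥} (hg : MemLp g 2 volume) :
    MemLp (fun x : ℝ => Complex.exp (Complex.I * t * x) • g x) 2 volume := by
  refine hg.of_le ?_ ?_
  · exact (Continuous.aestronglyMeasurable (by fun_prop)).smul hg.1
  · refine Eventually.of_forall fun x => ?_
    rw [norm_smul, Complex.norm_exp]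
    simp

/-- `e^{itZ_R}`, multiplication by `e^{itx}`, on `L²(ℝ, 𝔥)`. -/
def mulExp (t : ℝ) : OneParticle 𝔥 →ₗ[ℂ] OneParticle 𝔥 where
  toFun f := MemLp.toLp _ (memLp_exp t (Lp.memLp f))
  map_add' f g := by
    rw [← MemLp.toLp_add]
    refine MemLp.toLp_congr _ _ ?_
    filter_upwards [Lp.coeFn_add f g] with x hx
    rw [hx, Pi.add_apply, Pi.add_apply, smul_add]
  map_smul' c f := by
    rw [RingHom.id_apply, ← MemLp.toLp_const_smul]
    refine MemLp.toLp_congr _ _ ?_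
    filter_upwards [Lp.coeFn_smul c f] with x hx
    rw [hx, Pi.smul_apply, Pi.smul_apply, smul_comm]

theorem mulExp_mem_domX (t : ℝ) (f : OneParticle 𝔥) (hf : f ∈ DomX 𝔥) :
    mulExp t f ∈ DomX 𝔥 := by
  refine (memLp_exp t (memLp_of_mem_domX ⟨f, hf⟩)).ae_eq ?_
  filter_upwards [MemLp.coeFn_toLp (memLp_exp t (Lp.memLp f))] with x hx
  change _ = (x : ℂ) • (MemLp.toLp _ (memLp_exp t (Lp.memLp f)) : OneParticle 𝔥) x
  rw [hx, smul_comm]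

/-- `e^{itZ_R}` restricted to the domain of `Z_R`, which it preserves. -/
def expX (t : ℝ) : DomX 𝔥 →ₗ[ℂ] DomX 𝔥 :=
  (mulExp t).restrict (mulExp_mem_domX t)

/-- The functional `⟨1| ⊗ 1 : f ↦ ∫ f`, with values in `𝔥`. -/
def braOne : DomX 𝔥 →ₗ[ℂ] 𝔥 where
  toFun f := ∫ x, f.1 x
  map_add' f g := by
    rw [← integral_add (integrable_of_mem_domX f) (integrable_of_mem_domX g)]
    exact integral_congr_ae (Lp.coeFn_add f.1 g.1)
  map_smul' c f := by
    rw [RingHom.id_apply, ← integral_smul]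
    exact integral_congr_ae (Lp.coeFn_smul c f.1)

end Reservoir

/-! ### The data `(K, Re Υ, 𝔥, ν)` and the associated objects -/

section Data

variable (K 𝔥 : Type*) [NormedAddCommGroup K] [InnerProductSpace ℂ K]
  [NormedAddCommGroup 𝔥] [InnerProductSpace ℂ 𝔥]

/-- The Hilbert space `Z = K ⊗ Γ_s(L²(ℝ, 𝔥))`. -/
abbrev TotalSpace : Type _ := K ⊗[ℂ] Fock (OneParticle 𝔥)

/-- The space `D = K ⊗ Γ_s(Dom Z_R)` (algebraic tensor products). -/
abbrev AlgDom : Type _ := K ⊗[ℂ] AlgFock (DomX 𝔥)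

/-- The inclusion `D → Z`. -/
def inclD : AlgDom K 𝔥 →ₗ[ℂ] TotalSpace K 𝔥 :=
  LinearMap.lTensor K (fockIncl (OneParticle 𝔥) ∘ₗ secondQuant (DomX 𝔥).subtype)

/-- `dΓ(Z_R)` as an operator with domain `D`. -/
def dGammaX : AlgDom K 𝔥 →ₗ[ℂ] TotalSpace K 𝔥 :=
  LinearMap.lTensor K
    (fockIncl (OneParticle 𝔥) ∘ₗ dGamma (DomX 𝔥).subtype (mulX (𝔥 := 𝔥)).toFun)

/-- `e^{itdΓ(Z_R)} = Γ(e^{itZ_R})` on `D`. -/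
def freeD (t : ℝ) : AlgDom K 𝔥 →ₗ[ℂ] AlgDom K 𝔥 :=
  LinearMap.lTensor K (secondQuant (expX t))

variable {𝔥}

/-- `a(e^{itZ_R}|1⟩ ⊗ b)` on `D`, the annihilation operator for
`R* : k ⊗ f ↦ ⟪b, ∫ e^{-itx} f(x) dx⟫ k`. -/
def annihExp (t : ℝ) (b : 𝔥) : Module.End ℂ (AlgDom K 𝔥) :=
  annih ((TensorProduct.rid ℂ K).toLinearMap
    ∘ₗ LinearMap.lTensor K (innerₛₗ ℂ b ∘ₗ braOne ∘ₗ expX (-t)))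

variable {K}
variable [FiniteDimensional ℂ K] [CompleteSpace K] [CompleteSpace 𝔥]

/-- `a(|1⟩ ⊗ ν)` on `D`, the annihilation operator for `R* : k ⊗ f ↦ ν* (k ⊗ ∫ f)`. -/
def annihNu (ν : K →L[ℂ] K ⊗[ℂ] 𝔥) : Module.End ℂ (AlgDom K 𝔥) :=
  annih (ν.adjoint.toLinearMap ∘ₗ LinearMap.lTensor K braOne)

/-- The operator `Υ = E - (i/2) ν* ν` with real part `E`; that is, `-iΥ + iΥ* = -ν* ν`. -/
def upsilon (E : K →L[ℂ] K) (ν : K →L[ℂ] K ⊗[ℂ] 𝔥) : K →L[ℂ] K :=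
  E - (Complex.I / 2) • (ν.adjoint ∘L ν)

/-- The Lindblad generator `S ↦ i(Υ* S - S Υ) + ν* (S ⊗ 1) ν`. -/
def lindblad (E : K →L[ℂ] K) (ν : K →L[ℂ] K ⊗[ℂ] 𝔥) : (K →L[ℂ] K) →L[ℂ] (K →L[ℂ] K) :=
  LinearMap.toContinuousLinearMap
    { toFun := fun S =>
        Complex.I • ((upsilon E ν).adjoint ∘L S - S ∘L upsilon E ν)
          + ν.adjoint ∘L ampl 𝔥 S ∘L ν
      map_add' := fun S T => by
        ext x
        simp [ampl_add]
        module
      map_smul' := fun c S => by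
        ext x
        simp [ampl_smul]
        module }

/-- The Lindblad generator `S ↦ -i(Υ S - S Υ*) + ν* (S ⊗ 1) ν`. -/
def lindbladBack (E : K →L[ℂ] K) (ν : K →L[ℂ] K ⊗[ℂ] 𝔥) : (K →L[ℂ] K) →L[ℂ] (K →L[ℂ] K) :=
  LinearMap.toContinuousLinearMap
    { toFun := fun S =>
        (-Complex.I) • (upsilon E ν ∘L S - S ∘L (upsilon E ν).adjoint)
          + ν.adjoint ∘L ampl 𝔥 S ∘L ν
      map_add' := fun S T => by
        ext x
        simp [ampl_add]
        module
      map_smul' := fun c S => by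
        ext x
        simp [ampl_smul]
        module }

/-- The terms common to `Z⁺` and `Z⁻`, as a quadratic form on `D`:
`(2π)^{-1/2} a(|1⟩ ⊗ ν) + (2π)^{-1/2} a*(|1⟩ ⊗ ν) + dΓ(Z_R)`, where the form `a*` is the adjoint of
the form `a`. -/
def formCommon (ν : K →L[ℂ] K ⊗[ℂ] 𝔥) (ψ φ : AlgDom K 𝔥) : ℂ :=
  (Real.sqrt (2 * Real.pi) : ℂ)⁻¹ * ⟪inclD K 𝔥 ψ, inclD K 𝔥 (annihNu ν φ)⟫_ℂ
    + (Real.sqrt (2 * Real.pi) : ℂ)⁻¹ * ⟪inclD K 𝔥 (annihNu ν ψ), inclD K 𝔥 φ⟫_ℂ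
    + ⟪inclD K 𝔥 ψ, dGammaX K 𝔥 φ⟫_ℂ

/-- The quadratic form `Z⁺` on `D`. -/
def formPlus (E : K →L[ℂ] K) (ν : K →L[ℂ] K ⊗[ℂ] 𝔥) (ψ φ : AlgDom K 𝔥) : ℂ :=
  ⟪inclD K 𝔥 ψ, ampl _ (upsilon E ν) (inclD K 𝔥 φ)⟫_ℂ + formCommon ν ψ φ

/-- The quadratic form `Z⁻` on `D`. -/
def formMinus (E : K →L[ℂ] K) (ν : K →L[ℂ] K ⊗[ℂ] 𝔥) (ψ φ : AlgDom K 𝔥) : ℂ :=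
  ⟪inclD K 𝔥 ψ, ampl _ (upsilon E ν).adjoint (inclD K 𝔥 φ)⟫_ℂ + formCommon ν ψ φ

/-- `ν = ∑ j, C j ⊗ |b j⟩`. -/
def IsDecomposition (ν : K →L[ℂ] K ⊗[ℂ] 𝔥) {J : Type*} [Fintype J] (C : J → K →L[ℂ] K)
    (b : J → 𝔥) : Prop :=
  ∀ k, ν k = ∑ j, C j k ⊗ₜ[ℂ] b j

/-- `C⁺ = C` (for `ε = true`) and `C⁻ = C*` (for `ε = false`). -/
def signed (C : K →L[ℂ] K) (ε : Bool) : K →L[ℂ] K := if ε then C else C.adjoint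

/-- `e^{-i(t-τₙ)Υ} cₙ e^{-i(τₙ-τₙ₋₁)Υ} ⋯ c₁ e^{-iτ₁Υ}`. -/
def word (Y : K →L[ℂ] K) : (n : ℕ) → (Fin n → ℝ) → (Fin n → K →L[ℂ] K) → ℝ → K →L[ℂ] K
  | 0, _, _, t => NormedSpace.exp ((-Complex.I * t) • Y)
  | n + 1, τ, c, t =>
    NormedSpace.exp ((-Complex.I * (t - τ (Fin.last n) : ℝ)) • Y) * c (Fin.last n)
      * word Y n (Fin.init τ) (Fin.init c) (τ (Fin.last n))

/-- The product of the (commuting) operators `a(e^{iτ_p Z_R}|1⟩ ⊗ b_p)` over those `p` with sign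
`ε p = s`. -/
def annihProd {n : ℕ} (τ : Fin n → ℝ) (b : Fin n → 𝔥) (ε : Fin n → Bool) (s : Bool) :
    Module.End ℂ (AlgDom K 𝔥) :=
  (((List.finRange n).filter fun p => ε p == s).map fun p => annihExp K (τ p) (b p)).prod

/-- The simplex `0 < τ₁ < ⋯ < τₙ < t`. -/
def simplex (n : ℕ) (t : ℝ) : Set (Fin n → ℝ) :=
  {τ | StrictMono τ ∧ ∀ p, 0 < τ p ∧ τ p < t}

/-- The integrand of the `n`-th term of the series for `⟨ψ| U_t φ⟩`, with `e^{-itdΓ(Z_R)}` and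
the creation operators moved to the left-hand vector as their adjoints. -/
def dysonIntegrand (Y : K →L[ℂ] K) {J : Type*} [Fintype J] (C : J → K →L[ℂ] K) (b : J → 𝔥)
    (t : ℝ) (ψ φ : AlgDom K 𝔥) (n : ℕ) (τ : Fin n → ℝ) : ℂ :=
  ∑ j : Fin n → J, ∑ ε : Fin n → Bool,
    (-Complex.I) ^ n * ((Real.sqrt (2 * Real.pi) : ℂ)⁻¹) ^ n *
      ⟪inclD K 𝔥 (annihProd τ (b ∘ j) ε true (freeD K 𝔥 t ψ)),
        ampl _ (word Y n τ (fun p => signed (C (j p)) (ε p)) t)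
          (inclD K 𝔥 (annihProd τ (b ∘ j) ε false φ))⟫_ℂ

end Data

end WhiteNoise

end

/-!
The group is constructed in the interaction picture: `V_t = e^{it dΓ(Z_R)} U_t` solves a quantum
stochastic differential equation of Hudson and Parthasarathy, with drift `Y = -iΥ` and noise
coefficients `L i = -i (1 ⊗ ⟨e i|) ν` for an orthonormal basis `e` of `𝔥`. The Fourier transform,
with kernel `(2π)^{-1/2} e^{-isx}`, makes one-particle vectors into functions of time, called labels
here. On labels `e^{itx}` is a translation, and the singular vector `e^{itZ_R}|1⟩` becomes evaluation
at time `t`.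

*Existence.* Between the exponential vectors of two labels `f` and `g` the cocycle must have the
matrix elements `e^{⟪f, g⟫} ⟪k', W k⟫`, where `W` is the propagator of the bounded generator
`-i (Υ + (1 ⊗ ⟨f s|) ν + ((1 ⊗ ⟨g s|) ν)†)` on `K` (`gen_eq_coef`, `propagator`). Vectors with these
matrix elements are found as weak limits of products of short-time steps, in which the exponential
vector is displaced on one interval of the time axis (`approx`, `exists_weak_limit_approx`). A step
acts on operators on `K` by `Q ↦ Q + δ (Y† Q + Q Y + ∑ i, L i† Q L i) + ⋯`. For `Q = 1` the first
order vanishes, because `-iΥ + iΥ* = -ν*ν` (`drift_add_adjoint`). Hence the limit is an isometry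
(`tendsto_semiStep_one`), and the vacuum expectation of `V_t† (S ⊗ 1) V_t` is the Lindblad semigroup
(`exists_cocycle`). The adjoint of `V_t` is the cocycle of the time-reversed data, so it is an
isometry too and dilates the second semigroup (`cocycle_adjoint`). The propagators compose, and the
free evolution translates labels; this gives the cocycle identity (`cocycle_comp`) and the unitary
group (`exists_unitaryGroup`).

*The series.* Comparing coefficients of powers transfers the integral equation from exponential
vectors to powers `f ⊗ ⋯ ⊗ f`, which span the algebraic domain by polarization
(`apply_fockPow_of_expVec`, `factorial_smul_symTprod`, `IsCocycle.inner_inclD`). Variation of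
constants turns this equation into the recursion satisfied by the terms of the series
(`IsCocycle.inner_eq_add_integral`, `dysonForm_snoc`). Each use of the recursion annihilates a
particle on one of the two sides, so on the algebraic domain the series is a finite sum, equal to the
matrix element of `V_t`, whatever the decomposition of `ν` (`IsCocycle.hasSum_dysonTerm`).

*The derivative.* For `t > 0` the product rule for `e^{it dΓ(Z_R)}` and `V_t` gives the derivative of
`⟪ψ, U_t φ⟫` as an expression that is continuous up to `t = 0`, where its value is `-i Z⁺`
(`IsCocycle.hasDerivAt_freeD`, `groupRate_zero`). Taking adjoints gives the statement for `t < 0`,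
and `Z⁻` is the adjoint form of `Z⁺` (`conj_formPlus`).
-/

set_option linter.unusedSectionVars false


noncomputable section

namespace WhiteNoise

/-! ### Total families in Hilbert spaces -/

section Total

variable {H H' X : Type*} [NormedAddCommGroup H] [InnerProductSpace ℂ H]
  [NormedAddCommGroup H'] [InnerProductSpace ℂ H']

/-- A family of vectors is total if its linear span is dense. -/
def Total (v : X → H) : Prop := Dense (Submodule.span ℂ (Set.range v) : Set H)

theorem Total.denseRange {v : X → H} (hv : Total v) :
    DenseRange (Finsupp.linearCombination ℂ v) := by
  have h := Finsupp.range_linearCombination ℂ (v := v)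
  unfold DenseRange
  rw [← LinearMap.coe_range, h]
  exact hv

theorem Total.mem_of_isClosed {v : X → H} (hv : Total v) {S : Submodule ℂ H}
    (hS : IsClosed (S : Set H)) (h : ∀ x, v x ∈ S) (y : H) : y ∈ S := by
  have h1 : Submodule.span ℂ (Set.range v) ≤ S := Submodule.span_le.2 (by rintro _ ⟨x, rfl⟩; exact h x)
  have h2 : y ∈ closure (Submodule.span ℂ (Set.range v) : Set H) := hv y
  exact hS.closure_subset_iff.2 h1 h2

theorem Total.clm_ext {v : X → H} (hv : Total v) {T S : H →L[ℂ] H'}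
    (h : ∀ x, T (v x) = S (v x)) : T = S := by
  ext y
  refine hv.mem_of_isClosed (S := LinearMap.eqLocus T.toLinearMap S.toLinearMap) ?_ h y
  exact isClosed_eq T.continuous S.continuous

theorem Total.ext_inner {v : X → H} (hv : Total v) {y z : H}
    (h : ∀ x, ⟪v x, y⟫_ℂ = ⟪v x, z⟫_ℂ) : y = z := by
  have : (innerSL ℂ y : H →L[ℂ] ℂ) = innerSL ℂ z := hv.clm_ext fun x => by
    simp only [innerSL_apply_apply]
    rw [← inner_conj_symm, h, inner_conj_symm]
  refine ext_inner_right ℂ fun u => ?_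
  simpa using congrArg (fun f => f u) this

/-- Two families with the same Gram matrix are related by an isometry. -/
theorem Total.exists_isometry [CompleteSpace H'] {v : X → H} (hv : Total v) (w : X → H')
    (hG : ∀ x y, ⟪w x, w y⟫_ℂ = ⟪v x, v y⟫_ℂ) :
    ∃ T : H →L[ℂ] H', (∀ x, T (v x) = w x) ∧ ∀ a b, ⟪T a, T b⟫_ℂ = ⟪a, b⟫_ℂ := by
  let f := Finsupp.linearCombination ℂ w
  let e := Finsupp.linearCombination ℂ v
  have hn : ∀ c, ‖f c‖ = ‖e c‖ := by
    intro c
    rw [@norm_eq_sqrt_re_inner ℂ, @norm_eq_sqrt_re_inner ℂ]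
    simp only [f, e, Finsupp.linearCombination_apply, Finsupp.sum, sum_inner, inner_sum,
      inner_smul_left, inner_smul_right, hG]
  have he : DenseRange e := hv.denseRange
  have hT : ∀ c, f.extendOfNorm e (e c) = f c :=
    LinearMap.extendOfNorm_eq he ⟨1, fun c => by rw [one_mul, hn]⟩
  have hTn : ∀ x, ‖f.extendOfNorm e x‖ = ‖x‖ := fun x =>
    he.induction_on x (isClosed_eq (by fun_prop) (by fun_prop)) fun c => by rw [hT, hn]
  refine ⟨f.extendOfNorm e, fun x => ?_, fun a b => ?_⟩
  · have := hT (Finsupp.single x 1)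
    simpa [e, f] using this
  · exact LinearIsometry.inner_map_map
      (⟨(f.extendOfNorm e).toLinearMap, hTn⟩ : H →ₗᵢ[ℂ] H') a b

/-- A bounded sequence whose inner products with the members of a total family converge has a weak
limit. -/
theorem Total.exists_weak_limit [CompleteSpace H] {v : X → H} (hv : Total v) {u : ℕ → H} {C : ℝ}
    (hu : ∀ n, ‖u n‖ ≤ C) {l : X → ℂ} (hl : ∀ x, Tendsto (fun n => ⟪v x, u n⟫_ℂ) atTop (𝓝 (l x))) :
    ∃ y : H, ∀ z, Tendsto (fun n => ⟪z, u n⟫_ℂ) atTop (𝓝 ⟪z, y⟫_ℂ) := by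
  have hC : 0 ≤ C := (norm_nonneg _).trans (hu 0)
  have hcau : ∀ z, CauchySeq fun n => ⟪u n, z⟫_ℂ := by
    let S : Submodule ℂ H :=
      { carrier := {z | CauchySeq fun n => ⟪u n, z⟫_ℂ}
        add_mem' := by
          intro a b ha hb
          obtain ⟨x, hx⟩ := cauchySeq_tendsto_of_complete ha
          obtain ⟨y, hy⟩ := cauchySeq_tendsto_of_complete hb
          exact ((hx.add hy).congr fun n => (inner_add_right _ _ _).symm).cauchySeq
        zero_mem' := by simpa using cauchySeq_const (0 : ℂ)
        smul_mem' := by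
          intro c a ha
          obtain ⟨x, hx⟩ := cauchySeq_tendsto_of_complete ha
          exact ((hx.const_mul c).congr fun n => (inner_smul_right _ _ _).symm).cauchySeq }
    refine hv.mem_of_isClosed (S := S) ?_ ?_
    · refine isClosed_of_closure_subset fun z hz => ?_
      change CauchySeq _
      rw [Metric.cauchySeq_iff']
      intro ε hε
      obtain ⟨z', hz', hd⟩ := Metric.mem_closure_iff.1 hz (ε / (3 * (C + 1))) (by positivity)
      obtain ⟨N, hN⟩ := Metric.cauchySeq_iff'.1 (show CauchySeq _ from hz') (ε / 3) (by positivity)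
      refine ⟨N, fun n hn => ?_⟩
      have key : ∀ m, dist ⟪u m, z⟫_ℂ ⟪u m, z'⟫_ℂ < ε / 3 := fun m => by
        rw [dist_eq_norm, ← inner_sub_right]
        refine (norm_inner_le_norm _ _).trans_lt ?_
        rw [← dist_eq_norm]
        calc ‖u m‖ * dist z z' ≤ C * dist z z' := by gcongr; exact hu m
          _ ≤ (C + 1) * dist z z' := by gcongr; linarith
          _ < (C + 1) * (ε / (3 * (C + 1))) := by gcongr
          _ = ε / 3 := by field_simp
      calc dist ⟪u n, z⟫_ℂ ⟪u N, z⟫_ℂ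
          ≤ dist ⟪u n, z⟫_ℂ ⟪u n, z'⟫_ℂ + dist ⟪u n, z'⟫_ℂ ⟪u N, z'⟫_ℂ
            + dist ⟪u N, z'⟫_ℂ ⟪u N, z⟫_ℂ := dist_triangle4 _ _ _ _
        _ < ε / 3 + ε / 3 + ε / 3 := by
          gcongr
          · exact key n
          · exact hN n hn
          · rw [dist_comm]; exact key N
        _ = ε := by ring
    · intro x
      have h := (Complex.continuous_conj.tendsto _).comp (hl x)
      refine Tendsto.cauchySeq (x := (starRingEnd ℂ) (l x)) (h.congr fun n => ?_)
      simp
  choose g hg using fun z => cauchySeq_tendsto_of_complete (hcau z)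
  let G := continuousLinearMapOfTendsto (fun n => innerSL ℂ (u n)) (l := atTop) (f := g)
    (tendsto_pi_nhds.2 fun z => by simpa using hg z)
  refine ⟨(InnerProductSpace.toDual ℂ H).symm G, fun z => ?_⟩
  have h := (Complex.continuous_conj.tendsto _).comp (hg z)
  have e : (starRingEnd ℂ) (g z) = ⟪z, (InnerProductSpace.toDual ℂ H).symm G⟫_ℂ := by
    rw [← inner_conj_symm, InnerProductSpace.toDual_symm_apply]
    rfl
  rw [← e]
  exact h.congr fun n => by simp

variable {K F : Type*} [NormedAddCommGroup K] [InnerProductSpace ℂ K]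
  [NormedAddCommGroup F] [InnerProductSpace ℂ F]

theorem Total.tmul {e : X → F} (he : Total e) :
    Total (fun p : K × X => p.1 ⊗ₜ[ℂ] e p.2) := by
  have h1 : ∀ (k : K) (f : F), k ⊗ₜ[ℂ] f ∈ (Submodule.span ℂ
      (Set.range fun p : K × X => p.1 ⊗ₜ[ℂ] e p.2)).topologicalClosure := by
    intro k f
    let S := (Submodule.span ℂ
      (Set.range fun p : K × X => p.1 ⊗ₜ[ℂ] e p.2)).topologicalClosure
    change f ∈ Submodule.comap (TensorProduct.mkL ℂ K F k).toLinearMap S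
    refine he.mem_of_isClosed ?_ ?_ f
    · exact (Submodule.isClosed_topologicalClosure _).preimage
        (TensorProduct.mkL ℂ K F k).continuous
    · intro x
      exact Submodule.le_topologicalClosure _ (Submodule.subset_span ⟨(k, x), rfl⟩)
  intro y
  change y ∈ (Submodule.span ℂ (Set.range fun p : K × X => p.1 ⊗ₜ[ℂ] e p.2)).topologicalClosure
  induction y using TensorProduct.induction_on with
  | zero => exact zero_mem _
  | tmul k f => exact h1 k f
  | add x y hx hy => exact add_mem hx hy

@[simp]
theorem ampl_tmul (S : K →L[ℂ] K) (k : K) (f : F) : ampl F S (k ⊗ₜ[ℂ] f) = S k ⊗ₜ[ℂ] f := rfl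

theorem ampl_adjoint [FiniteDimensional ℂ K] [CompleteSpace K] [CompleteSpace F] (S : K →L[ℂ] K) :
    (ampl F S).adjoint = ampl F S.adjoint := by
  unfold ampl
  rw [TensorProduct.adjoint_mapL]
  congr 1
  exact ContinuousLinearMap.ext fun x => ext_inner_left ℂ fun y => by
    rw [ContinuousLinearMap.adjoint_inner_right]; rfl

theorem ampl_mul (S T : K →L[ℂ] K) : ampl F (S * T) = ampl F S * ampl F T := by
  unfold ampl
  rw [← TensorProduct.mapL_mul]
  rfl

theorem ampl_one : ampl F (1 : K →L[ℂ] K) = 1 := TensorProduct.mapL_id_id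

end Total

/-! ### Propagators of bounded measurable generators -/

section Propagator

/-- The discrete Grönwall estimate behind the convergence of all products of short-time steps. -/
theorem le_of_step_recursion {d : ℕ → ℝ → ℝ} {δ ρ ε : ℝ} {N : ℕ} (hρ : 1 ≤ ρ) (hε : 0 ≤ ε)
    (h0 : ∀ a, d 0 a ≤ 0) (h : ∀ n < N, ∀ a, d (n + 1) a ≤ ρ * d n (a + δ) + ε) {n : ℕ} (hn : n ≤ N)
    (a : ℝ) : d n a ≤ n * ρ ^ n * ε := by
  induction n generalizing a with
  | zero => simpa using h0 a
  | succ n ih =>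
    have h1 : (1 : ℝ) ≤ ρ ^ (n + 1) := one_le_pow₀ hρ
    calc d (n + 1) a ≤ ρ * d n (a + δ) + ε := h n hn a
      _ ≤ ρ * (n * ρ ^ n * ε) + 1 * ε := by
        rw [one_mul]; gcongr; exact ih (by omega) _
      _ ≤ ρ * (n * ρ ^ n * ε) + ρ ^ (n + 1) * ε := by gcongr
      _ = ((n + 1 : ℕ) : ℝ) * ρ ^ (n + 1) * ε := by push_cast; ring

/-- A sum of `N` errors of second order in the step length `T / N` vanishes in the limit. -/
theorem tendsto_of_step_bound {E : Type*} [SeminormedAddCommGroup E] {u : ℕ → E} {x : E} {T C D : ℝ}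
    (h : ∀ N : ℕ, N ≠ 0 →
      ‖u N - x‖ ≤ N * Real.exp (C * (T / N)) ^ N * (D * (T / N) ^ 2)) :
    Tendsto u atTop (𝓝 x) := by
  rw [tendsto_iff_norm_sub_tendsto_zero]
  have h1 : Tendsto (fun N : ℕ => (Real.exp (C * T) * D * T ^ 2) * (N : ℝ)⁻¹) atTop (𝓝 0) := by
    simpa using (tendsto_inv_atTop_nhds_zero_nat (𝕜 := ℝ)).const_mul (Real.exp (C * T) * D * T ^ 2)
  refine squeeze_zero' (Eventually.of_forall fun _ => norm_nonneg _) ?_ h1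
  filter_upwards [eventually_ne_atTop 0] with N hN
  refine (h N hN).trans (le_of_eq ?_)
  have hN' : (N : ℝ) ≠ 0 := by exact_mod_cast hN
  rw [← Real.exp_nat_mul]
  have : (N : ℝ) * (C * (T / N)) = C * T := by field_simp
  rw [this]
  field_simp

variable {A : Type*} [NormedRing A]

/-- A bounded measurable time-dependent generator. -/
structure IsBddGen (G : ℝ → A) (M : ℝ) : Prop where
  meas : AEStronglyMeasurable G volume
  bound : ∀ s, ‖G s‖ ≤ M

theorem IsBddGen.nonneg {G : ℝ → A} {M : ℝ} (hG : IsBddGen G M) : 0 ≤ M :=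
  (norm_nonneg _).trans (hG.bound 0)

theorem IsBddGen.intervalIntegrable_mul {G : ℝ → A} {M : ℝ} (hG : IsBddGen G M) {X : ℝ → A}
    {a b : ℝ} (hab : a ≤ b) (hX : ContinuousOn X (Set.Icc a b)) :
    IntervalIntegrable (fun s => G s * X s) volume a b := by
  rw [intervalIntegrable_iff_integrableOn_Icc_of_le hab]
  exact hX.integrableOn_Icc.bdd_mul hG.meas.restrict (Eventually.of_forall hG.bound)

theorem IsBddGen.intervalIntegrable {G : ℝ → A} {M : ℝ} (hG : IsBddGen G M) (a b : ℝ) :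
    IntervalIntegrable G volume a b := by
  have : IntervalIntegrable (fun _ : ℝ => M) volume a b := intervalIntegrable_const
  refine this.mono_fun hG.meas.restrict (Eventually.of_forall fun s => ?_)
  rw [Real.norm_eq_abs, abs_of_nonneg hG.nonneg]
  exact hG.bound s

variable [NormedAlgebra ℂ A]

theorem IsBddGen.norm_integral_le {G : ℝ → A} {M : ℝ} (hG : IsBddGen G M) {a b : ℝ} (hab : a ≤ b) :
    ‖∫ s in a..b, G s‖ ≤ M * (b - a) := by
  have := intervalIntegral.norm_integral_le_of_norm_le_const (a := a) (b := b) (f := G) (C := M)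
    fun x _ => hG.bound x
  rwa [abs_of_nonneg (sub_nonneg.2 hab)] at this

theorem integral_pow_div_factorial (M a t : ℝ) (n : ℕ) :
    ∫ s in a..t, M * ((M * (s - a)) ^ n / n.factorial)
      = (M * (t - a)) ^ (n + 1) / (n + 1).factorial := by
  have h : ∀ s ∈ Set.uIcc a t, HasDerivAt
      (fun s => (M * (s - a)) ^ (n + 1) / ((n + 1).factorial : ℝ))
      (M * ((M * (s - a)) ^ n / n.factorial)) s := by
    intro s _
    have h1 : HasDerivAt (fun s : ℝ => M * (s - a)) M s := by
      simpa using ((hasDerivAt_id s).sub_const a).const_mul M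
    refine ((h1.pow (n + 1)).div_const ((n + 1).factorial : ℝ)).congr_deriv ?_
    rw [Nat.factorial_succ]
    push_cast
    have : (n.factorial : ℝ) ≠ 0 := by exact_mod_cast n.factorial_ne_zero
    have : (n : ℝ) + 1 ≠ 0 := by positivity
    field_simp
  rw [intervalIntegral.integral_eq_sub_of_hasDerivAt h (Continuous.intervalIntegrable (by fun_prop) _ _)]
  simp

theorem IsBddGen.norm_integral_mul_le {G : ℝ → A} {M : ℝ} (hG : IsBddGen G M) {X : ℝ → A}
    {a t C : ℝ} (hat : a ≤ t) (n : ℕ)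
    (hX : ∀ s ∈ Set.Icc a t, ‖X s‖ ≤ C * ((M * (s - a)) ^ n / n.factorial)) :
    ‖∫ s in a..t, G s * X s‖ ≤ C * ((M * (t - a)) ^ (n + 1) / (n + 1).factorial) := by
  rw [← integral_pow_div_factorial, ← intervalIntegral.integral_const_mul]
  refine intervalIntegral.norm_integral_le_of_norm_le hat (Eventually.of_forall fun s hs => ?_)
    (Continuous.intervalIntegrable (by fun_prop) _ _)
  have hM := hG.nonneg
  calc ‖G s * X s‖ ≤ ‖G s‖ * ‖X s‖ := norm_mul_le _ _
    _ ≤ M * (C * ((M * (s - a)) ^ n / n.factorial)) := by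
      gcongr
      · exact hG.bound s
      · exact hX s ⟨hs.1.le, hs.2⟩
    _ = _ := by ring

/-- The terms of the time-ordered exponential series: iterated integrals of the generator. -/
def propIter (G : ℝ → A) (a : ℝ) : ℕ → ℝ → A
  | 0, _ => 1
  | n + 1, t => ∫ s in a..t, G s * propIter G a n s

/-- The propagator from time `a` to time `t ≥ a`: the solution of `W t = 1 + ∫ s in a..t, G s * W s`,
as a time-ordered exponential series. -/
def propagator (G : ℝ → A) (a t : ℝ) : A := ∑' n, propIter G a n t

variable {G : ℝ → A} {M : ℝ}

theorem continuousOn_primitive_mul [CompleteSpace A] (hG : IsBddGen G M) {X : ℝ → A}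
    {a b : ℝ} (hab : a ≤ b) (hX : ContinuousOn X (Set.Icc a b)) :
    ContinuousOn (fun t => ∫ s in a..t, G s * X s) (Set.Icc a b) := by
  have := intervalIntegral.continuousOn_primitive_interval'
    (hG.intervalIntegrable_mul hab hX) Set.left_mem_uIcc
  rwa [Set.uIcc_of_le hab] at this

theorem continuousOn_propIter [CompleteSpace A] (hG : IsBddGen G M) (n : ℕ) {a b : ℝ}
    (hab : a ≤ b) : ContinuousOn (propIter G a n) (Set.Icc a b) := by
  induction n with
  | zero => exact continuousOn_const
  | succ n ih => exact continuousOn_primitive_mul hG hab ih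

theorem norm_propIter_le (hG : IsBddGen G M) (n : ℕ) {a t : ℝ} (hat : a ≤ t) :
    ‖propIter G a n t‖ ≤ ‖(1 : A)‖ * ((M * (t - a)) ^ n / n.factorial) := by
  induction n generalizing t with
  | zero => simp [propIter]
  | succ n ih => exact hG.norm_integral_mul_le hat n fun s hs => ih hs.1

theorem norm_propagator_le (hG : IsBddGen G M) {a t : ℝ} (hat : a ≤ t) :
    ‖propagator G a t‖ ≤ ‖(1 : A)‖ * Real.exp (M * (t - a)) := by
  have h : HasSum (fun n => ‖(1 : A)‖ * ((M * (t - a)) ^ n / n.factorial))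
      (‖(1 : A)‖ * Real.exp (M * (t - a))) := by
    rw [Real.exp_eq_exp_ℝ]
    exact (NormedSpace.expSeries_div_hasSum_exp (M * (t - a))).mul_left _
  exact tsum_of_norm_bounded h fun n => norm_propIter_le hG n hat

theorem propagator_self (G : ℝ → A) (a : ℝ) : propagator G a a = 1 := by
  unfold propagator
  rw [tsum_eq_single 0]
  · rfl
  · intro n hn
    obtain ⟨m, rfl⟩ := Nat.exists_eq_succ_of_ne_zero hn
    simp [propIter]

theorem propagator_congr {G' : ℝ → A} {a t : ℝ} (hat : a ≤ t)
    (h : ∀ s ∈ Set.Ioc a t, G s = G' s) : propagator G a t = propagator G' a t := by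
  have : ∀ n, ∀ s ∈ Set.Icc a t, propIter G a n s = propIter G' a n s := by
    intro n
    induction n with
    | zero => intro s _; rfl
    | succ n ih =>
      intro s hs
      refine intervalIntegral.integral_congr_ae (Eventually.of_forall fun r hr => ?_)
      rw [Set.uIoc_of_le hs.1] at hr
      have hr' : r ∈ Set.Icc a t := ⟨hr.1.le, hr.2.trans hs.2⟩
      rw [h r ⟨hr.1, hr'.2⟩, ih r hr']
  exact tsum_congr fun n => this n t ⟨hat, le_rfl⟩

theorem propagator_shift (G : ℝ → A) (c a t : ℝ) :
    propagator (fun s => G (s + c)) a t = propagator G (a + c) (t + c) := by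
  have : ∀ n t, propIter (fun s => G (s + c)) a n t = propIter G (a + c) n (t + c) := by
    intro n
    induction n with
    | zero => intro t; rfl
    | succ n ih =>
      intro t
      simp only [propIter, ih]
      exact intervalIntegral.integral_comp_add_right (fun s => G s * propIter G (a + c) n s) c
  exact tsum_congr fun n => this n t

variable [CompleteSpace A]

theorem hasSum_propIter (hG : IsBddGen G M) {a t : ℝ} (hat : a ≤ t) :
    HasSum (fun n => propIter G a n t) (propagator G a t) :=
  (Summable.of_norm_bounded ((Real.summable_pow_div_factorial _).mul_left _)
    fun n => norm_propIter_le hG n hat).hasSum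

theorem continuousOn_propagator (hG : IsBddGen G M) {a b : ℝ} (hab : a ≤ b) :
    ContinuousOn (propagator G a) (Set.Icc a b) := by
  refine continuousOn_tsum (fun n => continuousOn_propIter hG n hab)
    ((Real.summable_pow_div_factorial (M * (b - a))).mul_left ‖(1 : A)‖) fun n x hx => ?_
  refine (norm_propIter_le hG n hx.1).trans ?_
  have := hG.nonneg
  have := sub_nonneg.2 hx.1
  gcongr
  exact hx.2

theorem propagator_eq (hG : IsBddGen G M) {a t : ℝ} (hat : a ≤ t) :
    propagator G a t = 1 + ∫ s in a..t, G s * propagator G a s := by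
  have h1 : HasSum (fun n => ∫ s in a..t, G s * propIter G a n s)
      (∫ s in a..t, G s * propagator G a s) := by
    have hM := hG.nonneg
    refine intervalIntegral.hasSum_integral_of_dominated_convergence
      (fun n _ => M * (‖(1 : A)‖ * ((M * (t - a)) ^ n / n.factorial))) (fun n => ?_) (fun n => ?_)
      (Eventually.of_forall fun s _ =>
        ((Real.summable_pow_div_factorial (M * (t - a))).mul_left _).mul_left _)
      intervalIntegrable_const ?_
    · exact (hG.intervalIntegrable_mul hat (continuousOn_propIter hG n hat)).def'.aestronglyMeasurable
    · refine Eventually.of_forall fun s hs => ?_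
      rw [Set.uIoc_of_le hat] at hs
      have h0 := sub_nonneg.2 hs.1.le
      refine (norm_mul_le _ _).trans ?_
      gcongr
      · exact hG.bound s
      · refine (norm_propIter_le hG n hs.1.le).trans ?_
        gcongr
        exact hs.2
    · refine Eventually.of_forall fun s hs => ?_
      rw [Set.uIoc_of_le hat] at hs
      exact (hasSum_propIter hG hs.1.le).mul_left _
  have h2 := (hasSum_nat_add_iff' 1).2 (hasSum_propIter hG hat)
  simp only [Finset.range_one, Finset.sum_singleton] at h2
  have h3 := h2.unique h1
  simp only [propIter] at h3
  rw [← h3]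
  abel

/-- The integral equation of the propagator has a unique solution. -/
theorem eq_propagator_mul (hG : IsBddGen G M) {a b : ℝ} {X : ℝ → A} {x : A}
    (hX : ContinuousOn X (Set.Icc a b))
    (h : ∀ t ∈ Set.Icc a b, X t = x + ∫ s in a..t, G s * X s) {t : ℝ} (ht : t ∈ Set.Icc a b) :
    X t = propagator G a t * x := by
  have hab : a ≤ b := ht.1.trans ht.2
  let Z : ℝ → A := fun t => X t - propagator G a t * x
  have hZc : ContinuousOn Z (Set.Icc a b) :=
    hX.sub ((continuousOn_propagator hG hab).mul continuousOn_const)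
  have hZ : ∀ t ∈ Set.Icc a b, Z t = ∫ s in a..t, G s * Z s := by
    intro t ht
    have e1 : ∫ s in a..t, G s * Z s
        = (∫ s in a..t, G s * X s) - ∫ s in a..t, G s * propagator G a s * x := by
      rw [← intervalIntegral.integral_sub]
      · simp only [Z, mul_sub, mul_assoc]
      · exact hG.intervalIntegrable_mul ht.1 (hX.mono (Set.Icc_subset_Icc_right ht.2))
      · exact (hG.intervalIntegrable_mul ht.1 (continuousOn_propagator hG ht.1)).mul_const x
    have e2 : ∫ s in a..t, G s * propagator G a s * x
        = (∫ s in a..t, G s * propagator G a s) * x :=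
      ((ContinuousLinearMap.mul ℝ A).flip x).intervalIntegral_comp_comm
        (hG.intervalIntegrable_mul ht.1 (continuousOn_propagator hG ht.1))
    have e3 : (∫ s in a..t, G s * propagator G a s) = propagator G a t - 1 := by
      rw [propagator_eq hG ht.1, add_sub_cancel_left]
    rw [e1, e2, e3]
    simp only [Z]
    rw [h t ht]
    noncomm_ring
  obtain ⟨C, hC⟩ := isCompact_Icc.exists_bound_of_continuousOn hZc
  have hb : ∀ n : ℕ, ∀ t ∈ Set.Icc a b, ‖Z t‖ ≤ C * ((M * (t - a)) ^ n / n.factorial) := by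
    intro n
    induction n with
    | zero => intro t ht; simpa using hC t ht
    | succ n ih =>
      intro t ht
      rw [hZ t ht]
      exact hG.norm_integral_mul_le ht.1 n fun s hs => ih s ⟨hs.1, hs.2.trans ht.2⟩
  have hlim : Tendsto (fun n : ℕ => C * ((M * (t - a)) ^ n / n.factorial)) atTop (𝓝 0) := by
    simpa using (FloorSemiring.tendsto_pow_div_factorial_atTop (M * (t - a))).const_mul C
  have h0 : ‖Z t‖ ≤ 0 := ge_of_tendsto' hlim fun n => hb n t ht
  exact sub_eq_zero.1 (norm_le_zero_iff.1 h0)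

theorem propagator_comp (hG : IsBddGen G M) {a b c : ℝ} (hab : a ≤ b) (hbc : b ≤ c) :
    propagator G a c = propagator G b c * propagator G a b := by
  refine eq_propagator_mul hG (a := b) (b := c) (X := propagator G a)
    ((continuousOn_propagator hG (hab.trans hbc)).mono (Set.Icc_subset_Icc_left hab)) ?_
    ⟨hbc, le_rfl⟩
  intro t ht
  rw [propagator_eq hG (hab.trans ht.1), propagator_eq hG hab, add_assoc,
    intervalIntegral.integral_add_adjacent_intervals]
  · exact hG.intervalIntegrable_mul hab (continuousOn_propagator hG hab)
  · exact hG.intervalIntegrable_mul ht.1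
      ((continuousOn_propagator hG (hab.trans ht.1)).mono (Set.Icc_subset_Icc_left hab))

theorem norm_propagator_sub_one_le (hG : IsBddGen G M) (h1 : ‖(1 : A)‖ ≤ 1) {a t : ℝ} (hat : a ≤ t) :
    ‖propagator G a t - 1‖ ≤ M * (t - a) * Real.exp (M * (t - a)) := by
  have hM := hG.nonneg
  rw [propagator_eq hG hat, add_sub_cancel_left]
  have := intervalIntegral.norm_integral_le_of_norm_le_const (a := a) (b := t)
    (f := fun s => G s * propagator G a s) (C := M * Real.exp (M * (t - a))) ?_
  · rw [abs_of_nonneg (sub_nonneg.2 hat)] at this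
    linarith
  · intro s hs
    rw [Set.uIoc_of_le hat] at hs
    refine (norm_mul_le _ _).trans ?_
    gcongr
    · exact hG.bound s
    · refine (norm_propagator_le hG hs.1.le).trans ?_
      calc ‖(1 : A)‖ * Real.exp (M * (s - a)) ≤ 1 * Real.exp (M * (t - a)) := by
            gcongr
            exact hs.2
        _ = _ := one_mul _

/-- The propagator over a short time agrees with its first order part `1 + ∫ G` up to second
order, although `G` is only measurable. -/
theorem norm_propagator_sub_le (hG : IsBddGen G M) (h1 : ‖(1 : A)‖ ≤ 1) {a t : ℝ} (hat : a ≤ t) :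
    ‖propagator G a t - (1 + ∫ s in a..t, G s)‖ ≤ (M * (t - a)) ^ 2 * Real.exp (M * (t - a)) := by
  have hM := hG.nonneg
  have e : propagator G a t - (1 + ∫ s in a..t, G s) = ∫ s in a..t, G s * (propagator G a s - 1) := by
    simp only [mul_sub, mul_one]
    rw [intervalIntegral.integral_sub (hG.intervalIntegrable_mul hat (continuousOn_propagator hG hat))
      (hG.intervalIntegrable a t), propagator_eq hG hat]
    abel
  rw [e]
  have := intervalIntegral.norm_integral_le_of_norm_le_const (a := a) (b := t)
    (f := fun s => G s * (propagator G a s - 1)) (C := M * (M * (t - a) * Real.exp (M * (t - a)))) ?_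
  · rw [abs_of_nonneg (sub_nonneg.2 hat)] at this
    refine this.trans (le_of_eq (by ring))
  · intro s hs
    rw [Set.uIoc_of_le hat] at hs
    refine (norm_mul_le _ _).trans ?_
    have := sub_nonneg.2 hs.1.le
    gcongr
    · exact hG.bound s
    · refine (norm_propagator_sub_one_le hG h1 hs.1.le).trans ?_
      gcongr <;> exact hs.2

/-- The ordered product of `n` steps of length `δ`, the earliest on the right. -/
def stepProd (R : ℝ → A) (δ : ℝ) : ℕ → ℝ → A
  | 0, _ => 1
  | n + 1, a => stepProd R δ n (a + δ) * R a

theorem norm_stepProd_sub_propagator_le (hG : IsBddGen G M) (h1 : ‖(1 : A)‖ ≤ 1) {R : ℝ → A}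
    {δ ρ ε : ℝ} (hδ : 0 ≤ δ) (hρ : Real.exp (M * δ) ≤ ρ) (hε : 0 ≤ ε) (hR : ∀ a, ‖R a‖ ≤ ρ)
    (h : ∀ a, ‖R a - propagator G a (a + δ)‖ ≤ ε) (n : ℕ) (a : ℝ) :
    ‖stepProd R δ n a - propagator G a (a + n * δ)‖ ≤ n * ρ ^ n * (ρ ^ n * ε) := by
  have hM := hG.nonneg
  have hρ1 : 1 ≤ ρ := (Real.one_le_exp (by positivity)).trans hρ
  have hρ0 : 0 ≤ ρ := zero_le_one.trans hρ1
  -- The factor `ρ ^ n` bounds the propagator over up to `n` steps.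
  refine le_of_step_recursion (δ := δ)
    (d := fun m a => ‖stepProd R δ m a - propagator G a (a + m * δ)‖) hρ1 (by positivity)
    (fun a => by simp [stepProd, propagator_self]) (fun m hm a => ?_) le_rfl a
  have hm0 : 0 ≤ m * δ := by positivity
  have hP : ‖propagator G (a + δ) (a + δ + m * δ)‖ ≤ ρ ^ n := by
    refine (norm_propagator_le hG (by linarith)).trans ?_
    calc ‖(1 : A)‖ * Real.exp (M * (a + δ + m * δ - (a + δ)))
        ≤ 1 * Real.exp (M * (a + δ + m * δ - (a + δ))) := by gcongr
      _ = Real.exp (M * δ) ^ m := by rw [one_mul, ← Real.exp_nat_mul]; congr 1; ring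
      _ ≤ ρ ^ m := by gcongr
      _ ≤ ρ ^ n := pow_le_pow_right₀ hρ1 hm.le
  have hc : propagator G a (a + ((m + 1 : ℕ) : ℝ) * δ)
      = propagator G (a + δ) (a + δ + m * δ) * propagator G a (a + δ) := by
    rw [← propagator_comp hG (by linarith) (by linarith)]
    congr 1
    push_cast
    ring
  have e : stepProd R δ (m + 1) a - propagator G a (a + ((m + 1 : ℕ) : ℝ) * δ)
      = (stepProd R δ m (a + δ) - propagator G (a + δ) (a + δ + m * δ)) * R a
        + propagator G (a + δ) (a + δ + m * δ) * (R a - propagator G a (a + δ)) := by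
    rw [hc, stepProd]
    noncomm_ring
  rw [e, mul_comm ρ]
  refine (norm_add_le _ _).trans (add_le_add ?_ ?_)
  · refine (norm_mul_le _ _).trans ?_
    gcongr
    exact hR a
  · refine (norm_mul_le _ _).trans ?_
    gcongr
    exact h a

end Propagator

/-! ### Labels: bounded square integrable functions of time -/

section Labels

variable (𝔥 : Type*) [NormedAddCommGroup 𝔥] [InnerProductSpace ℂ 𝔥]

/-- Bounded square integrable functions on the time axis, the labels of the exponential vectors.
They are functions rather than classes, so that they can be evaluated at a point. -/
def Lab : Submodule ℂ (ℝ → 𝔥) where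
  carrier := {p | MemLp p 2 volume ∧ ∃ C, ∀ s, ‖p s‖ ≤ C}
  add_mem' := by
    rintro p q ⟨hp, C, hC⟩ ⟨hq, D, hD⟩
    exact ⟨hp.add hq, C + D, fun s => (norm_add_le _ _).trans (add_le_add (hC s) (hD s))⟩
  zero_mem' := ⟨MemLp.zero, 0, fun s => by simp⟩
  smul_mem' := by
    rintro c p ⟨hp, C, hC⟩
    exact ⟨hp.const_smul c, ‖c‖ * C, fun s => by
      rw [Pi.smul_apply, norm_smul]; gcongr; exact hC s⟩

variable {𝔥}

theorem Lab.memLp (p : Lab 𝔥) : MemLp p.1 2 volume := p.2.1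

theorem Lab.exists_bound (p : Lab 𝔥) : ∃ C, ∀ s, ‖p.1 s‖ ≤ C := p.2.2

theorem Lab.aestronglyMeasurable (p : Lab 𝔥) : AEStronglyMeasurable p.1 volume := p.2.1.1

/-- The constant value `c` on `(a, a + δ]`, and `0` elsewhere. -/
def stepLab (a δ : ℝ) (c : 𝔥) : Lab 𝔥 :=
  ⟨(Set.Ioc a (a + δ)).indicator fun _ => c,
    memLp_indicator_const 2 measurableSet_Ioc c (Or.inr (by simp)), ‖c‖, fun s => by
      rw [norm_indicator_eq_indicator_norm]
      exact Set.indicator_le_self' (fun _ _ => norm_nonneg _) s⟩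

/-- Translation in time. -/
def shiftLab (c : ℝ) (p : Lab 𝔥) : Lab 𝔥 :=
  ⟨fun s => p.1 (s + c), (Lab.memLp p).comp_measurePreserving (measurePreserving_add_right volume c),
    (Lab.exists_bound p).imp fun _ h _ => h _⟩

/-- Reflection of the time axis, exchanging `0` and `T`. -/
def revLab (T : ℝ) (p : Lab 𝔥) : Lab 𝔥 :=
  ⟨fun s => p.1 (T - s),
    (Lab.memLp p).comp_measurePreserving (Measure.measurePreserving_sub_left volume T),
    (Lab.exists_bound p).imp fun _ h _ => h _⟩

/-- The inner product of labels in `L²(ℝ, 𝔥)`. -/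
def labInner (p q : Lab 𝔥) : ℂ := ∫ s, ⟪p.1 s, q.1 s⟫_ℂ

/-- The inner product of a label with the constant vector `c` on `(a, a + δ]`. -/
def pair (c : 𝔥) (g : Lab 𝔥) (a δ : ℝ) : ℂ := ∫ s in a..a + δ, ⟪c, g.1 s⟫_ℂ

theorem integrable_labInner (p q : Lab 𝔥) : Integrable (fun s => ⟪p.1 s, q.1 s⟫_ℂ) volume :=
  (L2.integrable_inner (𝕜 := ℂ) (Lab.memLp p).toLp (Lab.memLp q).toLp).congr (by
    filter_upwards [(Lab.memLp p).coeFn_toLp, (Lab.memLp q).coeFn_toLp] with s h1 h2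
    rw [h1, h2])

theorem labInner_add_right (p q r : Lab 𝔥) : labInner p (q + r) = labInner p q + labInner p r := by
  unfold labInner
  rw [← integral_add (integrable_labInner p q) (integrable_labInner p r)]
  exact integral_congr_ae (Eventually.of_forall fun s => inner_add_right _ _ _)

theorem labInner_conj (p q : Lab 𝔥) : (starRingEnd ℂ) (labInner p q) = labInner q p := by
  unfold labInner
  rw [← integral_conj]
  simp

theorem labInner_add_left (p q r : Lab 𝔥) : labInner (p + q) r = labInner p r + labInner q r := by
  rw [← labInner_conj, labInner_add_right, map_add, labInner_conj, labInner_conj]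

theorem labInner_stepLab_left {a δ : ℝ} (hδ : 0 ≤ δ) (c : 𝔥) (g : Lab 𝔥) :
    labInner (stepLab a δ c) g = pair c g a δ := by
  unfold labInner pair
  rw [intervalIntegral.integral_of_le (by linarith), ← integral_indicator measurableSet_Ioc]
  congr 1
  ext s
  by_cases hs : s ∈ Set.Ioc a (a + δ) <;> simp [stepLab, hs]

theorem labInner_stepLab_right {a δ : ℝ} (hδ : 0 ≤ δ) (c : 𝔥) (f : Lab 𝔥) :
    labInner f (stepLab a δ c) = (starRingEnd ℂ) (pair c f a δ) := by
  rw [← labInner_stepLab_left hδ, labInner_conj]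

theorem pair_stepLab {a δ : ℝ} (hδ : 0 ≤ δ) (c d : 𝔥) :
    pair c (stepLab a δ d) a δ = δ * ⟪c, d⟫_ℂ := by
  unfold pair
  rw [intervalIntegral.integral_of_le (by linarith), setIntegral_congr_fun (g := fun _ => ⟪c, d⟫_ℂ)
    measurableSet_Ioc (fun s hs => by simp [stepLab, hs])]
  simp [hδ]

theorem intervalIntegrable_pair (c : 𝔥) (g : Lab 𝔥) (a b : ℝ) :
    IntervalIntegrable (fun s => ⟪c, g.1 s⟫_ℂ) volume a b := by
  obtain ⟨C, hC⟩ := Lab.exists_bound g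
  refine (intervalIntegrable_const (c := ‖c‖ * C)).mono_fun
    (aestronglyMeasurable_const.inner (Lab.aestronglyMeasurable g)).restrict
    (Eventually.of_forall fun s => ?_)
  refine (norm_inner_le_norm _ _).trans ((?_ : _ ≤ ‖c‖ * C).trans (le_abs_self _))
  gcongr
  exact hC s

theorem pair_add (c : 𝔥) (f g : Lab 𝔥) (a δ : ℝ) : pair c (f + g) a δ = pair c f a δ + pair c g a δ := by
  unfold pair
  rw [← intervalIntegral.integral_add (intervalIntegrable_pair c f _ _)
    (intervalIntegrable_pair c g _ _)]
  exact intervalIntegral.integral_congr fun s _ => inner_add_right _ _ _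

theorem norm_pair_le {C : ℝ} {g : Lab 𝔥} (hC : ∀ s, ‖g.1 s‖ ≤ C) (c : 𝔥) (a : ℝ) {δ : ℝ}
    (hδ : 0 ≤ δ) : ‖pair c g a δ‖ ≤ ‖c‖ * C * δ := by
  have := intervalIntegral.norm_integral_le_of_norm_le_const (a := a) (b := a + δ)
    (f := fun s => ⟪c, g.1 s⟫_ℂ) (C := ‖c‖ * C) fun x _ =>
      (norm_inner_le_norm _ _).trans (by gcongr; exact hC x)
  simpa [abs_of_nonneg hδ, pair] using this

theorem stepLab_eq_zero {a δ s : ℝ} (c : 𝔥) (h : s ∉ Set.Ioc a (a + δ)) :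
    (stepLab a δ c).1 s = 0 := by
  simp [stepLab, Set.indicator_of_notMem h]

theorem pair_add_stepLab {a a' δ : ℝ} (hδ : 0 ≤ δ) (h : a + δ ≤ a') (c d : 𝔥) (g : Lab 𝔥) :
    pair c (g + stepLab a δ d) a' δ = pair c g a' δ := by
  unfold pair
  refine intervalIntegral.integral_congr_ae (Eventually.of_forall fun s hs => ?_)
  rw [Set.uIoc_of_le (by linarith)] at hs
  simp [stepLab_eq_zero d fun h' : s ∈ Set.Ioc a (a + δ) => by linarith [h'.2, hs.1]]

theorem labInner_shiftLab (c : ℝ) (p q : Lab 𝔥) :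
    labInner (shiftLab c p) (shiftLab c q) = labInner p q :=
  integral_add_right_eq_self (fun s => ⟪p.1 s, q.1 s⟫_ℂ) c

theorem labInner_revLab (T : ℝ) (p q : Lab 𝔥) :
    labInner (revLab T p) (revLab T q) = labInner p q :=
  integral_sub_left_eq_self (fun s => ⟪p.1 s, q.1 s⟫_ℂ) volume T

end Labels

/-! ### Step approximations of the cocycle -/

section Approx

variable {K 𝔥 F ι : Type*} [NormedAddCommGroup K] [InnerProductSpace ℂ K]
  [FiniteDimensional ℂ K] [CompleteSpace K]
  [NormedAddCommGroup 𝔥] [InnerProductSpace ℂ 𝔥]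
  [NormedAddCommGroup F] [InnerProductSpace ℂ F] [Fintype ι]

variable (Y : K →L[ℂ] K) (L : ι → K →L[ℂ] K) (b : ι → 𝔥)

/-- The generator of the matrix elements of the cocycle between the exponential vectors of `f` and
of `g`: creation operators act on the left as `⟪f s, b i⟫`, annihilation operators on the right as
`⟪b i, g s⟫`. -/
def gen (f g : Lab 𝔥) (s : ℝ) : K →L[ℂ] K :=
  Y + ∑ i, ⟪f.1 s, b i⟫_ℂ • L i - ∑ i, ⟪b i, g.1 s⟫_ℂ • (L i).adjoint

/-- The displacements used in one time step: none, or one of the `b i`. -/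
def stepVec : Option ι → 𝔥
  | none => 0
  | some i => b i

/-- The coefficients of the displaced exponential vectors in one time step. They add up to
`1 + δ Y - ∑ i, ⟪b i, ∫ g⟫ (L i)†`, and `L i` is the coefficient of the displacement `b i`. -/
def stepCoeff (δ : ℝ) (g : Lab 𝔥) (a : ℝ) : Option ι → K →L[ℂ] K
  | none => 1 + (δ : ℂ) • Y - ∑ i, pair (b i) g a δ • (L i).adjoint - ∑ i, L i
  | some i => L i

variable (e : Lab 𝔥 → F)

/-- The approximation of the cocycle on `[a, a + n δ]`, applied to `k ⊗ e g`, by `n` steps of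
length `δ`. In the step beginning at `a`, the exponential vector is displaced on `(a, a + δ]`. -/
def approx (δ : ℝ) : ℕ → ℝ → K → Lab 𝔥 → K ⊗[ℂ] F
  | 0, _, k, g => k ⊗ₜ[ℂ] e g
  | n + 1, a, k, g => ∑ α : Option ι,
      approx δ n (a + δ) (stepCoeff Y L b δ g a α k) (g + stepLab a δ (stepVec b α))

/-- One step of the matrix elements between exponential vectors and approximations. -/
def matStep (δ : ℝ) (f g : Lab 𝔥) (a : ℝ) : K →L[ℂ] K :=
  ∑ α : Option ι, Complex.exp ((starRingEnd ℂ) (pair (stepVec b α) f a δ)) •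
    stepCoeff Y L b δ g a α

/-- One step of the Gram matrix of approximations. -/
def gramStep (δ : ℝ) (f g : Lab 𝔥) (a : ℝ) (Q : K →L[ℂ] K) : K →L[ℂ] K :=
  ∑ α : Option ι, ∑ β : Option ι,
    Complex.exp (pair (stepVec b α) g a δ + (starRingEnd ℂ) (pair (stepVec b β) f a δ)
      + δ * ⟪stepVec b α, stepVec b β⟫_ℂ) •
      ((stepCoeff Y L b δ f a α).adjoint * Q * stepCoeff Y L b δ g a β)

/-- One step of the inner products of approximations with exact vectors. -/
def semiStep (δ : ℝ) (f g : Lab 𝔥) (a : ℝ) (Q : K →L[ℂ] K) : K →L[ℂ] K :=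
  ∑ α : Option ι, Complex.exp (pair (stepVec b α) g a δ) •
    ((stepCoeff Y L b δ f a α).adjoint * Q *
      propagator (gen Y L b (f + stepLab a δ (stepVec b α)) g) a (a + δ))

/-- The composition of `n` successive maps, the earliest time applied last. -/
def iterMap {A : Type*} (T : ℝ → A → A) (δ : ℝ) (Q : A) : ℕ → ℝ → A
  | 0, _ => Q
  | n + 1, a => T a (iterMap T δ Q n (a + δ))

theorem stepProd_congr {A : Type*} [NormedRing A] {R R' : ℝ → A} {δ : ℝ} (hδ : 0 ≤ δ) (n : ℕ)
    {a : ℝ} (h : ∀ a', a ≤ a' → R a' = R' a') : stepProd R δ n a = stepProd R' δ n a := by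
  induction n generalizing a with
  | zero => rfl
  | succ n ih =>
    rw [stepProd, stepProd, h a le_rfl, ih fun a' ha' => h a' (by linarith)]

theorem iterMap_congr {A : Type*} {T T' : ℝ → A → A} {δ : ℝ} (hδ : 0 ≤ δ) (Q : A) (n : ℕ)
    {a : ℝ} (h : ∀ a', a ≤ a' → T a' = T' a') : iterMap T δ Q n a = iterMap T' δ Q n a := by
  induction n generalizing a with
  | zero => rfl
  | succ n ih =>
    rw [iterMap, iterMap, h a le_rfl, ih fun a' ha' => h a' (by linarith)]

variable {Y L b e}

theorem stepCoeff_add_stepLab {a a' δ : ℝ} (hδ : 0 ≤ δ) (h : a + δ ≤ a') (d : 𝔥) (g : Lab 𝔥) :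
    stepCoeff Y L b δ (g + stepLab a δ d) a' = stepCoeff Y L b δ g a' := by
  funext α
  cases α with
  | none => simp only [stepCoeff, pair_add_stepLab hδ h]
  | some i => rfl

theorem gen_congr {f f' g g' : Lab 𝔥} {s : ℝ} (hf : f.1 s = f'.1 s) (hg : g.1 s = g'.1 s) :
    gen Y L b f g s = gen Y L b f' g' s := by
  simp only [gen, hf, hg]

theorem stepLab_add_apply {f : Lab 𝔥} {a δ s : ℝ} {c : 𝔥} (h : s ∉ Set.Ioc a (a + δ)) :
    (f + stepLab a δ c).1 s = f.1 s := by
  change f.1 s + (stepLab a δ c).1 s = _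
  rw [stepLab_eq_zero c h, add_zero]

theorem semiStep_add_stepLab {a a' δ : ℝ} (hδ : 0 ≤ δ) (h : a + δ ≤ a') (d : 𝔥) (f g : Lab 𝔥) :
    semiStep Y L b δ (f + stepLab a δ d) g a' = semiStep Y L b δ f g a' := by
  funext Q
  unfold semiStep
  refine Finset.sum_congr rfl fun α _ => ?_
  rw [stepCoeff_add_stepLab hδ h]
  congr 2
  refine propagator_congr (by linarith) fun s hs => gen_congr ?_ rfl
  rw [add_right_comm]
  refine stepLab_add_apply fun h' => ?_
  linarith [h'.2, hs.1]

/-- The inner products of approximations with vectors that have the matrix elements of the exact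
cocycle on `[0, T]`. -/
theorem inner_approx_ampl [CompleteSpace F] {M : Lab 𝔥 → Lab 𝔥 → ℝ}
    (hgen : ∀ f g, IsBddGen (gen Y L b f g) (M f g)) {T : ℝ} {Φ : K → Lab 𝔥 → K ⊗[ℂ] F}
    (hΦ : ∀ k' k f g, ⟪k' ⊗ₜ[ℂ] e f, Φ k g⟫_ℂ
      = Complex.exp (labInner f g) * ⟪k', propagator (gen Y L b f g) 0 T k⟫_ℂ)
    (S : K →L[ℂ] K) {δ : ℝ} (hδ : 0 ≤ δ) (n : ℕ) {a : ℝ} (ha : 0 ≤ a) (haT : a + n * δ = T)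
    (k' k : K) (f g : Lab 𝔥) :
    ⟪approx Y L b e δ n a k' f, ampl F S (Φ k g)⟫_ℂ = Complex.exp (labInner f g) *
      ⟪k', (iterMap (semiStep Y L b δ f g) δ S n a * propagator (gen Y L b f g) 0 a) k⟫_ℂ := by
  induction n generalizing a k' f with
  | zero =>
    have : a = T := by simpa using haT
    subst this
    simp only [approx, iterMap, mul_apply_eq_comp]
    rw [← ContinuousLinearMap.adjoint_inner_left, ampl_adjoint, ampl_tmul, hΦ,
      ContinuousLinearMap.adjoint_inner_left]
  | succ n ih =>
    have hs : ∀ α, iterMap (semiStep Y L b δ (f + stepLab a δ (stepVec b α)) g) δ S n (a + δ)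
        = iterMap (semiStep Y L b δ f g) δ S n (a + δ) := fun α =>
      iterMap_congr hδ S n fun a' ha' => semiStep_add_stepLab hδ ha' _ f g
    have hp : ∀ α, propagator (gen Y L b (f + stepLab a δ (stepVec b α)) g) 0 (a + δ)
        = propagator (gen Y L b (f + stepLab a δ (stepVec b α)) g) a (a + δ)
          * propagator (gen Y L b f g) 0 a := fun α => by
      rw [propagator_comp (hgen _ _) ha (by linarith)]
      congr 1
      refine propagator_congr ha fun s hs => gen_congr (stepLab_add_apply fun h' => ?_) rfl
      linarith [h'.1, hs.2]
    have haT' : a + δ + n * δ = T := by rw [← haT]; push_cast; ring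
    simp only [approx, sum_inner, ih (by linarith : 0 ≤ a + δ) haT', hs, hp, labInner_add_left,
      labInner_stepLab_left hδ, Complex.exp_add, iterMap]
    simp only [semiStep, Finset.sum_mul, mul_apply_eq_comp, sum_apply, smul_mul_assoc,
      inner_sum, smul_apply, inner_smul_right, Finset.mul_sum,
      ContinuousLinearMap.adjoint_inner_right]
    exact Finset.sum_congr rfl fun α _ => by ring

variable (he : ∀ p q, ⟪e p, e q⟫_ℂ = Complex.exp (labInner p q))
include he

/-- Matrix elements of approximations are products of steps: a displacement on `(a, a + δ]` is not
seen by the coefficients of later steps. -/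
theorem inner_tmul_approx {δ : ℝ} (hδ : 0 ≤ δ) (n : ℕ) (a : ℝ) (k' k : K) (f g : Lab 𝔥) :
    ⟪k' ⊗ₜ[ℂ] e f, approx Y L b e δ n a k g⟫_ℂ
      = Complex.exp (labInner f g) * ⟪k', stepProd (matStep Y L b δ f g) δ n a k⟫_ℂ := by
  induction n generalizing a k g with
  | zero => simp [approx, stepProd, TensorProduct.inner_tmul, he, mul_comm]
  | succ n ih =>
    have hs : ∀ α, stepProd (matStep Y L b δ f (g + stepLab a δ (stepVec b α))) δ n (a + δ)
        = stepProd (matStep Y L b δ f g) δ n (a + δ) := fun α =>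
      stepProd_congr hδ n fun a' ha' => by
        simp only [matStep, stepCoeff_add_stepLab hδ ha']
    simp only [approx, inner_sum, ih, hs, labInner_add_right, labInner_stepLab_right hδ,
      Complex.exp_add, stepProd]
    simp only [matStep, mul_apply_eq_comp, sum_apply,
      inner_sum, smul_apply, map_smul, inner_smul_right, Finset.mul_sum]
    exact Finset.sum_congr rfl fun α _ => by ring

/-- The Gram kernel of the approximations: the steps act on operators on `K`, starting from `1`. -/
theorem inner_approx_approx {δ : ℝ} (hδ : 0 ≤ δ) (n : ℕ) (a : ℝ) (k' k : K) (f g : Lab 𝔥) :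
    ⟪approx Y L b e δ n a k' f, approx Y L b e δ n a k g⟫_ℂ
      = Complex.exp (labInner f g) * ⟪k', iterMap (gramStep Y L b δ f g) δ 1 n a k⟫_ℂ := by
  induction n generalizing a k' k f g with
  | zero => simp [approx, iterMap, TensorProduct.inner_tmul, he, mul_comm]
  | succ n ih =>
    have hs : ∀ α β, iterMap (gramStep Y L b δ (f + stepLab a δ (stepVec b α))
        (g + stepLab a δ (stepVec b β))) δ 1 n (a + δ)
        = iterMap (gramStep Y L b δ f g) δ 1 n (a + δ) := fun α β =>
      iterMap_congr hδ 1 n fun a' ha' => by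
        funext Q
        simp only [gramStep, stepCoeff_add_stepLab hδ ha', pair_add_stepLab hδ ha']
    simp only [approx, sum_inner, inner_sum, ih, hs, labInner_add_right, labInner_add_left,
      labInner_stepLab_right hδ, labInner_stepLab_left hδ, pair_add, pair_stepLab hδ, map_add,
      map_mul, Complex.conj_ofReal, inner_conj_symm, Complex.exp_add, iterMap]
    simp only [gramStep, mul_apply_eq_comp, sum_apply,
      inner_sum, smul_apply, inner_smul_right, Finset.mul_sum,
      ContinuousLinearMap.adjoint_inner_right, Complex.exp_add]
    rw [Finset.sum_comm]
    exact Finset.sum_congr rfl fun α _ => Finset.sum_congr rfl fun β _ => by ring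

end Approx

/-! ### Short-time estimates -/

section Estimates

open Asymptotics

variable {K 𝔥 ι : Type*} [NormedAddCommGroup K] [InnerProductSpace ℂ K]
  [FiniteDimensional ℂ K] [CompleteSpace K]
  [NormedAddCommGroup 𝔥] [InnerProductSpace ℂ 𝔥] [Fintype ι]

variable (K) in
/-- The filter on triples `(a, δ, Q)` for estimates that are uniform in the initial time `a`, the
length `0 ≤ δ ≤ T` of a step, and the operator `Q`. -/
def stepFilter (T : ℝ) : Filter (ℝ × ℝ × (K →L[ℂ] K)) := 𝓟 {x | 0 ≤ x.2.1 ∧ x.2.1 ≤ T}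

variable {T : ℝ}

theorem isBigO_stepFilter {E : Type*} [SeminormedAddCommGroup E] {u : ℝ × ℝ × (K →L[ℂ] K) → E}
    {v : ℝ × ℝ × (K →L[ℂ] K) → ℝ} (C : ℝ)
    (h : ∀ a δ Q, 0 ≤ δ → δ ≤ T → ‖u (a, δ, Q)‖ ≤ C * ‖v (a, δ, Q)‖) : u =O[stepFilter K T] v :=
  isBigO_principal.2 ⟨C, fun x hx => h x.1 x.2.1 x.2.2 hx.1 hx.2⟩

theorem isBigO_step_one : (fun x : ℝ × ℝ × (K →L[ℂ] K) => x.2.1) =O[stepFilter K T] fun _ => (1 : ℝ) :=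
  isBigO_stepFilter T fun a δ Q h0 hT => by simpa [abs_of_nonneg h0] using hT

theorem isBigO_step_of_sq {E : Type*} [SeminormedAddCommGroup E] {u : ℝ × ℝ × (K →L[ℂ] K) → E}
    (h : u =O[stepFilter K T] fun x => x.2.1 ^ 2) : u =O[stepFilter K T] fun x => x.2.1 :=
  h.trans (by simpa [pow_two] using (isBigO_refl _ _).mul (isBigO_step_one (K := K) (T := T)))

theorem isBigO_pair (c : 𝔥) (g : Lab 𝔥) :
    (fun x : ℝ × ℝ × (K →L[ℂ] K) => pair c g x.1 x.2.1) =O[stepFilter K T] fun x => x.2.1 := by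
  obtain ⟨C, hC⟩ := Lab.exists_bound g
  refine isBigO_stepFilter (‖c‖ * C) fun a δ Q h0 _ => ?_
  simpa [abs_of_nonneg h0] using norm_pair_le hC c a h0

theorem IsBigO.exp_sub {z : ℝ × ℝ × (K →L[ℂ] K) → ℂ} (hz : z =O[stepFilter K T] fun x => x.2.1)
    (n : ℕ) : (fun x => Complex.exp (z x) - ∑ m ∈ Finset.range n, z x ^ m / m.factorial)
      =O[stepFilter K T] fun x => x.2.1 ^ n := by
  obtain ⟨C, hC⟩ := isBigO_principal.1 hz
  refine isBigO_stepFilter (|C| ^ n * Real.exp (|C| * T)) fun a δ Q h0 hT => ?_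
  have h := hC (a, δ, Q) ⟨h0, hT⟩
  have h' : ‖z (a, δ, Q)‖ ≤ |C| * δ := by
    refine h.trans ?_
    simp only [Real.norm_eq_abs, abs_of_nonneg h0]
    gcongr
    exact le_abs_self C
  refine (Complex.norm_exp_sub_sum_le_norm_mul_exp _ n).trans ?_
  calc ‖z (a, δ, Q)‖ ^ n * Real.exp ‖z (a, δ, Q)‖
      ≤ (|C| * δ) ^ n * Real.exp (|C| * T) := by
        gcongr
        exact h'.trans (by gcongr)
    _ = _ := by
      simp only [norm_pow, Real.norm_eq_abs, abs_of_nonneg h0]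
      ring

theorem IsBigO.exp_sub_one {z : ℝ × ℝ × (K →L[ℂ] K) → ℂ}
    (hz : z =O[stepFilter K T] fun x => x.2.1) :
    (fun x => Complex.exp (z x) - 1) =O[stepFilter K T] fun x => x.2.1 := by
  simpa using IsBigO.exp_sub hz 1

theorem IsBigO.exp_sub_one_sub {z : ℝ × ℝ × (K →L[ℂ] K) → ℂ}
    (hz : z =O[stepFilter K T] fun x => x.2.1) :
    (fun x => Complex.exp (z x) - 1 - z x) =O[stepFilter K T] fun x => x.2.1 ^ 2 := by
  simpa [Finset.sum_range_succ, sub_sub] using IsBigO.exp_sub hz 2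

theorem norm_one_le : ‖(1 : K →L[ℂ] K)‖ ≤ 1 := ContinuousLinearMap.norm_id_le

variable (Y : K →L[ℂ] K) (L : ι → K →L[ℂ] K) (b : ι → 𝔥)

/-- A bound for the generator, for labels bounded by `C` and `D`. -/
def genBound (C D : ℝ) : ℝ := ‖Y‖ + ∑ i, C * ‖b i‖ * ‖L i‖ + ∑ i, ‖b i‖ * D * ‖L i‖

variable {Y L b}

theorem isBddGen_gen {f g : Lab 𝔥} {C D : ℝ} (hf : ∀ s, ‖f.1 s‖ ≤ C) (hg : ∀ s, ‖g.1 s‖ ≤ D) :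
    IsBddGen (gen Y L b f g) (genBound Y L b C D) where
  meas := by
    unfold gen
    refine (aestronglyMeasurable_const.add ?_).sub ?_
    · exact Finset.aestronglyMeasurable_fun_sum _ fun i _ =>
        ((Lab.aestronglyMeasurable f).inner aestronglyMeasurable_const).smul_const _
    · exact Finset.aestronglyMeasurable_fun_sum _ fun i _ =>
        (aestronglyMeasurable_const.inner (Lab.aestronglyMeasurable g)).smul_const _
  bound s := by
    refine (norm_sub_le _ _).trans (add_le_add ((norm_add_le _ _).trans (add_le_add le_rfl ?_)) ?_)
    · refine norm_sum_le_of_le _ fun i _ => ?_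
      rw [norm_smul]
      gcongr
      exact (norm_inner_le_norm _ _).trans (by gcongr; exact hf s)
    · refine norm_sum_le_of_le _ fun i _ => ?_
      rw [norm_smul, LinearIsometryEquiv.norm_map]
      gcongr
      exact (norm_inner_le_norm _ _).trans (by gcongr; exact hg s)

theorem exists_isBddGen (f g : Lab 𝔥) : ∃ M, IsBddGen (gen Y L b f g) M := by
  obtain ⟨C, hC⟩ := Lab.exists_bound f
  obtain ⟨D, hD⟩ := Lab.exists_bound g
  exact ⟨_, isBddGen_gen hC hD⟩

theorem integral_gen (f g : Lab 𝔥) (a δ : ℝ) :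
    ∫ s in a..a + δ, gen Y L b f g s
      = (δ : ℂ) • Y + ∑ i, (starRingEnd ℂ) (pair (b i) f a δ) • L i
        - ∑ i, pair (b i) g a δ • (L i).adjoint := by
  have hl : ∀ i, IntervalIntegrable (fun s => ⟪f.1 s, b i⟫_ℂ • L i) volume a (a + δ) := fun i => by
    have : IntervalIntegrable (fun s => ⟪f.1 s, b i⟫_ℂ) volume a (a + δ) :=
      (intervalIntegrable_pair (b i) f a (a + δ)).mono_fun
        ((Lab.aestronglyMeasurable f).inner aestronglyMeasurable_const).restrict
        (Eventually.of_forall fun s => (norm_inner_symm _ _).le)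
    exact ⟨this.1.smul_const _, this.2.smul_const _⟩
  have hr : ∀ i, IntervalIntegrable (fun s => ⟪b i, g.1 s⟫_ℂ • (L i).adjoint) volume a (a + δ) :=
    fun i => ⟨(intervalIntegrable_pair (b i) g a (a + δ)).1.smul_const _,
      (intervalIntegrable_pair (b i) g a (a + δ)).2.smul_const _⟩
  have hls : IntervalIntegrable (fun s => ∑ i, ⟪f.1 s, b i⟫_ℂ • L i) volume a (a + δ) := 
    ⟨integrable_finsetSum _ fun i _ => (hl i).1, integrable_finsetSum _ fun i _ => (hl i).2⟩
  have hrs : IntervalIntegrable (fun s => ∑ i, ⟪b i, g.1 s⟫_ℂ • (L i).adjoint) volume a (a + δ) := 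
    ⟨integrable_finsetSum _ fun i _ => (hr i).1, integrable_finsetSum _ fun i _ => (hr i).2⟩
  unfold gen
  rw [intervalIntegral.integral_sub, intervalIntegral.integral_add,
    intervalIntegral.integral_finsetSum, intervalIntegral.integral_finsetSum]
  · congr 1
    · congr 1
      · simp
      · refine Finset.sum_congr rfl fun i _ => ?_
        rw [intervalIntegral.integral_smul_const]
        congr 1
        unfold pair
        rw [intervalIntegral, intervalIntegral, map_sub, ← integral_conj, ← integral_conj]
        simp
    · refine Finset.sum_congr rfl fun i _ => ?_
      rw [intervalIntegral.integral_smul_const]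
      rfl
  · exact fun i _ => hr i
  · exact fun i _ => hl i
  · exact intervalIntegrable_const
  · exact hls
  · exact intervalIntegrable_const.add hls
  · exact hrs

theorem sum_stepCoeff (δ : ℝ) (g : Lab 𝔥) (a : ℝ) :
    ∑ α, stepCoeff Y L b δ g a α
      = 1 + ((δ : ℂ) • Y - ∑ i, pair (b i) g a δ • (L i).adjoint) := by
  rw [Fintype.sum_option]
  simp only [stepCoeff]
  abel

theorem isBigO_drift (g : Lab 𝔥) :
    (fun x : ℝ × ℝ × (K →L[ℂ] K) => (x.2.1 : ℂ) • Y - ∑ i, pair (b i) g x.1 x.2.1 • (L i).adjoint)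
      =O[stepFilter K T] fun x => x.2.1 := by
  refine IsBigO.sub ?_ (IsBigO.fun_sum fun i _ => ?_)
  · refine isBigO_stepFilter ‖Y‖ fun a δ Q h0 _ => ?_
    rw [norm_smul, mul_comm]
    simp
  · simpa using (isBigO_pair (b i) g).smul (isBigO_const_const (L i).adjoint (one_ne_zero (α := ℝ)) _)

theorem isBigO_const_one' {E : Type*} [SeminormedAddCommGroup E] (c : E) :
    (fun _ : ℝ × ℝ × (K →L[ℂ] K) => c) =O[stepFilter K T] fun _ => (1 : ℝ) :=
  isBigO_const_const c one_ne_zero _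

theorem isBigO_stepCoeff (g : Lab 𝔥) (α : Option ι) :
    (fun x : ℝ × ℝ × (K →L[ℂ] K) => stepCoeff Y L b x.2.1 g x.1 α)
      =O[stepFilter K T] fun _ => (1 : ℝ) := by
  cases α with
  | none =>
    have h := ((isBigO_const_one' (K := K) (T := T) (1 : K →L[ℂ] K)).add
      ((isBigO_drift (Y := Y) (L := L) (b := b) g).trans isBigO_step_one)).sub
      (isBigO_const_one' (K := K) (T := T) (∑ i, L i))
    refine h.congr_left fun x => ?_
    simp only [stepCoeff]
    abel
  | some i => exact isBigO_const_one' (L i)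

theorem isBigO_conj {z : ℝ × ℝ × (K →L[ℂ] K) → ℂ} {v : ℝ × ℝ × (K →L[ℂ] K) → ℝ}
    (h : z =O[stepFilter K T] v) : (fun x => (starRingEnd ℂ) (z x)) =O[stepFilter K T] v :=
  (h.norm_left.congr_left fun x => (RCLike.norm_conj (z x)).symm).of_norm_left

theorem isBigO_adjoint {u : ℝ × ℝ × (K →L[ℂ] K) → K →L[ℂ] K} {v : ℝ × ℝ × (K →L[ℂ] K) → ℝ}
    (h : u =O[stepFilter K T] v) : (fun x => (u x).adjoint) =O[stepFilter K T] v :=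
  (h.norm_left.congr_left fun x =>
    (LinearIsometryEquiv.norm_map ContinuousLinearMap.adjoint (u x)).symm).of_norm_left

theorem isBigO_id_step :
    (fun x : ℝ × ℝ × (K →L[ℂ] K) => x.2.2) =O[stepFilter K T] fun x => ‖x.2.2‖ :=
  (isBigO_refl _ _).norm_right

theorem isBigO_propagator_sub (f g : Lab 𝔥) (c : 𝔥) :
    (fun x : ℝ × ℝ × (K →L[ℂ] K) => propagator (gen Y L b (f + stepLab x.1 x.2.1 c) g) x.1
        (x.1 + x.2.1) - (1 + ∫ s in x.1..x.1 + x.2.1, gen Y L b (f + stepLab x.1 x.2.1 c) g s))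
      =O[stepFilter K T] fun x => x.2.1 ^ 2 := by
  obtain ⟨C, hC⟩ := Lab.exists_bound f
  obtain ⟨D, hD⟩ := Lab.exists_bound g
  refine isBigO_stepFilter (genBound Y L b (C + ‖c‖) D ^ 2 * Real.exp (genBound Y L b (C + ‖c‖) D * T))
    fun a δ Q h0 hT => ?_
  have hG : IsBddGen (gen Y L b (f + stepLab a δ c) g) (genBound Y L b (C + ‖c‖) D) :=
    isBddGen_gen (fun s => (norm_add_le _ _).trans (add_le_add (hC s) (by
      change ‖(Set.Ioc a (a + δ)).indicator (fun _ => c) s‖ ≤ ‖c‖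
      rw [norm_indicator_eq_indicator_norm]
      exact Set.indicator_le_self' (fun _ _ => norm_nonneg _) s))) hD
  have hM := hG.nonneg
  refine (norm_propagator_sub_le hG norm_one_le (by linarith)).trans ?_
  rw [add_sub_cancel_left, mul_pow, Real.norm_eq_abs, abs_of_nonneg (sq_nonneg δ)]
  calc _ ≤ genBound Y L b (C + ‖c‖) D ^ 2 * δ ^ 2 * Real.exp (genBound Y L b (C + ‖c‖) D * T) := by
        gcongr
    _ = _ := by ring

theorem isBigO_integral_gen (f g : Lab 𝔥) (c : 𝔥) :
    (fun x : ℝ × ℝ × (K →L[ℂ] K) =>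
        ∫ s in x.1..x.1 + x.2.1, gen Y L b (f + stepLab x.1 x.2.1 c) g s)
      =O[stepFilter K T] fun x => x.2.1 := by
  obtain ⟨C, hC⟩ := Lab.exists_bound f
  obtain ⟨D, hD⟩ := Lab.exists_bound g
  refine isBigO_stepFilter (genBound Y L b (C + ‖c‖) D) fun a δ Q h0 hT => ?_
  have hG : IsBddGen (gen Y L b (f + stepLab a δ c) g) (genBound Y L b (C + ‖c‖) D) :=
    isBddGen_gen (fun s => (norm_add_le _ _).trans (add_le_add (hC s) (by
      change ‖(Set.Ioc a (a + δ)).indicator (fun _ => c) s‖ ≤ ‖c‖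
      rw [norm_indicator_eq_indicator_norm]
      exact Set.indicator_le_self' (fun _ _ => norm_nonneg _) s))) hD
  have := hG.norm_integral_le (a := a) (b := a + δ) (by linarith)
  simpa [abs_of_nonneg h0] using this

/-- One step of the matrix elements agrees with the generator up to second order. -/
theorem isBigO_matStep_sub (f g : Lab 𝔥) :
    (fun x : ℝ × ℝ × (K →L[ℂ] K) => matStep Y L b x.2.1 f g x.1
        - (1 + ∫ s in x.1..x.1 + x.2.1, gen Y L b f g s))
      =O[stepFilter K T] fun x => x.2.1 ^ 2 := by
  have hz : ∀ α, (fun x : ℝ × ℝ × (K →L[ℂ] K) =>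
      (starRingEnd ℂ) (pair (stepVec b α) f x.1 x.2.1)) =O[stepFilter K T] fun x => x.2.1 :=
    fun α => isBigO_conj (isBigO_pair _ f)
  have h := IsBigO.fun_sum (s := Finset.univ) fun α _ =>
    (IsBigO.exp_sub_one_sub (hz α)).smul (isBigO_stepCoeff (Y := Y) (L := L) (b := b) g α)
  simp only [smul_eq_mul, mul_one] at h
  refine h.congr_left fun x => ?_
  have e1 : ∑ α, (starRingEnd ℂ) (pair (stepVec b α) f x.1 x.2.1) • stepCoeff Y L b x.2.1 g x.1 α
      = ∑ i, (starRingEnd ℂ) (pair (b i) f x.1 x.2.1) • L i := by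
    rw [Fintype.sum_option]
    simp [stepVec, stepCoeff, pair]
  simp only [sub_smul, one_smul, Finset.sum_sub_distrib, sum_stepCoeff, e1, integral_gen, matStep]
  abel

/-- One step of the Gram matrix is the identity up to first order. -/
theorem isBigO_gramStep_sub (f g : Lab 𝔥) :
    (fun x : ℝ × ℝ × (K →L[ℂ] K) => gramStep Y L b x.2.1 f g x.1 x.2.2 - x.2.2)
      =O[stepFilter K T] fun x => x.2.1 * ‖x.2.2‖ := by
  have hz : ∀ α β, (fun x : ℝ × ℝ × (K →L[ℂ] K) => pair (stepVec b α) g x.1 x.2.1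
      + (starRingEnd ℂ) (pair (stepVec b β) f x.1 x.2.1)
      + x.2.1 * ⟪stepVec b α, stepVec b β⟫_ℂ) =O[stepFilter K T] fun x => x.2.1 := fun α β => by
    refine ((isBigO_pair _ g).add (isBigO_conj (isBigO_pair _ f))).add ?_
    refine isBigO_stepFilter ‖⟪stepVec b α, stepVec b β⟫_ℂ‖ fun a δ Q h0 _ => ?_
    rw [norm_mul, mul_comm]
    simp
  have h1 := IsBigO.fun_sum (s := Finset.univ) fun α _ => IsBigO.fun_sum (s := Finset.univ) fun β _ =>
    (IsBigO.exp_sub_one (hz α β)).smul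
      (((isBigO_adjoint (isBigO_stepCoeff (Y := Y) (L := L) (b := b) f α)).mul isBigO_id_step).mul
        (isBigO_stepCoeff (Y := Y) (L := L) (b := b) g β))
  have hf := isBigO_adjoint (isBigO_drift (T := T) (Y := Y) (L := L) (b := b) f)
  have hg := isBigO_drift (T := T) (Y := Y) (L := L) (b := b) g
  have h2 := (hf.mul isBigO_id_step).mul
    ((isBigO_const_one' (1 : K →L[ℂ] K)).add (hg.trans isBigO_step_one))
  have h3 := (isBigO_id_step (K := K) (T := T)).mul hg
  simp only [smul_eq_mul, mul_one, one_mul] at h1 h2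
  refine ((h1.add h2).add (h3.congr_right fun x => mul_comm _ _)).congr_left fun x => ?_
  have e1 : ∑ α, ∑ β, (stepCoeff Y L b x.2.1 f x.1 α).adjoint * x.2.2 * stepCoeff Y L b x.2.1 g x.1 β
      = (∑ α, stepCoeff Y L b x.2.1 f x.1 α).adjoint * x.2.2
        * ∑ α, stepCoeff Y L b x.2.1 g x.1 α := by
    rw [map_sum, Finset.sum_mul, Finset.sum_mul]
    exact Finset.sum_congr rfl fun α _ => (Finset.mul_sum _ _ _).symm
  have e2 : (1 : K →L[ℂ] K).adjoint = 1 := ContinuousLinearMap.adjoint_id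
  simp only [sub_smul, one_smul, Finset.sum_sub_distrib, e1, sum_stepCoeff, gramStep, map_add, e2]
  generalize (x.2.1 : ℂ) • Y - ∑ i, pair (b i) g x.1 x.2.1 • (L i).adjoint = u
  generalize ((x.2.1 : ℂ) • Y - ∑ i, pair (b i) f x.1 x.2.1 • (L i).adjoint).adjoint = v
  noncomm_ring

/-- The first order part of one step of the inner products of approximations with exact vectors. -/
def semiLin (Y : K →L[ℂ] K) (L : ι → K →L[ℂ] K) (b : ι → 𝔥) (δ : ℝ) (f g : Lab 𝔥) (a : ℝ)
    (Q : K →L[ℂ] K) : K →L[ℂ] K :=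
  ((δ : ℂ) • Y - ∑ i, pair (b i) f a δ • (L i).adjoint).adjoint * Q
    + Q * (∫ s in a..a + δ, gen Y L b f g s)
    + ∑ i, (L i).adjoint * Q * ((δ : ℂ) • L i + pair (b i) g a δ • 1)

/-- The displacement by `b i` adds `δ L i` to the integrated generator, because the `b i` are
orthonormal. This is the Itô correction in `semiLin`. -/
theorem isBigO_semiStep_sub (hb : Orthonormal ℂ b) (f g : Lab 𝔥) :
    (fun x : ℝ × ℝ × (K →L[ℂ] K) => semiStep Y L b x.2.1 f g x.1 x.2.2
        - (x.2.2 + semiLin Y L b x.2.1 f g x.1 x.2.2))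
      =O[stepFilter K T] fun x => x.2.1 ^ 2 * ‖x.2.2‖ := by
  classical
  let z : Option ι → ℝ × ℝ × (K →L[ℂ] K) → ℂ := fun α x => pair (stepVec b α) g x.1 x.2.1
  let I : Option ι → ℝ × ℝ × (K →L[ℂ] K) → K →L[ℂ] K := fun α x =>
    ∫ s in x.1..x.1 + x.2.1, gen Y L b (f + stepLab x.1 x.2.1 (stepVec b α)) g s
  let W : Option ι → ℝ × ℝ × (K →L[ℂ] K) → K →L[ℂ] K := fun α x =>
    propagator (gen Y L b (f + stepLab x.1 x.2.1 (stepVec b α)) g) x.1 (x.1 + x.2.1)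
  have hz : ∀ α, z α =O[stepFilter K T] fun x => x.2.1 := fun α => isBigO_pair _ g
  have hI : ∀ α, I α =O[stepFilter K T] fun x => x.2.1 := fun α => isBigO_integral_gen f g _
  have hW : ∀ α, (fun x => W α x - (1 + I α x)) =O[stepFilter K T] fun x => x.2.1 ^ 2 :=
    fun α => isBigO_propagator_sub f g _
  have hW1 : ∀ α, W α =O[stepFilter K T] fun _ => (1 : ℝ) := fun α => by
    have := ((isBigO_step_of_sq (hW α)).trans isBigO_step_one).add
      ((isBigO_const_one' (1 : K →L[ℂ] K)).add ((hI α).trans isBigO_step_one))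
    simpa using this
  have hX : ∀ α, (fun x => Complex.exp (z α x) • W α x - (1 + z α x • 1 + I α x))
      =O[stepFilter K T] fun x => x.2.1 ^ 2 := fun α => by
    have h1 := (IsBigO.exp_sub_one_sub (hz α)).smul (hW1 α)
    have h2 := ((isBigO_const_one' (1 : ℂ)).add ((hz α).trans isBigO_step_one)).smul (hW α)
    have h3 := (hz α).smul (hI α)
    simp only [smul_eq_mul, mul_one, one_mul] at h1 h2 h3
    refine ((h1.add h2).add (h3.congr_right fun x => (pow_two _).symm)).congr_left fun x => ?_
    simp only [smul_sub, smul_add, sub_smul, add_smul, one_smul]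
    abel
  have h1 := IsBigO.fun_sum (s := Finset.univ) fun α _ =>
    ((isBigO_adjoint (isBigO_stepCoeff (T := T) (Y := Y) (L := L) (b := b) f α)).mul
      isBigO_id_step).mul (hX α)
  have hf := isBigO_adjoint (isBigO_drift (T := T) (Y := Y) (L := L) (b := b) f)
  have h2 := (hf.mul isBigO_id_step).mul (hI none)
  refine (h1.congr_right fun x => ?_).add (h2.congr_right fun x => ?_) |>.congr'
    (eventually_principal.2 fun x hx => ?_) EventuallyEq.rfl
  · ring
  · ring
  have eI0 : I none x = ∫ s in x.1..x.1 + x.2.1, gen Y L b f g s := by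
    have h0 : (stepLab x.1 x.2.1 (stepVec b none) : Lab 𝔥) = 0 :=
      Subtype.ext (funext fun s => by simp [stepLab, stepVec])
    simp only [I, h0, add_zero]
  have eI : ∀ i, I (some i) x = I none x + (x.2.1 : ℂ) • L i := fun i => by
    have h' : ∑ j, (starRingEnd ℂ) (x.2.1 * ⟪b j, b i⟫_ℂ) • L j = (x.2.1 : ℂ) • L i := by
      rw [Finset.sum_eq_single i]
      · simp [hb.1 i]
      · intro j _ hj
        simp [orthonormal_iff_ite.1 hb, hj]
      · simp
    rw [eI0]
    simp only [I, integral_gen, pair_add, stepVec, pair_stepLab hx.1, map_add, add_smul,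
      Finset.sum_add_distrib, h']
    abel
  have ez : z none x = 0 := by simp [z, stepVec, pair]
  have e2 : (1 : K →L[ℂ] K).adjoint = 1 := ContinuousLinearMap.adjoint_id
  have e3 := congrArg ContinuousLinearMap.adjoint
    (sum_stepCoeff (Y := Y) (L := L) (b := b) x.2.1 f x.1)
  rw [map_add, e2, map_sum, Fintype.sum_option] at e3
  simp only [semiStep, semiLin, ← eI0, ← mul_smul_comm, mul_sub, Finset.sum_sub_distrib]
  change _ - _ + _ = ∑ α, _ * (Complex.exp (z α x) • W α x) - _
  rw [Fintype.sum_option (f := fun α => (stepCoeff Y L b x.2.1 f x.1 α).adjoint * x.2.2 *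
    (1 + z α x • 1 + I α x))]
  rw [eq_sub_of_add_eq e3]
  simp only [ez, eI, zero_smul, stepCoeff]
  generalize ((x.2.1 : ℂ) • Y - ∑ i, pair (b i) f x.1 x.2.1 • (L i).adjoint).adjoint = v
  have e4 : ∑ i, (L i).adjoint * x.2.2 * (1 + z (some i) x • 1 + (I none x + (x.2.1 : ℂ) • L i))
      = (∑ i, (L i).adjoint) * x.2.2 * (1 + I none x)
        + ∑ i, (L i).adjoint * x.2.2 * ((x.2.1 : ℂ) • L i + pair (b i) g x.1 x.2.1 • 1) := by
    rw [Finset.sum_mul, Finset.sum_mul, ← Finset.sum_add_distrib]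
    refine Finset.sum_congr rfl fun i _ => ?_
    rw [← mul_add]
    congr 1
    simp only [z, stepVec]
    abel
  rw [e4]
  noncomm_ring

end Estimates

/-! ### Limits of products of short-time steps -/

section Limits

/-- Steps that agree with the generator up to second order have products that converge to the
propagator. -/
theorem tendsto_stepProd {A : Type*} [NormedRing A] [NormedAlgebra ℂ A] [CompleteSpace A]
    {G : ℝ → A} {M T D : ℝ} (hG : IsBddGen G M) (h1 : ‖(1 : A)‖ ≤ 1) (hT : 0 ≤ T) {R : ℝ → ℝ → A}
    (hR : ∀ δ a, 0 ≤ δ → δ ≤ T → ‖R δ a - (1 + ∫ s in a..a + δ, G s)‖ ≤ D * δ ^ 2) :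
    Tendsto (fun N : ℕ => stepProd (R (T / N)) (T / N) N 0) atTop (𝓝 (propagator G 0 T)) := by
  have hM := hG.nonneg
  refine tendsto_of_step_bound (T := T) (C := 2 * (M + |D| * T))
    (D := |D| + M ^ 2 * Real.exp (M * T)) fun N hN => ?_
  have hN' : (N : ℝ) ≠ 0 := by exact_mod_cast hN
  have hN1 : (1 : ℝ) ≤ N := by exact_mod_cast Nat.one_le_iff_ne_zero.2 hN
  set δ : ℝ := T / N with hδ
  have h0 : 0 ≤ δ := by positivity
  have hle : δ ≤ T := div_le_self hT hN1
  have hR' : ∀ a, ‖R δ a - (1 + ∫ s in a..a + δ, G s)‖ ≤ |D| * δ ^ 2 := fun a =>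
    (hR δ a h0 hle).trans (by gcongr; exact le_abs_self D)
  have hrho : 1 + (M + |D| * T) * δ ≤ Real.exp ((M + |D| * T) * δ) := by
    rw [add_comm]; exact Real.add_one_le_exp _
  have hb : ∀ a, ‖R δ a‖ ≤ Real.exp ((M + |D| * T) * δ) := fun a => by
    refine le_trans ?_ hrho
    have hi := hG.norm_integral_le (a := a) (b := a + δ) (by linarith)
    rw [add_sub_cancel_left] at hi
    calc ‖R δ a‖ = ‖(R δ a - (1 + ∫ s in a..a + δ, G s)) + (1 + ∫ s in a..a + δ, G s)‖ := by
          rw [sub_add_cancel]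
      _ ≤ |D| * δ ^ 2 + (1 + M * δ) :=
          (norm_add_le _ _).trans (add_le_add (hR' a) ((norm_add_le _ _).trans (add_le_add h1 hi)))
      _ ≤ |D| * (T * δ) + (1 + M * δ) := by rw [pow_two]; gcongr
      _ = _ := by ring
  have key := norm_stepProd_sub_propagator_le hG h1 (R := R δ) (δ := δ)
    (ρ := Real.exp ((M + |D| * T) * δ)) (ε := (|D| + M ^ 2 * Real.exp (M * T)) * δ ^ 2) h0
    (Real.exp_le_exp.2 (by gcongr; exact le_add_of_nonneg_right (by positivity))) (by positivity) hb
    (fun a => ?_) N 0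
  · have e : (0 : ℝ) + N * δ = T := by rw [hδ]; field_simp; ring
    rw [e] at key
    refine key.trans (le_of_eq ?_)
    rw [← Real.exp_nat_mul, ← Real.exp_nat_mul, mul_assoc, ← mul_assoc (Real.exp _), ← Real.exp_add]
    ring_nf
  · have hp := norm_propagator_sub_le hG h1 (a := a) (t := a + δ) (by linarith)
    rw [add_sub_cancel_left] at hp
    calc ‖R δ a - propagator G a (a + δ)‖
        = ‖(R δ a - (1 + ∫ s in a..a + δ, G s))
            - (propagator G a (a + δ) - (1 + ∫ s in a..a + δ, G s))‖ := by congr 1; abel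
      _ ≤ |D| * δ ^ 2 + (M * δ) ^ 2 * Real.exp (M * δ) :=
          (norm_sub_le _ _).trans (add_le_add (hR' a) hp)
      _ ≤ |D| * δ ^ 2 + (M * δ) ^ 2 * Real.exp (M * T) := by gcongr
      _ = _ := by ring

/-- Convergence of iterated steps to a curve `z` that they follow up to second order. -/
theorem tendsto_iterMap {A : Type*} [SeminormedAddCommGroup A] {T C D : ℝ} (hC : 0 ≤ C) (hT : 0 ≤ T)
    (hD : 0 ≤ D) {P : ℝ → ℝ → A → A} {z : ℝ → A}
    (hP : ∀ δ a Q Q', 0 ≤ δ → δ ≤ T → ‖P δ a Q - P δ a Q'‖ ≤ (1 + C * δ) * ‖Q - Q'‖)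
    (hz : ∀ δ a s, 0 ≤ δ → δ ≤ T → 0 ≤ s → s ≤ T → ‖P δ a (z s) - z (s + δ)‖ ≤ D * δ ^ 2) :
    Tendsto (fun N : ℕ => iterMap (P (T / N)) (T / N) (z 0) N 0) atTop (𝓝 (z T)) := by
  refine tendsto_of_step_bound (T := T) (C := C) (D := D) fun N hN => ?_
  have hN' : (N : ℝ) ≠ 0 := by exact_mod_cast hN
  have hN1 : (1 : ℝ) ≤ N := by exact_mod_cast Nat.one_le_iff_ne_zero.2 hN
  set δ : ℝ := T / N with hδ
  have h0 : 0 ≤ δ := by positivity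
  have hle : δ ≤ T := div_le_self hT hN1
  have e : (N : ℝ) * δ = T := by rw [hδ]; field_simp
  have key := le_of_step_recursion (δ := δ) (ρ := Real.exp (C * δ)) (ε := D * δ ^ 2)
    (d := fun n a => ‖iterMap (P δ) δ (z 0) n a - z (n * δ)‖) (N := N)
    (Real.one_le_exp (by positivity)) (by positivity) (fun a => by simp [iterMap])
    (fun n hn a => ?_) le_rfl 0
  · simpa only [e] using key
  · have hs : (n : ℝ) * δ ≤ T := by
      rw [← e]; gcongr
    have e2 : ((n + 1 : ℕ) : ℝ) * δ = n * δ + δ := by push_cast; ring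
    calc ‖iterMap (P δ) δ (z 0) (n + 1) a - z (((n + 1 : ℕ) : ℝ) * δ)‖
        = ‖(P δ a (iterMap (P δ) δ (z 0) n (a + δ)) - P δ a (z (n * δ)))
            + (P δ a (z (n * δ)) - z (n * δ + δ))‖ := by
          rw [e2, iterMap]; congr 1; abel
      _ ≤ (1 + C * δ) * ‖iterMap (P δ) δ (z 0) n (a + δ) - z (n * δ)‖ + D * δ ^ 2 :=
          (norm_add_le _ _).trans
            (add_le_add (hP _ _ _ _ h0 hle) (hz _ _ _ h0 hle (by positivity) hs))
      _ ≤ _ := by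
          gcongr
          rw [add_comm]
          exact Real.add_one_le_exp _

theorem stepProd_succ' {A : Type*} [NormedRing A] (R : ℝ → A) (δ : ℝ) (n : ℕ) (a : ℝ) :
    stepProd R δ (n + 1) a = R (a + n * δ) * stepProd R δ n a := by
  induction n generalizing a with
  | zero => simp [stepProd]
  | succ n ih =>
    rw [stepProd, ih, stepProd, mul_assoc]
    congr 2
    push_cast
    ring

/-- Conjugation reverses the order of the steps, that is, the direction of time. -/
theorem star_stepProd {A : Type*} [NormedRing A] [StarRing A] {R R' : ℝ → A} {δ c : ℝ}
    (h : ∀ a, R' a = star (R (c - δ - a))) (n : ℕ) (a : ℝ) :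
    star (stepProd R δ n a) = stepProd R' δ n (c - a - n * δ) := by
  induction n generalizing a with
  | zero => simp [stepProd]
  | succ n ih =>
    rw [stepProd_succ' R', stepProd, star_mul, ih, h]
    congr 2
    · congr 1
      push_cast
      ring
    · push_cast
      ring

section Exp

variable {B : Type*} [NormedRing B] [NormedAlgebra ℂ B] [CompleteSpace B]

theorem hasDerivAt_exp_ofReal_smul (X : B) (t : ℝ) :
    HasDerivAt (fun s : ℝ => NormedSpace.exp ((s : ℂ) • X)) (X * NormedSpace.exp ((t : ℂ) • X)) t := by
  let := NormedAlgebra.restrictScalars ℚ ℂ B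
  have h := (hasDerivAt_exp_smul_const' (𝕂 := ℂ) X (t : ℂ)).scomp t Complex.ofRealCLM.hasDerivAt
  rw [Complex.ofRealCLM_apply, Complex.ofReal_one, one_smul] at h
  exact h

theorem continuous_exp_ofReal_smul (X : B) :
    Continuous fun s : ℝ => NormedSpace.exp ((s : ℂ) • X) :=
  continuous_iff_continuousAt.2 fun t => (hasDerivAt_exp_ofReal_smul X t).continuousAt

theorem exp_ofReal_add_smul (X : B) (s t : ℝ) : NormedSpace.exp (((s + t : ℝ) : ℂ) • X)
    = NormedSpace.exp ((s : ℂ) • X) * NormedSpace.exp ((t : ℂ) • X) := by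
  let := NormedAlgebra.restrictScalars ℚ ℂ B
  rw [← NormedSpace.exp_add_of_commute (((Commute.refl X).smul_left _).smul_right _), ← add_smul,
    Complex.ofReal_add]

theorem exp_zero_smul (X : B) : NormedSpace.exp (((0 : ℝ) : ℂ) • X) = 1 := by
  let := NormedAlgebra.restrictScalars ℚ ℂ B
  simp

/-- The propagator of a constant generator. -/
theorem propagator_const (X : B) {t : ℝ} (ht : 0 ≤ t) :
    propagator (fun _ => X) 0 t = NormedSpace.exp ((t : ℂ) • X) := by
  have hG : IsBddGen (fun _ : ℝ => X) ‖X‖ := ⟨aestronglyMeasurable_const, fun _ => le_rfl⟩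
  have hc := continuous_exp_ofReal_smul X
  have h := eq_propagator_mul hG (a := 0) (b := t) (x := 1)
    (X := fun s : ℝ => NormedSpace.exp ((s : ℂ) • X)) hc.continuousOn (fun s _ => ?_)
    (⟨ht, le_rfl⟩ : t ∈ Set.Icc 0 t)
  · simpa using h.symm
  · rw [intervalIntegral.integral_eq_sub_of_hasDerivAt
      (fun r _ => hasDerivAt_exp_ofReal_smul X r) ((continuous_const.mul hc).intervalIntegrable _ _)]
    rw [exp_zero_smul]
    abel

theorem norm_exp_smul_sub_le (h1 : ‖(1 : B)‖ ≤ 1) (X : B) {T δ : ℝ} (h0 : 0 ≤ δ) (hle : δ ≤ T) :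
    ‖NormedSpace.exp ((δ : ℂ) • X) - (1 + (δ : ℂ) • X)‖ ≤ ‖X‖ ^ 2 * Real.exp (‖X‖ * T) * δ ^ 2 := by
  have hG : IsBddGen (fun _ : ℝ => X) ‖X‖ := ⟨aestronglyMeasurable_const, fun _ => le_rfl⟩
  have h := norm_propagator_sub_le hG h1 h0
  rw [propagator_const X h0] at h
  simp only [intervalIntegral.integral_const, sub_zero] at h
  rw [← Complex.coe_smul δ X] at h
  refine h.trans ?_
  rw [mul_pow, mul_right_comm]
  gcongr

end Exp

variable {K 𝔥 ι : Type*} [NormedAddCommGroup K] [InnerProductSpace ℂ K]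
  [FiniteDimensional ℂ K] [CompleteSpace K]
  [NormedAddCommGroup 𝔥] [InnerProductSpace ℂ 𝔥] [Fintype ι]
  {Y : K →L[ℂ] K} {L : ι → K →L[ℂ] K} {b : ι → 𝔥} {T : ℝ}

theorem tendsto_matStep (hT : 0 ≤ T) (f g : Lab 𝔥) :
    Tendsto (fun N : ℕ => stepProd (matStep Y L b (T / N) f g) (T / N) N 0) atTop
      (𝓝 (propagator (gen Y L b f g) 0 T)) := by
  obtain ⟨M, hM⟩ := exists_isBddGen (Y := Y) (L := L) (b := b) f g
  obtain ⟨D, hD⟩ := Asymptotics.isBigO_principal.1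
    (isBigO_matStep_sub (T := T) (Y := Y) (L := L) (b := b) f g)
  refine tendsto_stepProd (R := fun δ a => matStep Y L b δ f g a) (D := D) hM norm_one_le hT
    fun δ a h0 hle => ?_
  simpa using hD (a, δ, 0) ⟨h0, hle⟩

/-- The approximations are bounded as the step length tends to `0`. -/
theorem exists_bound_gramStep (hT : 0 ≤ T) (f g : Lab 𝔥) :
    ∃ C, ∀ N : ℕ, N ≠ 0 → ‖iterMap (gramStep Y L b (T / N) f g) (T / N) 1 N 0‖ ≤ C := by
  obtain ⟨D, hD⟩ := Asymptotics.isBigO_principal.1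
    (isBigO_gramStep_sub (T := T) (Y := Y) (L := L) (b := b) f g)
  refine ⟨Real.exp (|D| * T), fun N hN => ?_⟩
  have hN' : (N : ℝ) ≠ 0 := by exact_mod_cast hN
  have hN1 : (1 : ℝ) ≤ N := by exact_mod_cast Nat.one_le_iff_ne_zero.2 hN
  set δ : ℝ := T / N with hδ
  have h0 : 0 ≤ δ := by positivity
  have hle : δ ≤ T := div_le_self hT hN1
  have hstep : ∀ a Q, ‖gramStep Y L b δ f g a Q‖ ≤ Real.exp (|D| * δ) * ‖Q‖ := fun a Q => by
    have h : ‖gramStep Y L b δ f g a Q - Q‖ ≤ |D| * (δ * ‖Q‖) := by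
      refine (hD (a, δ, Q) ⟨h0, hle⟩).trans ?_
      rw [Real.norm_eq_abs, abs_of_nonneg (by positivity : 0 ≤ δ * ‖Q‖)]
      gcongr
      exact le_abs_self D
    calc ‖gramStep Y L b δ f g a Q‖ = ‖(gramStep Y L b δ f g a Q - Q) + Q‖ := by rw [sub_add_cancel]
      _ ≤ |D| * (δ * ‖Q‖) + ‖Q‖ := (norm_add_le _ _).trans (add_le_add h le_rfl)
      _ = (|D| * δ + 1) * ‖Q‖ := by ring
      _ ≤ _ := by gcongr; exact Real.add_one_le_exp _
  have key : ∀ n a, ‖iterMap (gramStep Y L b δ f g) δ 1 n a‖ ≤ Real.exp (|D| * δ) ^ n := by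
    intro n
    induction n with
    | zero => intro a; simpa [iterMap] using norm_one_le
    | succ n ih =>
      intro a
      rw [pow_succ']
      exact (hstep _ _).trans (by gcongr; exact ih _)
  refine (key N 0).trans (le_of_eq ?_)
  rw [← Real.exp_nat_mul]
  congr 1
  rw [hδ]
  field_simp

variable (Y L) in
/-- The Lindblad generator `Q ↦ Y† Q + Q Y + ∑ i, L i† Q L i`. -/
def hpLindblad : (K →L[ℂ] K) →L[ℂ] (K →L[ℂ] K) :=
  ContinuousLinearMap.mul ℂ _ Y.adjoint + (ContinuousLinearMap.mul ℂ _).flip Y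
    + ∑ i, ContinuousLinearMap.mulLeftRight ℂ _ (L i).adjoint (L i)

theorem hpLindblad_apply (Q : K →L[ℂ] K) :
    hpLindblad Y L Q = Y.adjoint * Q + Q * Y + ∑ i, (L i).adjoint * Q * L i := by
  simp [hpLindblad, sum_apply, ContinuousLinearMap.mulLeftRight_apply]

/-- The Itô correction cancels the real part of the drift. -/
theorem semiLin_one (hYL : Y + Y.adjoint + ∑ i, (L i).adjoint * L i = 0) (δ : ℝ) (f g : Lab 𝔥)
    (a : ℝ) : semiLin Y L b δ f g a 1 = 0 := by
  have h : (δ : ℂ) • Y.adjoint = -((δ : ℂ) • Y + ∑ i, (L i).adjoint * ((δ : ℂ) • L i)) := by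
    simp only [mul_smul_comm, ← Finset.smul_sum, ← smul_add, ← smul_neg]
    congr 1
    rw [eq_neg_iff_add_eq_zero, ← hYL]
    abel
  simp only [semiLin, mul_one, one_mul, integral_gen, map_sub, map_sum, map_smulₛₗ,
    ContinuousLinearMap.adjoint_adjoint, mul_add, Finset.sum_add_distrib, Complex.conj_ofReal, h,
    mul_smul_comm]
  abel

/-- On the vacuum the first order part of a step is the Lindblad generator. -/
theorem semiLin_zero (δ : ℝ) (a : ℝ) (Q : K →L[ℂ] K) :
    semiLin Y L b δ 0 0 a Q = (δ : ℂ) • hpLindblad Y L Q := by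
  have h : ∀ c : 𝔥, pair c 0 a δ = 0 := fun c => by simp [pair]
  simp only [semiLin, integral_gen, h, hpLindblad_apply, zero_smul, Finset.sum_const_zero, sub_zero,
    map_zero, add_zero, map_smulₛₗ, Complex.conj_ofReal, smul_mul_assoc, mul_smul_comm, smul_add,
    Finset.smul_sum]

theorem semiStep_sub (δ : ℝ) (f g : Lab 𝔥) (a : ℝ) (Q Q' : K →L[ℂ] K) :
    semiStep Y L b δ f g a Q - semiStep Y L b δ f g a Q' = semiStep Y L b δ f g a (Q - Q') := by
  simp only [semiStep, ← Finset.sum_sub_distrib, ← smul_sub, mul_sub, sub_mul]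

/-- Stability of the steps: they expand by at most `1 + C δ`. -/
theorem exists_norm_semiStep_le (hb : Orthonormal ℂ b) (f g : Lab 𝔥) (T : ℝ) :
    ∃ C, 0 ≤ C ∧ ∀ δ a Q, 0 ≤ δ → δ ≤ T → ‖semiStep Y L b δ f g a Q‖ ≤ (1 + C * δ) * ‖Q‖ := by
  have hlin : (fun x : ℝ × ℝ × (K →L[ℂ] K) => semiLin Y L b x.2.1 f g x.1 x.2.2)
      =O[stepFilter K T] fun x => x.2.1 * ‖x.2.2‖ := by
    have h0 : ∀ x : ℝ × ℝ × (K →L[ℂ] K), f + stepLab x.1 x.2.1 0 = f := fun x => by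
      rw [show (stepLab x.1 x.2.1 0 : Lab 𝔥) = 0 from Subtype.ext (funext fun s => by simp [stepLab]),
        add_zero]
    have hf := isBigO_adjoint (isBigO_drift (T := T) (Y := Y) (L := L) (b := b) f)
    have hI := isBigO_integral_gen (T := T) (Y := Y) (L := L) (b := b) f g 0
    simp only [h0] at hI
    refine ((hf.mul isBigO_id_step).add ((isBigO_id_step.mul hI).congr_right fun x => mul_comm _ _)).add
      (Asymptotics.IsBigO.fun_sum fun i _ => ?_)
    have hδ : (fun x : ℝ × ℝ × (K →L[ℂ] K) => (x.2.1 : ℂ) • L i + pair (b i) g x.1 x.2.1 • 1)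
        =O[stepFilter K T] fun x => x.2.1 := by
      refine Asymptotics.IsBigO.add ?_ ?_
      · refine isBigO_stepFilter ‖L i‖ fun a δ Q h0 _ => ?_
        rw [norm_smul, mul_comm]
        simp
      · simpa using (isBigO_pair (b i) g).smul (isBigO_const_one' (1 : K →L[ℂ] K))
    refine (((isBigO_const_one' (L i).adjoint).mul isBigO_id_step).mul hδ).congr_right fun x => ?_
    ring
  have hsq : (fun x : ℝ × ℝ × (K →L[ℂ] K) => x.2.1 ^ 2 * ‖x.2.2‖)
      =O[stepFilter K T] fun x => x.2.1 * ‖x.2.2‖ := by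
    refine Asymptotics.IsBigO.mul ?_ (Asymptotics.isBigO_refl _ _)
    exact isBigO_step_of_sq (Asymptotics.isBigO_refl _ _)
  have h := ((isBigO_semiStep_sub (T := T) (Y := Y) (L := L) hb f g).trans hsq).add hlin
  obtain ⟨C, hC⟩ := Asymptotics.isBigO_principal.1 h
  refine ⟨|C|, abs_nonneg _, fun δ a Q h0 hle => ?_⟩
  have h' := hC (a, δ, Q) ⟨h0, hle⟩
  simp only at h'
  have e : semiStep Y L b δ f g a Q - (Q + semiLin Y L b δ f g a Q) + semiLin Y L b δ f g a Q
      = semiStep Y L b δ f g a Q - Q := by abel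
  rw [e, Real.norm_eq_abs, abs_of_nonneg (by positivity : 0 ≤ δ * ‖Q‖)] at h'
  calc ‖semiStep Y L b δ f g a Q‖ = ‖(semiStep Y L b δ f g a Q - Q) + Q‖ := by rw [sub_add_cancel]
    _ ≤ C * (δ * ‖Q‖) + ‖Q‖ := (norm_add_le _ _).trans (add_le_add h' le_rfl)
    _ ≤ |C| * (δ * ‖Q‖) + ‖Q‖ := by gcongr; exact le_abs_self C
    _ = _ := by ring

/-- Conservation of probability, the source of isometry: the steps preserve `1` up to second
order. -/
theorem tendsto_semiStep_one (hb : Orthonormal ℂ b)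
    (hYL : Y + Y.adjoint + ∑ i, (L i).adjoint * L i = 0) (hT : 0 ≤ T) (f g : Lab 𝔥) :
    Tendsto (fun N : ℕ => iterMap (semiStep Y L b (T / N) f g) (T / N) 1 N 0) atTop (𝓝 1) := by
  obtain ⟨C, hC0, hC⟩ := exists_norm_semiStep_le (Y := Y) (L := L) hb f g T
  obtain ⟨D, hD⟩ := Asymptotics.isBigO_principal.1
    (isBigO_semiStep_sub (T := T) (Y := Y) (L := L) hb f g)
  refine tendsto_iterMap (C := C) (D := |D|) (P := fun δ => semiStep Y L b δ f g)
    (z := fun _ => 1) hC0 hT (abs_nonneg _)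
    (fun δ a Q Q' h0 hle => by rw [semiStep_sub]; exact hC δ a _ h0 hle) fun δ a s h0 hle _ _ => ?_
  have h := hD (a, δ, 1) ⟨h0, hle⟩
  simp only [semiLin_one hYL, add_zero] at h
  refine h.trans ?_
  rw [Real.norm_eq_abs, abs_of_nonneg (by positivity)]
  calc D * (δ ^ 2 * ‖(1 : K →L[ℂ] K)‖) ≤ |D| * (δ ^ 2 * 1) := by
        gcongr
        · exact le_abs_self D
        · exact norm_one_le
    _ = _ := by ring

/-- On the vacuum the steps follow the semigroup of the Lindblad generator. -/
theorem tendsto_semiStep_lindblad (hb : Orthonormal ℂ b) (hT : 0 ≤ T) (S : K →L[ℂ] K) :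
    Tendsto (fun N : ℕ => iterMap (semiStep Y L b (T / N) 0 0) (T / N) S N 0) atTop
      (𝓝 (NormedSpace.exp ((T : ℂ) • hpLindblad Y L) S)) := by
  obtain ⟨C, hC0, hC⟩ := exists_norm_semiStep_le (Y := Y) (L := L) hb 0 0 T
  obtain ⟨D, hD⟩ := Asymptotics.isBigO_principal.1
    (isBigO_semiStep_sub (T := T) (Y := Y) (L := L) hb 0 0)
  set Λ := hpLindblad Y L with hΛ
  let z : ℝ → K →L[ℂ] K := fun s => NormedSpace.exp ((s : ℂ) • Λ) S
  have hadd : ∀ s δ : ℝ, z (s + δ) = NormedSpace.exp ((δ : ℂ) • Λ) (z s) := fun s δ => by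
    have h := congrArg (fun X => X S) (exp_ofReal_add_smul Λ δ s)
    simp only [z, add_comm s δ]
    exact h
  obtain ⟨B, hB⟩ := isCompact_Icc.exists_bound_of_continuousOn (s := Set.Icc 0 T) (f := z)
    ((continuous_exp_ofReal_smul Λ).clm_apply continuous_const).continuousOn
  have hz0 : z 0 = S := congrArg (fun X => X S) (exp_zero_smul Λ)
  have hB0 : 0 ≤ B := (norm_nonneg _).trans (hB 0 ⟨le_rfl, hT⟩)
  have := tendsto_iterMap (C := C) (D := (|D| + ‖Λ‖ ^ 2 * Real.exp (‖Λ‖ * T)) * B)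
    (P := fun δ => semiStep Y L b δ 0 0) (z := z) hC0 hT (by positivity)
    (fun δ a Q Q' h0 hle => by rw [semiStep_sub]; exact hC δ a _ h0 hle) fun δ a s h0 hle hs0 hs => ?_
  · simpa only [hz0] using this
  · have h := hD (a, δ, z s) ⟨h0, hle⟩
    simp only [semiLin_zero, ← hΛ] at h
    rw [Real.norm_eq_abs, abs_of_nonneg (by positivity)] at h
    have h2 : ‖z (s + δ) - (z s + (δ : ℂ) • Λ (z s))‖
        ≤ ‖Λ‖ ^ 2 * Real.exp (‖Λ‖ * T) * δ ^ 2 * B := by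
      rw [hadd]
      refine ((NormedSpace.exp ((δ : ℂ) • Λ) - (1 + (δ : ℂ) • Λ)).le_opNorm (z s)).trans ?_
      gcongr
      · exact norm_exp_smul_sub_le ContinuousLinearMap.norm_id_le Λ h0 hle
      · exact hB s ⟨hs0, hs⟩
    calc ‖semiStep Y L b δ 0 0 a (z s) - z (s + δ)‖
        = ‖(semiStep Y L b δ 0 0 a (z s) - (z s + (δ : ℂ) • Λ (z s)))
            - (z (s + δ) - (z s + (δ : ℂ) • Λ (z s)))‖ := by congr 1; abel
      _ ≤ |D| * (δ ^ 2 * B) + ‖Λ‖ ^ 2 * Real.exp (‖Λ‖ * T) * δ ^ 2 * B := by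
          refine (norm_sub_le _ _).trans (add_le_add (h.trans ?_) h2)
          gcongr
          · exact le_abs_self D
          · exact hB s ⟨hs0, hs⟩
      _ = _ := by ring

end Limits

/-! ### The unitary cocycle -/

section Cocycle

variable {K 𝔥 F ι : Type*} [NormedAddCommGroup K] [InnerProductSpace ℂ K]
  [FiniteDimensional ℂ K] [CompleteSpace K]
  [NormedAddCommGroup 𝔥] [InnerProductSpace ℂ 𝔥]
  [NormedAddCommGroup F] [InnerProductSpace ℂ F] [CompleteSpace F] [Fintype ι]

/-- `V` has the matrix elements of the cocycle at time `T` between exponential vectors. -/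
def HasCocycleMatrix (Y : K →L[ℂ] K) (L : ι → K →L[ℂ] K) (b : ι → 𝔥) (e : Lab 𝔥 → F) (T : ℝ)
    (V : K → Lab 𝔥 → K ⊗[ℂ] F) : Prop :=
  ∀ k' k f g, ⟪k' ⊗ₜ[ℂ] e f, V k g⟫_ℂ
    = Complex.exp (labInner f g) * ⟪k', propagator (gen Y L b f g) 0 T k⟫_ℂ

variable {Y : K →L[ℂ] K} {L : ι → K →L[ℂ] K} {b : ι → 𝔥} {e : Lab 𝔥 → F} {T : ℝ}

theorem sub_succ_cast (N : ℕ) (T : ℝ) : (0 : ℝ) + ((N + 1 : ℕ) : ℝ) * (T / ((N + 1 : ℕ) : ℝ)) = T := by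
  have : ((N + 1 : ℕ) : ℝ) ≠ 0 := by positivity
  field_simp
  ring

/-- The approximations converge weakly: they are bounded, and their inner products with the total
family of vectors `k ⊗ e f` converge. -/
theorem exists_weak_limit_approx (he : ∀ p q, ⟪e p, e q⟫_ℂ = Complex.exp (labInner p q))
    (het : Total e) (hT : 0 ≤ T) (k : K) (g : Lab 𝔥) :
    ∃ y : K ⊗[ℂ] F, (∀ k' f, ⟪k' ⊗ₜ[ℂ] e f, y⟫_ℂ
      = Complex.exp (labInner f g) * ⟪k', propagator (gen Y L b f g) 0 T k⟫_ℂ) ∧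
      ∀ z, Tendsto (fun N : ℕ => ⟪z, approx Y L b e (T / ((N + 1 : ℕ) : ℝ)) (N + 1) 0 k g⟫_ℂ) atTop
        (𝓝 ⟪z, y⟫_ℂ) := by
  obtain ⟨C, hC⟩ := exists_bound_gramStep (Y := Y) (L := L) (b := b) hT g g
  have hbound : ∀ N : ℕ, ‖approx Y L b e (T / ((N + 1 : ℕ) : ℝ)) (N + 1) 0 k g‖
      ≤ Real.sqrt (‖Complex.exp (labInner g g)‖ * (‖k‖ * (C * ‖k‖))) := fun N => by
    refine Real.le_sqrt_of_sq_le ?_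
    rw [← @inner_self_eq_norm_sq ℂ, inner_approx_approx he (by positivity)]
    refine (RCLike.re_le_norm _).trans ?_
    rw [norm_mul]
    gcongr
    refine (norm_inner_le_norm _ _).trans ?_
    gcongr
    refine (ContinuousLinearMap.le_opNorm _ _).trans ?_
    gcongr
    exact hC (N + 1) (by omega)
  have hlim : ∀ p : K × Lab 𝔥, Tendsto (fun N : ℕ =>
      ⟪p.1 ⊗ₜ[ℂ] e p.2, approx Y L b e (T / ((N + 1 : ℕ) : ℝ)) (N + 1) 0 k g⟫_ℂ) atTop
      (𝓝 (Complex.exp (labInner p.2 g) * ⟪p.1, propagator (gen Y L b p.2 g) 0 T k⟫_ℂ)) := fun p => by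
    have h := (tendsto_matStep (Y := Y) (L := L) (b := b) hT p.2 g).comp (tendsto_add_atTop_nat 1)
    have h2 : Continuous fun X : K →L[ℂ] K => Complex.exp (labInner p.2 g) * ⟪p.1, X k⟫_ℂ := by
      fun_prop
    refine ((h2.tendsto _).comp h).congr fun N => ?_
    rw [inner_tmul_approx he (by positivity)]
    rfl
  obtain ⟨y, hy⟩ := (Total.tmul (K := K) het).exists_weak_limit hbound hlim
  exact ⟨y, fun k' f => tendsto_nhds_unique (hy _) (hlim (k', f)), hy⟩

/-- Matrix elements of `S ⊗ 1` between weak limits. Only the left-hand vector is approximated; a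
simultaneous limit on both sides would not be controlled by weak convergence. -/
theorem inner_ampl_of_tendsto (hT : 0 ≤ T)
    {V : K → Lab 𝔥 → K ⊗[ℂ] F} (hV : HasCocycleMatrix Y L b e T V)
    (hlim : ∀ k g z, Tendsto (fun N : ℕ =>
      ⟪z, approx Y L b e (T / ((N + 1 : ℕ) : ℝ)) (N + 1) 0 k g⟫_ℂ) atTop (𝓝 ⟪z, V k g⟫_ℂ))
    {S Q : K →L[ℂ] K} {f g : Lab 𝔥}
    (hS : Tendsto (fun N : ℕ => iterMap (semiStep Y L b (T / N) f g) (T / N) S N 0) atTop (𝓝 Q))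
    (k' k : K) :
    ⟪V k' f, ampl F S (V k g)⟫_ℂ = Complex.exp (labInner f g) * ⟪k', Q k⟫_ℂ := by
  have h1 : Tendsto (fun N : ℕ =>
      ⟪approx Y L b e (T / ((N + 1 : ℕ) : ℝ)) (N + 1) 0 k' f, ampl F S (V k g)⟫_ℂ) atTop
      (𝓝 ⟪V k' f, ampl F S (V k g)⟫_ℂ) := by
    have := (Complex.continuous_conj.tendsto _).comp (hlim k' f (ampl F S (V k g)))
    have h2 : (starRingEnd ℂ) ⟪ampl F S (V k g), V k' f⟫_ℂ = ⟪V k' f, ampl F S (V k g)⟫_ℂ :=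
      inner_conj_symm (𝕜 := ℂ) (E := K ⊗[ℂ] F) _ _
    rw [← h2]
    exact this.congr fun N => inner_conj_symm (𝕜 := ℂ) (E := K ⊗[ℂ] F) _ _
  refine tendsto_nhds_unique h1 ?_
  have h2 : Continuous fun X : K →L[ℂ] K => Complex.exp (labInner f g) * ⟪k', X k⟫_ℂ := by fun_prop
  refine ((h2.tendsto _).comp (hS.comp (tendsto_add_atTop_nat 1))).congr fun N => ?_
  rw [inner_approx_ampl (fun f g => (exists_isBddGen (Y := Y) (L := L) (b := b) f g).choose_spec) hV S
    (by positivity) (N + 1) le_rfl (sub_succ_cast N T), propagator_self, mul_one]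
  rfl

/-- Existence of the cocycle at time `T` as an isometry, with the semigroup that it dilates. -/
theorem exists_cocycle (he : ∀ p q, ⟪e p, e q⟫_ℂ = Complex.exp (labInner p q)) (het : Total e)
    (hb : Orthonormal ℂ b) (hYL : Y + Y.adjoint + ∑ i, (L i).adjoint * L i = 0) (hT : 0 ≤ T) :
    ∃ V : K ⊗[ℂ] F →L[ℂ] K ⊗[ℂ] F, HasCocycleMatrix Y L b e T (fun k g => V (k ⊗ₜ[ℂ] e g)) ∧
      (∀ x y, ⟪V x, V y⟫_ℂ = ⟪x, y⟫_ℂ) ∧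
      (∀ k g z, Tendsto (fun N : ℕ =>
        ⟪z, approx Y L b e (T / ((N + 1 : ℕ) : ℝ)) (N + 1) 0 k g⟫_ℂ) atTop
        (𝓝 ⟪z, V (k ⊗ₜ[ℂ] e g)⟫_ℂ)) ∧
      ∀ (S : K →L[ℂ] K) k' k, ⟪V (k' ⊗ₜ[ℂ] e 0), ampl F S (V (k ⊗ₜ[ℂ] e 0))⟫_ℂ
        = ⟪k', NormedSpace.exp ((T : ℂ) • hpLindblad Y L) S k⟫_ℂ := by
  choose Φ hΦ hlim using fun k g => exists_weak_limit_approx (Y := Y) (L := L) (b := b) he het hT k g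
  have hΦ' : HasCocycleMatrix Y L b e T Φ := fun k' k f g => hΦ k g k' f
  have hgram : ∀ x y : K × Lab 𝔥, ⟪Φ x.1 x.2, Φ y.1 y.2⟫_ℂ
      = ⟪x.1 ⊗ₜ[ℂ] e x.2, y.1 ⊗ₜ[ℂ] e y.2⟫_ℂ := fun x y => by
    have := inner_ampl_of_tendsto hT hΦ' hlim (tendsto_semiStep_one hb hYL hT x.2 y.2) x.1 y.1
    rw [ampl_one] at this
    rw [TensorProduct.inner_tmul, he, mul_comm]
    exact this
  obtain ⟨V, hV, hV'⟩ := (Total.tmul (K := K) het).exists_isometry (fun x => Φ x.1 x.2) hgram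
  have hV2 : ∀ k g, V (k ⊗ₜ[ℂ] e g) = Φ k g := fun k g => hV (k, g)
  refine ⟨V, ?_, hV', ?_, ?_⟩
  · simpa only [hV2] using hΦ'
  · simpa only [hV2] using hlim
  · intro S k' k
    have := inner_ampl_of_tendsto hT hΦ' hlim (tendsto_semiStep_lindblad hb hT S) k' k
    rw [hV2, hV2, this]
    simp [labInner]

/-! #### Time reversal -/

theorem pair_revLab (c : 𝔥) (g : Lab 𝔥) (a δ : ℝ) :
    pair c (revLab T g) a δ = pair c g (T - δ - a) δ := by
  unfold pair
  have h := intervalIntegral.integral_comp_sub_left (a := a) (b := a + δ)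
    (fun s => ⟪c, g.1 s⟫_ℂ) T
  rw [show T - (a + δ) = T - δ - a by ring] at h
  rw [show T - δ - a + δ = T - a by ring]
  exact h

/-- The adjoint of the propagator is the propagator of the time-reversed data. -/
theorem adjoint_propagator_gen (hT : 0 ≤ T) (f g : Lab 𝔥) :
    (propagator (gen Y L b g f) 0 T).adjoint
      = propagator (gen Y.adjoint (fun i => -L i) b (revLab T f) (revLab T g)) 0 T := by
  obtain ⟨M, hM⟩ := exists_isBddGen (Y := Y) (L := L) (b := b) g f
  obtain ⟨M', hM'⟩ := exists_isBddGen (Y := Y.adjoint) (L := fun i => -L i) (b := b)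
    (revLab T f) (revLab T g)
  have h1 := tendsto_stepProd (D := 0) hM norm_one_le hT
    (R := fun δ a => 1 + ∫ s in a..a + δ, gen Y L b g f s) fun δ a _ _ => by simp
  have h2 := tendsto_stepProd (D := 0) hM' norm_one_le hT
    (R := fun δ a => 1 + ∫ s in a..a + δ,
      gen Y.adjoint (fun i => -L i) b (revLab T f) (revLab T g) s) fun δ a _ _ => by simp
  have h3 := ((ContinuousLinearMap.adjoint (𝕜 := ℂ) (E := K) (F := K)).continuous.tendsto _).comp h1
  refine tendsto_nhds_unique (h3.congr' ?_) h2
  filter_upwards [eventually_ne_atTop 0] with N hN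
  have hN' : (N : ℝ) ≠ 0 := by exact_mod_cast hN
  have h4 := star_stepProd (δ := T / N) (c := T)
    (R := fun a => 1 + ∫ s in a..a + T / N, gen Y L b g f s)
    (R' := fun a => 1 + ∫ s in a..a + T / N,
      gen Y.adjoint (fun i => -L i) b (revLab T f) (revLab T g) s) (fun a => ?_) N 0
  · have e0 : T - 0 - N * (T / N) = 0 := by field_simp; ring
    rw [e0] at h4
    exact h4
  · rw [star_add, star_one, integral_gen, integral_gen, ContinuousLinearMap.star_eq_adjoint]
    simp only [map_sub, map_add, map_sum, map_smulₛₗ, map_neg, pair_revLab,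
      ContinuousLinearMap.adjoint_adjoint, smul_neg, Complex.conj_ofReal, Complex.conj_conj,
      Finset.sum_neg_distrib]
    abel

variable (Γ : F →L[ℂ] F)

theorem inner_lTensor {Γ : F →L[ℂ] F} (hΓ : ∀ x y, ⟪Γ x, Γ y⟫_ℂ = ⟪x, y⟫_ℂ) (x y : K ⊗[ℂ] F) :
    ⟪Γ.lTensor K x, Γ.lTensor K y⟫_ℂ = ⟪x, y⟫_ℂ := by
  let Γ' : F →ₗᵢ[ℂ] F := Γ.toLinearMap.isometryOfInner hΓ
  have h : ∀ z, Γ.lTensor K z = Γ'.lTensor K z := fun z => by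
    induction z using TensorProduct.induction_on with
    | zero => simp
    | tmul k f => simp [Γ']
    | add x y hx hy => rw [map_add, map_add, hx, hy]
  rw [h, h]
  exact (Γ'.lTensor K).inner_map_map x y

theorem ampl_lTensor (S : K →L[ℂ] K) (Γ : F →L[ℂ] F) (x : K ⊗[ℂ] F) :
    ampl F S (Γ.lTensor K x) = Γ.lTensor K (ampl F S x) := by
  induction x using TensorProduct.induction_on with
  | zero => simp
  | tmul k f => rfl
  | add x y hx hy => rw [map_add, map_add, map_add, map_add, hx, hy]

/-- The adjoint of the cocycle is its time reversal; hence it is isometric, and dilates the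
semigroup of the time-reversed data. -/
theorem cocycle_adjoint (he : ∀ p q, ⟪e p, e q⟫_ℂ = Complex.exp (labInner p q)) (het : Total e)
    (hb : Orthonormal ℂ b) (hYL : Y + Y.adjoint + ∑ i, (L i).adjoint * L i = 0) (hT : 0 ≤ T)
    {V : K ⊗[ℂ] F →L[ℂ] K ⊗[ℂ] F}
    (hV : HasCocycleMatrix Y L b e T (fun k g => V (k ⊗ₜ[ℂ] e g))) :
    (∀ x y, ⟪V.adjoint x, V.adjoint y⟫_ℂ = ⟪x, y⟫_ℂ) ∧
      ∀ (S : K →L[ℂ] K) k' k, ⟪V.adjoint (k' ⊗ₜ[ℂ] e 0), ampl F S (V.adjoint (k ⊗ₜ[ℂ] e 0))⟫_ℂ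
        = ⟪k', NormedSpace.exp ((T : ℂ) • hpLindblad Y.adjoint fun i => -L i) S k⟫_ℂ := by
  obtain ⟨Γ, hΓe, hΓ⟩ := het.exists_isometry (fun p => e (revLab T p)) fun p q => by
    rw [he, he, labInner_revLab]
  have hYL' : Y.adjoint + Y.adjoint.adjoint + ∑ i, (-L i).adjoint * -L i = 0 := by
    rw [← hYL, ContinuousLinearMap.adjoint_adjoint, add_comm Y]
    simp
  obtain ⟨V', hV'm, hV'i, -, hV'L⟩ := exists_cocycle (L := fun i => -L i) he het hb hYL' hT
  have hrev : ∀ p : Lab 𝔥, revLab T (revLab T p) = p := fun p =>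
    Subtype.ext (funext fun s => congrArg p.1 (sub_sub_cancel T s))
  -- The reversal `Γ` of `[0, T]` intertwines the adjoint with the cocycle of the data `Y†`, `-L`.
  have key : ∀ k q, V.adjoint (k ⊗ₜ[ℂ] e q) = Γ.lTensor K (V' (k ⊗ₜ[ℂ] e (revLab T q))) := by
    intro k q
    refine (Total.tmul (K := K) het).ext_inner fun ⟨k', p⟩ => ?_
    have h1 : k' ⊗ₜ[ℂ] e p = Γ.lTensor K (k' ⊗ₜ[ℂ] e (revLab T p)) := by
      rw [ContinuousLinearMap.lTensor_tmul, hΓe, hrev]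
    calc ⟪k' ⊗ₜ[ℂ] e p, V.adjoint (k ⊗ₜ[ℂ] e q)⟫_ℂ
        = (starRingEnd ℂ) ⟪k ⊗ₜ[ℂ] e q, V (k' ⊗ₜ[ℂ] e p)⟫_ℂ := by
          rw [ContinuousLinearMap.adjoint_inner_right]
          exact (inner_conj_symm (𝕜 := ℂ) (E := K ⊗[ℂ] F) _ _).symm
      _ = Complex.exp (labInner p q) * ⟪k', (propagator (gen Y L b q p) 0 T).adjoint k⟫_ℂ := by
          rw [hV, map_mul, ← Complex.exp_conj, labInner_conj, inner_conj_symm,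
            ContinuousLinearMap.adjoint_inner_right]
      _ = ⟪k' ⊗ₜ[ℂ] e p, Γ.lTensor K (V' (k ⊗ₜ[ℂ] e (revLab T q)))⟫_ℂ := by
          rw [h1, inner_lTensor hΓ, hV'm, labInner_revLab, adjoint_propagator_gen hT]
  have h0 : revLab T (0 : Lab 𝔥) = 0 := rfl
  constructor
  · have h1 : V.adjoint.adjoint ∘L V.adjoint = 1 := by
      refine (Total.tmul (K := K) het).clm_ext fun ⟨k, q⟩ => ?_
      refine (Total.tmul (K := K) het).ext_inner fun ⟨k', p⟩ => ?_
      rw [ContinuousLinearMap.comp_apply, ContinuousLinearMap.adjoint_inner_right]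
      simp only [key]
      rw [inner_lTensor hΓ, hV'i, TensorProduct.inner_tmul (𝕜 := ℂ), he, labInner_revLab, ← he]
      exact (TensorProduct.inner_tmul ..).symm
    intro x y
    rw [← ContinuousLinearMap.adjoint_inner_right, ← ContinuousLinearMap.comp_apply, h1]
    rfl
  · intro S k' k
    rw [key, key, h0, ampl_lTensor, inner_lTensor hΓ, hV'L]

/-! #### The cocycle identity -/

/-- Operators that act after time `t` do not see the displacements of the approximations. -/
theorem inner_tmul_clm_approx {B : K ⊗[ℂ] F →L[ℂ] K ⊗[ℂ] F} {s t : ℝ} (hs : 0 ≤ s)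
    (hB : ∀ k' k f g, ⟪k' ⊗ₜ[ℂ] e f, B (k ⊗ₜ[ℂ] e g)⟫_ℂ
      = Complex.exp (labInner f g) * ⟪k', propagator (gen Y L b f g) t (s + t) k⟫_ℂ)
    {δ : ℝ} (hδ : 0 ≤ δ) (n : ℕ) (a : ℝ) (hat : a + n * δ ≤ t) (k' k : K) (f g : Lab 𝔥) :
    ⟪k' ⊗ₜ[ℂ] e f, B (approx Y L b e δ n a k g)⟫_ℂ = Complex.exp (labInner f g) *
      ⟪k', propagator (gen Y L b f g) t (s + t) (stepProd (matStep Y L b δ f g) δ n a k)⟫_ℂ := by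
  induction n generalizing a k g with
  | zero => simp [approx, stepProd, hB]
  | succ n ih =>
    have hn : (0 : ℝ) ≤ n * δ := by positivity
    have hat' : a + δ + n * δ ≤ t := by push_cast at hat; linarith
    have hs' : ∀ α, stepProd (matStep Y L b δ f (g + stepLab a δ (stepVec b α))) δ n (a + δ)
        = stepProd (matStep Y L b δ f g) δ n (a + δ) := fun α =>
      stepProd_congr hδ n fun a' ha' => by
        simp only [matStep, stepCoeff_add_stepLab hδ ha']
    have hp : ∀ α, propagator (gen Y L b f (g + stepLab a δ (stepVec b α))) t (s + t)
        = propagator (gen Y L b f g) t (s + t) := fun α =>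
      propagator_congr (by linarith) fun r hr => gen_congr rfl (stepLab_add_apply fun h' => by
        linarith [h'.2, hr.1])
    simp only [approx, map_sum, inner_sum, ih _ hat', hs', hp, labInner_add_right,
      labInner_stepLab_right hδ, Complex.exp_add, stepProd]
    simp only [matStep, mul_apply_eq_comp, sum_apply, map_sum,
      inner_sum, smul_apply, map_smul, inner_smul_right, Finset.mul_sum]
    exact Finset.sum_congr rfl fun α _ => by ring

/-- The cocycle identity. Conjugation by the translation `Γ` turns the cocycle at time `s` into the
evolution from `t` to `s + t`. That evolution, applied to the approximations at time `t`, multiplies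
their matrix elements by the propagator from `t` to `s + t`, and the composition law for
propagators gives the claim in the weak limit. -/
theorem cocycle_comp (het : Total e)
    {s t : ℝ} (hs : 0 ≤ s) (ht : 0 ≤ t) {Vs Vt Vst : K ⊗[ℂ] F →L[ℂ] K ⊗[ℂ] F}
    (hVs : HasCocycleMatrix Y L b e s (fun k g => Vs (k ⊗ₜ[ℂ] e g)))
    (hVst : HasCocycleMatrix Y L b e (s + t) (fun k g => Vst (k ⊗ₜ[ℂ] e g)))
    (hlim : ∀ k g z, Tendsto (fun N : ℕ =>
      ⟪z, approx Y L b e (t / ((N + 1 : ℕ) : ℝ)) (N + 1) 0 k g⟫_ℂ) atTop (𝓝 ⟪z, Vt (k ⊗ₜ[ℂ] e g)⟫_ℂ))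
    {Γ Γ' : F →L[ℂ] F} (hΓ : ∀ p, Γ (e p) = e (shiftLab (-t) p))
    (hΓi : ∀ x y, ⟪Γ x, Γ y⟫_ℂ = ⟪x, y⟫_ℂ) (hΓ' : ∀ p, Γ' (e p) = e (shiftLab t p)) :
    Vst = Γ.lTensor K ∘L Vs ∘L Γ'.lTensor K ∘L Vt := by
  let B := Γ.lTensor K ∘L Vs ∘L Γ'.lTensor K
  have hsh : ∀ p : Lab 𝔥, shiftLab (-t) (shiftLab t p) = p := fun p =>
    Subtype.ext (funext fun r => congrArg p.1 (neg_add_cancel_right r t))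
  have hB : ∀ k' k f g, ⟪k' ⊗ₜ[ℂ] e f, B (k ⊗ₜ[ℂ] e g)⟫_ℂ
      = Complex.exp (labInner f g) * ⟪k', propagator (gen Y L b f g) t (s + t) k⟫_ℂ := by
    intro k' k f g
    have h1 : k' ⊗ₜ[ℂ] e f = Γ.lTensor K (k' ⊗ₜ[ℂ] e (shiftLab t f)) := by
      rw [ContinuousLinearMap.lTensor_tmul, hΓ, hsh]
    have h2 : B (k ⊗ₜ[ℂ] e g) = Γ.lTensor K (Vs (k ⊗ₜ[ℂ] e (shiftLab t g))) := by
      simp only [B, ContinuousLinearMap.comp_apply, ContinuousLinearMap.lTensor_tmul, hΓ']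
    rw [h1, h2, inner_lTensor hΓi, hVs, labInner_shiftLab]
    have h3 := propagator_shift (gen Y L b f g) t 0 s
    rw [zero_add] at h3
    rw [← h3]
    rfl
  change Vst = B ∘L Vt
  refine (Total.tmul (K := K) het).clm_ext fun ⟨k, g⟩ => ?_
  refine (Total.tmul (K := K) het).ext_inner fun ⟨k', f⟩ => ?_
  -- The bounded operator `B` may be applied to the weakly convergent approximations.
  have h4 : Tendsto (fun N : ℕ =>
      ⟪k' ⊗ₜ[ℂ] e f, B (approx Y L b e (t / ((N + 1 : ℕ) : ℝ)) (N + 1) 0 k g)⟫_ℂ) atTop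
      (𝓝 ⟪k' ⊗ₜ[ℂ] e f, (B ∘L Vt) (k ⊗ₜ[ℂ] e g)⟫_ℂ) := by
    have := hlim k g (B.adjoint (k' ⊗ₜ[ℂ] e f))
    rw [ContinuousLinearMap.adjoint_inner_left] at this
    exact this.congr fun N => ContinuousLinearMap.adjoint_inner_left _ _ _
  refine tendsto_nhds_unique ?_ h4
  obtain ⟨M, hM⟩ := exists_isBddGen (Y := Y) (L := L) (b := b) f g
  have h5 : Continuous fun X : K →L[ℂ] K => Complex.exp (labInner f g) *
      ⟪k', propagator (gen Y L b f g) t (s + t) (X k)⟫_ℂ := by fun_prop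
  have h6 := (h5.tendsto _).comp ((tendsto_matStep (Y := Y) (L := L) (b := b) ht f g).comp
    (tendsto_add_atTop_nat 1))
  have h7 := hVst k' k f g
  rw [propagator_comp hM ht (by linarith : t ≤ s + t), mul_apply_eq_comp] at h7
  rw [h7]
  refine h6.congr fun N => ?_
  rw [inner_tmul_clm_approx hs hB (by positivity) (N + 1) 0 (sub_succ_cast N t).le]
  rfl

end Cocycle

/-! ### Symmetric powers -/

section SymPow

variable (n : ℕ) {V W K : Type*} [AddCommGroup V] [Module ℂ V] [AddCommGroup W] [Module ℂ W]
  [AddCommGroup K] [Module ℂ K]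

/-- The symmetrized product of `n` vectors. -/
def symTprod : MultilinearMap ℂ (fun _ : Fin n => V) (SymTensor n V) :=
  (symmetrizer n V).compMultilinearMap (PiTensorProduct.tprod ℂ)

theorem symIncl_symTprod (f : Fin n → V) :
    symIncl n V (symTprod n f) = (n.factorial : ℂ)⁻¹ •
      ∑ σ : Equiv.Perm (Fin n), PiTensorProduct.tprod ℂ fun i => f (σ.symm i) := by
  change ((n.factorial : ℂ)⁻¹ • ∑ σ : Equiv.Perm (Fin n),
      (PiTensorProduct.reindex ℂ (fun _ => V) σ).toLinearMap) (PiTensorProduct.tprod ℂ f) = _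
  rw [LinearMap.smul_apply, LinearMap.sum_apply]
  congr 1
  refine Finset.sum_congr rfl fun σ _ => ?_
  exact PiTensorProduct.reindex_tprod (s := fun _ => V) σ f

theorem symIncl_injective : Function.Injective (symIncl n V) := Subtype.coe_injective

theorem symTprod_perm (f : Fin n → V) (σ : Equiv.Perm (Fin n)) :
    symTprod n (fun i => f (σ i)) = symTprod n f := by
  refine symIncl_injective n ?_
  rw [symIncl_symTprod, symIncl_symTprod]
  congr 1
  refine Fintype.sum_equiv (Equiv.mulRight σ⁻¹) _ _ fun τ => ?_
  simp [Equiv.Perm.mul_def]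
  rfl

/-- The symmetric power `f ⊗ ⋯ ⊗ f`. -/
def symPow (f : V) : SymTensor n V := symTprod n fun _ => f

theorem symIncl_symPow (f : V) :
    symIncl n V (symPow n f) = PiTensorProduct.tprod ℂ fun _ => f := by
  rw [symPow, symIncl_symTprod, Finset.sum_const, Finset.card_univ, Fintype.card_perm,
    Fintype.card_fin, ← Nat.cast_smul_eq_nsmul ℂ, smul_smul,
    inv_mul_cancel₀ (by exact_mod_cast n.factorial_ne_zero), one_smul]

theorem symPow_smul (c : ℂ) (f : V) : symPow n (c • f) = c ^ n • symPow n f := by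
  have h := (symTprod n).map_smul_univ (fun _ => c) fun _ => f
  simpa [symPow] using h

/-- Polarization, by inclusion and exclusion over the vectors that are left out. -/
theorem factorial_smul_symTprod (f : Fin n → V) :
    (n.factorial : ℂ) • symTprod n f
      = ∑ s : Finset (Fin n), (-1 : ℂ) ^ s.card • symPow n (∑ i ∈ sᶜ, f i) := by
  have h1 : ∀ s : Finset (Fin n), (-1 : ℂ) ^ s.card • symPow n (∑ i ∈ sᶜ, f i)
      = ∑ r : Fin n → Fin n, (if s ⊆ (Finset.univ.image r)ᶜ then (-1 : ℂ) ^ s.card else 0) •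
        symTprod n fun i => f (r i) := fun s => by
    rw [symPow, (symTprod n).map_sum_finset (fun _ j => f j) fun _ => sᶜ, Finset.smul_sum]
    rw [← Finset.sum_subset (Finset.subset_univ (Fintype.piFinset fun _ => sᶜ))]
    · refine Finset.sum_congr rfl fun r hr => ?_
      rw [if_pos]
      intro i hi
      simp only [Finset.mem_compl, Finset.mem_image, Finset.mem_univ, true_and, not_exists]
      intro j hj
      have := Fintype.mem_piFinset.1 hr j
      rw [hj] at this
      exact Finset.mem_compl.1 this hi
    · intro r _ hr
      rw [if_neg, zero_smul]
      intro h
      refine hr (Fintype.mem_piFinset.2 fun j => Finset.mem_compl.2 fun hj => ?_)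
      exact Finset.mem_compl.1 (h hj) (Finset.mem_image_of_mem _ (Finset.mem_univ _))
  have h2 : ∀ r : Fin n → Fin n,
      (∑ s : Finset (Fin n), if s ⊆ (Finset.univ.image r)ᶜ then (-1 : ℂ) ^ s.card else 0)
        = if Function.Bijective r then 1 else 0 := fun r => by
    have h3 := Finset.sum_powerset_neg_one_pow_card (x := (Finset.univ.image r)ᶜ)
    have h4 : (Finset.univ.image r)ᶜ = ∅ ↔ Function.Bijective r := by
      rw [Finset.compl_eq_empty_iff, ← Finite.surjective_iff_bijective, Finset.eq_univ_iff_forall]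
      simp [Function.Surjective]
    rw [← Finset.sum_filter]
    have h5 : (Finset.univ.filter fun s : Finset (Fin n) => s ⊆ (Finset.univ.image r)ᶜ)
        = ((Finset.univ.image r)ᶜ).powerset := by ext s; simp
    rw [h5]
    have h6 := congrArg (fun z : ℤ => (z : ℂ)) h3
    push_cast at h6
    rw [h6]
    simp only [h4]
  simp_rw [h1]
  rw [Finset.sum_comm]
  simp_rw [← Finset.sum_smul, h2, ite_smul, one_smul, zero_smul]
  rw [← Finset.sum_filter]
  have h7 : ∑ r ∈ Finset.univ.filter (fun r : Fin n → Fin n => Function.Bijective r),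
      (symTprod n fun i => f (r i)) = ∑ σ : Equiv.Perm (Fin n), symTprod n fun i => f (σ i) := by
    symm
    refine Finset.sum_bij (fun σ _ => (σ : Fin n → Fin n)) ?_ ?_ ?_ ?_
    · intro σ _
      exact Finset.mem_filter.2 ⟨Finset.mem_univ _, σ.bijective⟩
    · intro σ _ τ _ h
      exact Equiv.coe_fn_injective h
    · intro r hr
      exact ⟨Equiv.ofBijective r (Finset.mem_filter.1 hr).2, Finset.mem_univ _, rfl⟩
    · intro σ _
      rfl
  rw [h7]
  simp only [symTprod_perm, Finset.sum_const, Finset.card_univ, Fintype.card_perm,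
    Fintype.card_fin, Nat.cast_smul_eq_nsmul]

/-- Symmetric tensors are spanned by powers. -/
theorem span_symPow : Submodule.span ℂ (Set.range (symPow n : V → SymTensor n V)) = ⊤ := by
  have h1 : ∀ f : Fin n → V,
      symTprod n f ∈ Submodule.span ℂ (Set.range (symPow n : V → SymTensor n V)) := fun f => by
    have h : symTprod n f = (n.factorial : ℂ)⁻¹ • ((n.factorial : ℂ) • symTprod n f) := by
      rw [smul_smul, inv_mul_cancel₀ (by exact_mod_cast n.factorial_ne_zero), one_smul]
    rw [h, factorial_smul_symTprod]
    exact Submodule.smul_mem _ _ (Submodule.sum_mem _ fun s _ =>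
      Submodule.smul_mem _ _ (Submodule.subset_span ⟨_, rfl⟩))
  rw [eq_top_iff]
  intro x _
  rw [← symmetrizer_symIncl n V x]
  generalize symIncl n V x = y
  induction y using PiTensorProduct.induction_on with
  | smul_tprod c f =>
    rw [map_smul]
    exact Submodule.smul_mem _ _ (h1 f)
  | add x y hx hy =>
    rw [map_add]
    exact add_mem hx hy

/-- The power `f ⊗ ⋯ ⊗ f` in the algebraic Fock space. -/
def algPow (f : V) : AlgFock V := DirectSum.lof ℂ ℕ (fun n => SymTensor n V) n (symPow n f)

theorem span_algPow :
    Submodule.span ℂ (Set.range fun p : ℕ × V => algPow p.1 p.2) = (⊤ : Submodule ℂ (AlgFock V)) := by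
  rw [eq_top_iff]
  intro x _
  induction x using DirectSum.induction_on with
  | zero => exact zero_mem _
  | of n x =>
    have h : Submodule.span ℂ (Set.range (symPow n : V → SymTensor n V)) ≤
        (Submodule.span ℂ (Set.range fun p : ℕ × V => algPow p.1 p.2)).comap
          (DirectSum.lof ℂ ℕ (fun n => SymTensor n V) n) :=
      Submodule.span_le.2 (by
        rintro _ ⟨f, rfl⟩
        exact Submodule.subset_span ⟨(n, f), rfl⟩)
    rw [span_symPow] at h
    exact h (Submodule.mem_top (x := x))
  | add x y hx hy => exact add_mem (hx trivial) (hy trivial)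

/-- A property that is stable under addition holds on `K ⊗ Γ(V)` if it holds on the vectors
`k ⊗ f^{⊗n}`. -/
theorem algPow_induction {P : K ⊗[ℂ] AlgFock V → Prop} (h0 : P 0)
    (hadd : ∀ x y, P x → P y → P (x + y)) (h : ∀ k n f, P (k ⊗ₜ[ℂ] algPow n f)) (x) : P x := by
  induction x using TensorProduct.induction_on with
  | zero => exact h0
  | add x y hx hy => exact hadd _ _ hx hy
  | tmul k y =>
    have hy : y ∈ Submodule.span ℂ (Set.range fun p : ℕ × V => algPow p.1 p.2) := by
      rw [span_algPow]; trivial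
    induction hy using Submodule.span_induction generalizing k with
    | mem y hy =>
      obtain ⟨p, rfl⟩ := hy
      exact h _ _ _
    | zero => rw [TensorProduct.tmul_zero]; exact h0
    | add y z _ _ hy hz => rw [TensorProduct.tmul_add]; exact hadd _ _ (hy k) (hz k)
    | smul c y _ hy => rw [← TensorProduct.smul_tmul]; exact hy _

theorem symMap_symPow (L : V →ₗ[ℂ] W) (f : V) : symMap n L (symPow n f) = symPow n (L f) := by
  refine symIncl_injective n ?_
  rw [symIncl_symPow]
  change PiTensorProduct.map (fun _ => L) (symIncl n V (symPow n f)) = _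
  rw [symIncl_symPow, PiTensorProduct.map_tprod]

theorem secondQuant_algPow (L : V →ₗ[ℂ] W) (f : V) :
    secondQuant L (algPow n f) = algPow n (L f) := by
  rw [secondQuant, algPow, DirectSum.lmap_lof, symMap_symPow, algPow]

theorem dGamma_algPow (J A : V →ₗ[ℂ] W) (f : V) :
    dGamma J A (algPow n f) = DirectSum.lof ℂ ℕ (fun n => SymTensor n W) n
      (∑ i : Fin n, symTprod n (Function.update (fun _ => J f) i (A f))) := by
  rw [dGamma, algPow, DirectSum.lmap_lof]
  congr 1
  simp only [LinearMap.comp_apply, symIncl_symPow, LinearMap.sum_apply, PiTensorProduct.map_tprod,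
    map_sum]
  refine Finset.sum_congr rfl fun i _ => ?_
  change _ = symmetrizer n W (PiTensorProduct.tprod ℂ _)
  congr 2
  funext j
  by_cases h : j = i
  · subst h; simp
  · simp [h]

theorem annih_algPow_succ (Rs : K ⊗[ℂ] V →ₗ[ℂ] K) (k : K) (f : V) :
    annih Rs (k ⊗ₜ[ℂ] algPow (n + 1) f)
      = (Real.sqrt (n + 1) : ℂ) • (Rs (k ⊗ₜ[ℂ] f) ⊗ₜ[ℂ] algPow n f) := by
  have h : (TensorProduct.directSumRight ℂ ℂ K fun n => SymTensor n V)
      (k ⊗ₜ[ℂ] algPow (n + 1) f) = DirectSum.lof ℂ ℕ (fun n => K ⊗[ℂ] SymTensor n V) (n + 1)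
        (k ⊗ₜ[ℂ] symPow (n + 1) f) := TensorProduct.directSumRight_tmul_lof ..
  rw [annih, LinearMap.comp_apply, LinearEquiv.coe_coe, h, DirectSum.toModule_lof]
  simp only [LinearMap.comp_apply, annihSector, LinearMap.smul_apply, map_smul,
    LinearMap.lTensor_tmul, symIncl_symPow, splitFirst_tprod, LinearEquiv.coe_coe,
    TensorProduct.assoc_symm_tmul, TensorProduct.map_tmul]
  rfl

theorem annih_algPow_zero (Rs : K ⊗[ℂ] V →ₗ[ℂ] K) (k : K) (f : V) :
    annih Rs (k ⊗ₜ[ℂ] algPow 0 f) = 0 := by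
  have h : (TensorProduct.directSumRight ℂ ℂ K fun n => SymTensor n V)
      (k ⊗ₜ[ℂ] algPow 0 f) = DirectSum.lof ℂ ℕ (fun n => K ⊗[ℂ] SymTensor n V) 0
        (k ⊗ₜ[ℂ] symPow 0 f) := TensorProduct.directSumRight_tmul_lof ..
  rw [annih, LinearMap.comp_apply, LinearEquiv.coe_coe, h, DirectSum.toModule_lof]
  rfl

end SymPow

/-! ### Powers and exponential vectors in the Fock space -/

/-- The coefficients of an everywhere convergent power series are determined by its sum. -/
theorem eq_of_hasSum_pow {a b : ℕ → ℂ} {s : ℂ → ℂ} (ha : ∀ z, HasSum (fun n => z ^ n * a n) (s z))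
    (hb : ∀ z, HasSum (fun n => z ^ n * b n) (s z)) : a = b := by
  have h : ∀ {c : ℕ → ℂ}, (∀ z, HasSum (fun n => z ^ n * c n) (s z)) →
      HasFPowerSeriesAt s (FormalMultilinearSeries.ofScalars ℂ c) 0 := fun {c} hc => by
    rw [hasFPowerSeriesAt_iff]
    refine Eventually.of_forall fun z => ?_
    simpa [FormalMultilinearSeries.coeff_ofScalars] using hc z
  have := (h ha).eq_formalMultilinearSeries (h hb)
  funext n
  simpa [FormalMultilinearSeries.coeff_ofScalars] using
    congrArg (fun p : FormalMultilinearSeries ℂ ℂ ℂ => p.coeff n) this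

/-- A map into an inner product space is continuous if its Gram kernel is. -/
theorem continuous_of_inner {X H : Type*} [TopologicalSpace X] [NormedAddCommGroup H]
    [InnerProductSpace ℂ H] {v : X → H} (hd : Continuous fun x => ⟪v x, v x⟫_ℂ)
    (hs : ∀ y, Continuous fun x => ⟪v x, v y⟫_ℂ) : Continuous v := by
  rw [continuous_iff_continuousAt]
  intro y
  rw [ContinuousAt, tendsto_iff_norm_sub_tendsto_zero]
  have h1 : Tendsto (fun x => (⟪v x, v x⟫_ℂ - ⟪v x, v y⟫_ℂ - (starRingEnd ℂ) ⟪v x, v y⟫_ℂ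
      + ⟪v y, v y⟫_ℂ).re) (𝓝 y) (𝓝 ((⟪v y, v y⟫_ℂ - ⟪v y, v y⟫_ℂ - (starRingEnd ℂ) ⟪v y, v y⟫_ℂ
      + ⟪v y, v y⟫_ℂ).re)) := by
    have hc : Continuous fun x => (⟪v x, v x⟫_ℂ - ⟪v x, v y⟫_ℂ - (starRingEnd ℂ) ⟪v x, v y⟫_ℂ
      + ⟪v y, v y⟫_ℂ).re := Complex.continuous_re.comp
        (((hd.sub (hs y)).sub (Complex.continuous_conj.comp (hs y))).add continuous_const)
    exact hc.tendsto y
  have h2 : ∀ x, (⟪v x, v x⟫_ℂ - ⟪v x, v y⟫_ℂ - (starRingEnd ℂ) ⟪v x, v y⟫_ℂ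
      + ⟪v y, v y⟫_ℂ).re = ‖v x - v y‖ ^ 2 := fun x => by
    rw [← @inner_self_eq_norm_sq ℂ, inner_sub_left, inner_sub_right, inner_sub_right,
      inner_conj_symm]
    simp only [map_sub, RCLike.re_to_complex, Complex.add_re, Complex.sub_re]
    ring
  simp only [h2, sub_self] at h1
  have h3 := (Real.continuous_sqrt.tendsto _).comp h1
  simpa [Function.comp_def, Real.sqrt_sq (norm_nonneg _)] using h3

theorem Total.of_forall_inner_eq_zero {X H : Type*} [NormedAddCommGroup H] [InnerProductSpace ℂ H]
    [CompleteSpace H] {v : X → H} (h : ∀ y, (∀ x, ⟪v x, y⟫_ℂ = 0) → y = 0) : Total v := by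
  rw [Total, Submodule.dense_iff_topologicalClosure_eq_top, Submodule.topologicalClosure_eq_top_iff,
    Submodule.eq_bot_iff]
  intro y hy
  exact h y fun x => (Submodule.mem_orthogonal _ _).1 hy _ (Submodule.subset_span ⟨x, rfl⟩)

section Fock

variable (n : ℕ) {R : Type*} [NormedAddCommGroup R] [InnerProductSpace ℂ R]

theorem inner_symPow (f g : R) : ⟪symPow n f, symPow n g⟫_ℂ = ⟪f, g⟫_ℂ ^ n := by
  rw [inner_symTensor, symIncl_symPow, symIncl_symPow, tensorForm_tprod]
  simp

theorem norm_symTprod_le (f : Fin n → R) : ‖symTprod n f‖ ≤ ∏ i, ‖f i‖ := by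
  refine le_of_sq_le_sq ?_ (Finset.prod_nonneg fun i _ => norm_nonneg _)
  rw [← @inner_self_eq_norm_sq ℂ, inner_symTensor, symIncl_symTprod]
  simp only [map_smul, map_sum, LinearMap.smul_apply, LinearMap.sum_apply, map_smulₛₗ,
    tensorForm_tprod, smul_eq_mul]
  refine (RCLike.re_le_norm _).trans ?_
  have hperm : ∀ σ : Equiv.Perm (Fin n), ∏ i, ‖f (σ.symm i)‖ = ∏ i, ‖f i‖ := fun σ =>
    Equiv.prod_comp σ.symm fun i => ‖f i‖
  have h1 : ∀ σ τ : Equiv.Perm (Fin n),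
      ‖∏ i, ⟪f (σ.symm i), f (τ.symm i)⟫_ℂ‖ ≤ (∏ i, ‖f i‖) ^ 2 := fun σ τ => by
    rw [norm_prod, sq]
    nth_rw 1 [← hperm σ]
    rw [← hperm τ, ← Finset.prod_mul_distrib]
    exact Finset.prod_le_prod (fun i _ => norm_nonneg _) fun i _ => norm_inner_le_norm _ _
  have hn : (n.factorial : ℝ) ≠ 0 := by exact_mod_cast n.factorial_ne_zero
  rw [← Finset.mul_sum, norm_mul, norm_mul]
  calc _ ≤ (n.factorial : ℝ)⁻¹ * ((n.factorial : ℝ)⁻¹ *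
        ∑ σ : Equiv.Perm (Fin n), ∑ τ : Equiv.Perm (Fin n), (∏ i, ‖f i‖) ^ 2) := by
        gcongr
        · simp
        · simp
        · refine (norm_sum_le _ _).trans (Finset.sum_le_sum fun σ _ => ?_)
          exact (norm_sum_le _ _).trans (Finset.sum_le_sum fun τ _ => h1 _ _)
    _ = (∏ i, ‖f i‖) ^ 2 := by
        simp only [Finset.sum_const, Finset.card_univ, Fintype.card_perm, Fintype.card_fin,
          nsmul_eq_mul]
        field_simp

/-- The inclusion of the algebraic `n`-particle space in the Fock space. -/
def sectorIncl : SymTensor n R →L[ℂ] Fock R :=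
  lp.singleContinuousLinearMap ℂ (fun n : ℕ => NParticle n R) 2 n
    ∘L (UniformSpace.Completion.toComplL (𝕜 := ℂ) (E := SymTensor n R))

theorem fockIncl_lof (x : SymTensor n R) :
    fockIncl R (DirectSum.lof ℂ ℕ (fun n => SymTensor n R) n x) = sectorIncl n x := by
  rw [fockIncl, DirectSum.toModule_lof]
  rfl

/-- The continuous multilinear map `(f₁, …, fₙ) ↦ Sym (f₁ ⊗ ⋯ ⊗ fₙ)`. -/
def symTprodL : ContinuousMultilinearMap ℂ (fun _ : Fin n => R) (Fock R) :=
  (sectorIncl n).compContinuousMultilinearMap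
    ((symTprod n).mkContinuous 1 fun f => by rw [one_mul]; exact norm_symTprod_le n f)

/-- The power `f ⊗ ⋯ ⊗ f` in the Fock space. -/
def fockPow (f : R) : Fock R := symTprodL n fun _ => f

theorem fockIncl_algPow (f : R) : fockIncl R (algPow n f) = fockPow n f := fockIncl_lof n _

theorem fockPow_eq (f : R) : fockPow n f
    = lp.single (E := fun n : ℕ => NParticle n R) 2 n ((symPow n f : SymTensor n R) : NParticle n R) := rfl

theorem continuous_fockPow : Continuous (fockPow n : R → Fock R) :=
  (symTprodL n).cont.comp (continuous_pi fun _ => continuous_id)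

theorem inner_fockPow (m : ℕ) (f g : R) :
    ⟪fockPow n f, fockPow m g⟫_ℂ = if n = m then ⟪f, g⟫_ℂ ^ n else 0 := by
  rw [fockPow_eq, fockPow_eq, lp.inner_single_left]
  by_cases h : n = m
  · subst h
    rw [lp.single_apply_self, UniformSpace.Completion.inner_coe, inner_symPow, if_pos rfl]
  · rw [lp.single_apply_ne _ _ _ h, inner_zero_right, if_neg h]

theorem fockPow_smul (c : ℂ) (f : R) : fockPow n (c • f) = c ^ n • fockPow n f := by
  rw [← fockIncl_algPow, ← fockIncl_algPow, algPow, symPow_smul, map_smul, map_smul]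
  rfl

theorem vacuum_eq (f : R) : vacuum R = fockPow 0 f := by
  rw [vacuum, algVacuum, ← fockIncl_algPow, algPow]
  congr 2
  change symTprod 0 _ = symTprod 0 _
  congr 1
  exact Subsingleton.elim _ _

theorem norm_vacuum : ‖vacuum R‖ = 1 := by
  rw [@norm_eq_sqrt_re_inner ℂ, vacuum_eq 0, inner_fockPow]
  simp

/-- The powers of a dense set of one-particle vectors are total. -/
theorem total_fockPow {X : Type*} {v : X → R} (hv : DenseRange v) :
    Total fun p : ℕ × X => fockPow p.1 (v p.2) := by
  set S := (Submodule.span ℂ (Set.range fun p : ℕ × X => fockPow p.1 (v p.2))).topologicalClosure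
    with hS
  have hSc : IsClosed (S : Set (Fock R)) := Submodule.isClosed_topologicalClosure _
  have h1 : ∀ n (f : R), fockPow n f ∈ S := fun n f =>
    hv.induction_on f (hSc.preimage (continuous_fockPow n)) fun x =>
      Submodule.le_topologicalClosure _ (Submodule.subset_span ⟨(n, x), rfl⟩)
  have h2 : ∀ n (x : SymTensor n R), sectorIncl n x ∈ S := fun n x => by
    have : Submodule.span ℂ (Set.range (symPow n : R → SymTensor n R)) ≤
        S.comap (sectorIncl n).toLinearMap :=
      Submodule.span_le.2 (by rintro _ ⟨f, rfl⟩; exact h1 n f)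
    rw [span_symPow] at this
    exact this (Submodule.mem_top (x := x))
  have h3 : ∀ n (x : NParticle n R), lp.single (E := fun n : ℕ => NParticle n R) 2 n x ∈ S :=
    fun n x => by
    refine UniformSpace.Completion.induction_on x (hSc.preimage ?_) (h2 n)
    exact (lp.singleContinuousLinearMap ℂ (fun n : ℕ => NParticle n R) 2 n).continuous
  intro x
  change x ∈ S
  have h4 := lp.hasSum_single (p := 2) (by simp) x
  exact hSc.mem_of_tendsto h4 (Eventually.of_forall fun s => Submodule.sum_mem _ fun i _ => h3 i _)

theorem memℓp_expVec (f : R) : Memℓp (E := fun n : ℕ => NParticle n R)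
    (fun n => (Real.sqrt n.factorial : ℂ)⁻¹ • ((symPow n f : SymTensor n R) : NParticle n R)) 2 := by
  refine memℓp_gen ?_
  have h := NormedSpace.expSeries_div_summable (𝔸 := ℝ) (‖f‖ ^ 2)
  refine h.congr fun n => ?_
  have h1 : ‖((symPow n f : SymTensor n R) : NParticle n R)‖ ^ 2 = (‖f‖ ^ 2) ^ n := by
    rw [UniformSpace.Completion.norm_coe, ← @inner_self_eq_norm_sq ℂ, inner_symPow,
      inner_self_eq_norm_sq_to_K]
    norm_cast
  rw [norm_smul, ENNReal.toReal_ofNat, Real.rpow_two, mul_pow, h1, norm_inv, Complex.norm_real,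
    Real.norm_eq_abs, abs_of_nonneg (Real.sqrt_nonneg _), inv_pow, Real.sq_sqrt (by positivity)]
  ring

/-- The exponential vector `∑ n, (n!)^{-1/2} f^{⊗n}`. -/
def expVec (f : R) : Fock R := ⟨_, memℓp_expVec f⟩

theorem hasSum_expVec (f : R) :
    HasSum (fun n => (Real.sqrt n.factorial : ℂ)⁻¹ • fockPow n f) (expVec f) := by
  refine (lp.hasSum_single (p := 2) (by simp) (expVec f)).congr_fun fun n => ?_
  exact (lp.single_smul (p := 2) n _ _).symm

theorem inner_expVec (f g : R) : ⟪expVec f, expVec g⟫_ℂ = Complex.exp ⟪f, g⟫_ℂ := by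
  have h1 := lp.hasSum_inner (𝕜 := ℂ) (expVec f) (expVec g)
  have h2 := NormedSpace.expSeries_div_hasSum_exp (𝔸 := ℂ) ⟪f, g⟫_ℂ
  rw [← Complex.exp_eq_exp_ℂ] at h2
  refine h1.unique (h2.congr_fun fun n => ?_)
  change ⟪(Real.sqrt n.factorial : ℂ)⁻¹ • ((symPow n f : SymTensor n R) : NParticle n R),
    (Real.sqrt n.factorial : ℂ)⁻¹ • ((symPow n g : SymTensor n R) : NParticle n R)⟫_ℂ = _
  rw [inner_smul_left, inner_smul_right, UniformSpace.Completion.inner_coe, inner_symPow,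
    map_inv₀, Complex.conj_ofReal, ← mul_assoc, ← mul_inv, ← Complex.ofReal_mul,
    Real.mul_self_sqrt (by positivity), Complex.ofReal_natCast, div_eq_inv_mul]

theorem expVec_zero : expVec (0 : R) = vacuum R := by
  refine (hasSum_expVec (0 : R)).unique ?_
  have h := hasSum_ite_eq 0 (vacuum R)
  convert h using 2 with n
  split_ifs with h0
  · subst h0
    simp [← vacuum_eq]
  · have := fockPow_smul n 0 (0 : R)
    rw [zero_smul, zero_pow h0, zero_smul] at this
    rw [this, smul_zero]

/-- Expansion of a functional of an exponential vector in powers of the argument. -/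
theorem hasSum_apply_expVec_smul (φ : Fock R →L[ℂ] ℂ) (z : ℂ) (f : R) :
    HasSum (fun n => z ^ n * ((Real.sqrt n.factorial : ℂ)⁻¹ * φ (fockPow n f)))
      (φ (expVec (z • f))) := by
  refine ((hasSum_expVec (z • f)).mapL φ).congr_fun fun n => ?_
  rw [map_smul, fockPow_smul, map_smul, smul_eq_mul, smul_eq_mul]
  ring

/-- The exponential vectors of a dense subspace are total. -/
theorem total_expVec {X : Type*} {v : X → R} (hv : DenseRange v)
    (hsmul : ∀ (z : ℂ) x, ∃ y, v y = z • v x) : Total fun x => expVec (v x) := by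
  refine Total.of_forall_inner_eq_zero fun y hy => ?_
  refine (total_fockPow hv).ext_inner fun ⟨n, x⟩ => ?_
  have h0 : ∀ z : ℂ, innerSL ℂ y (expVec (z • v x)) = 0 := fun z => by
    obtain ⟨x', hx'⟩ := hsmul z x
    rw [innerSL_apply_apply, ← hx', ← inner_conj_symm, hy, map_zero]
  have h1 : _ = (0 : ℕ → ℂ) := eq_of_hasSum_pow (fun z => hasSum_apply_expVec_smul (innerSL ℂ y) z (v x))
    fun z => by rw [h0]; simp
  have h2 := congrFun h1 n
  have hn : (Real.sqrt n.factorial : ℂ)⁻¹ ≠ 0 := by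
    have : (0 : ℝ) < n.factorial := by exact_mod_cast n.factorial_pos
    simpa using (Real.sqrt_pos.2 this).ne'
  rw [Pi.zero_apply, mul_eq_zero, or_iff_right hn, innerSL_apply_apply] at h2
  rw [inner_zero_right, ← inner_conj_symm, h2, map_zero]

/-- Second quantization of an isometry. -/
theorem exists_secondQuantization (T : R → R) (hT : ∀ f g, ⟪T f, T g⟫_ℂ = ⟪f, g⟫_ℂ) :
    ∃ Γ : Fock R →L[ℂ] Fock R, (∀ n f, Γ (fockPow n f) = fockPow n (T f)) ∧
      (∀ f, Γ (expVec f) = expVec (T f)) ∧ ∀ x y, ⟪Γ x, Γ y⟫_ℂ = ⟪x, y⟫_ℂ := by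
  obtain ⟨Γ, h1, h2⟩ := (total_fockPow (R := R) denseRange_id).exists_isometry
    (fun p => fockPow p.1 (T p.2)) fun p q => by
      simp only [inner_fockPow, hT, id_eq]
  refine ⟨Γ, fun n f => h1 (n, f), fun f => ?_, h2⟩
  refine ((hasSum_expVec f).mapL Γ).unique ?_
  have h3 : ∀ n, Γ (fockPow n f) = fockPow n (T f) := fun n => h1 (n, f)
  simp only [map_smul, h3]
  exact hasSum_expVec (T f)

end Fock

/-! ### The Fourier transform and the position representation -/

section Fourier

open FourierTransform

variable {𝔥 : Type*} [NormedAddCommGroup 𝔥] [InnerProductSpace ℂ 𝔥]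

theorem memLp_comp_mul_left {p : ℝ → 𝔥} (hp : MemLp p 2 volume) {a : ℝ} (ha : a ≠ 0) :
    MemLp (fun u => p (a * u)) 2 volume := by
  refine MemLp.comp_of_map (f := fun u => a * u) ?_ (by fun_prop)
  rw [Real.map_volume_mul_left ha]
  exact hp.smul_measure ENNReal.ofReal_ne_top

theorem inner_toLp {f g : ℝ → 𝔥} (hf : MemLp f 2 volume) (hg : MemLp g 2 volume) :
    ⟪(hf.toLp f : OneParticle 𝔥), hg.toLp g⟫_ℂ = ∫ x, ⟪f x, g x⟫_ℂ := by
  rw [L2.inner_def]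
  refine integral_congr_ae ?_
  filter_upwards [hf.coeFn_toLp, hg.coeFn_toLp] with x h1 h2
  rw [h1, h2]

theorem two_pi_ne_zero : 2 * Real.pi ≠ 0 := by positivity

theorem coe_sqrt_two_pi_ne_zero : (Real.sqrt (2 * Real.pi) : ℂ) ≠ 0 := by
  exact_mod_cast (Real.sqrt_pos.2 Real.two_pi_pos).ne'

theorem coe_sqrt_two_pi_mul_self :
    (Real.sqrt (2 * Real.pi) : ℂ) * Real.sqrt (2 * Real.pi) = (2 * Real.pi : ℝ) := by
  exact_mod_cast Real.mul_self_sqrt Real.two_pi_pos.le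

/-- The dilation that turns the unitary Fourier transform with kernel `(2π)^{-1/2} e^{-isx}` into
the one with kernel `e^{-2πiux}`. -/
theorem memLp_dilate (p : Lab 𝔥) :
    MemLp (fun u : ℝ => (Real.sqrt (2 * Real.pi) : ℂ) • p.1 (2 * Real.pi * u)) 2 volume :=
  (memLp_comp_mul_left (Lab.memLp p) two_pi_ne_zero).const_smul _

variable [CompleteSpace 𝔥]

/-- The one-particle vector whose Fourier transform, with kernel `(2π)^{-1/2} e^{-isx}`, is the
label `p`. -/
def posVec (p : Lab 𝔥) : OneParticle 𝔥 := 𝓕⁻ ((memLp_dilate p).toLp _ : OneParticle 𝔥)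

theorem inner_posVec (p q : Lab 𝔥) : ⟪posVec p, posVec q⟫_ℂ = labInner p q := by
  rw [posVec, posVec, ← Lp.inner_fourier_eq, FourierInvPair.fourier_fourierInv_eq,
    FourierInvPair.fourier_fourierInv_eq, inner_toLp]
  have h := Measure.integral_comp_mul_left (fun s => ⟪p.1 s, q.1 s⟫_ℂ) (2 * Real.pi)
  simp only [inner_smul_left, inner_smul_right, Complex.conj_ofReal, ← mul_assoc,
    coe_sqrt_two_pi_mul_self]
  rw [integral_const_mul, h, abs_of_pos (by positivity), labInner, Complex.real_smul, ← mul_assoc,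
    ← Complex.ofReal_mul, mul_inv_cancel₀ two_pi_ne_zero, Complex.ofReal_one, one_mul]

theorem posVec_smul (z : ℂ) (p : Lab 𝔥) : posVec (z • p) = z • posVec p := by
  rw [posVec, posVec, ← FourierInvSMul.fourierInv_smul, ← MemLp.toLp_const_smul]
  congr 2
  funext u
  exact smul_comm _ _ _

/-- The Fourier transform on `L²` is given by the integral on `L¹ ∩ L²`. -/
theorem coeFn_fourier (f : OneParticle 𝔥) (hf : Integrable (fun x => f x) volume) :
    (𝓕 f : OneParticle 𝔥) =ᵐ[volume] 𝓕 (f : ℝ → 𝔥) := by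
  have hc : Continuous (𝓕 (f : ℝ → 𝔥)) :=
    VectorFourier.fourierIntegral_continuous Real.continuous_fourierChar (by fun_prop) hf
  refine ae_eq_of_integral_contDiff_smul_eq
    ((Lp.memLp (𝓕 f : OneParticle 𝔥)).locallyIntegrable (by norm_num)) hc.locallyIntegrable ?_
  intro g hg hgc
  have hg' := Complex.ofRealCLM.contDiff.comp hg
  have hgc' : HasCompactSupport fun x => (g x : ℂ) := hgc.comp_left Complex.ofReal_zero
  let φ := hgc'.toSchwartzMap hg'
  have h1 := congrArg (fun T => T φ) (Lp.fourier_toTemperedDistribution_eq f)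
  simp only [TemperedDistribution.fourier_apply, Lp.toTemperedDistribution_apply] at h1
  have h2 := VectorFourier.integral_fourierIntegral_smul_eq_flip (μ := volume) (ν := volume)
    (e := Real.fourierChar) (L := innerₗ ℝ) (f := φ) (g := fun x => f x)
    Real.continuous_fourierChar (by fun_prop) φ.integrable hf
  have h3 : (innerₗ ℝ).flip = innerₗ ℝ := by ext; simp
  rw [h3] at h2
  exact h1.symm.trans h2

/-- The Fourier transform with kernel `(2π)^{-1/2} e^{-isx}` on the domain of `Z_R`. -/
def fhat (f : DomX 𝔥) (s : ℝ) : 𝔥 := (Real.sqrt (2 * Real.pi) : ℂ)⁻¹ • braOne (expX (-s) f)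

theorem coeFn_expX (t : ℝ) (f : DomX 𝔥) :
    ((expX t f).1 : ℝ → 𝔥) =ᵐ[volume] fun x => Complex.exp (Complex.I * t * x) • f.1 x :=
  MemLp.coeFn_toLp (memLp_exp t (Lp.memLp f.1))

theorem braOne_expX (s : ℝ) (f : DomX 𝔥) :
    braOne (expX (-s) f) = 𝓕 (f.1 : ℝ → 𝔥) (s / (2 * Real.pi)) := by
  rw [Real.fourier_real_eq_integral_exp_smul]
  change ∫ x, (expX (-s) f).1 x = _
  refine integral_congr_ae ?_
  filter_upwards [coeFn_expX (-s) f] with x hx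
  rw [hx]
  congr 2
  have : (Real.pi : ℂ) ≠ 0 := by exact_mod_cast Real.pi_ne_zero
  push_cast
  field_simp

theorem continuous_fhat (f : DomX 𝔥) : Continuous (fhat f) := by
  have hc : Continuous (𝓕 (f.1 : ℝ → 𝔥)) :=
    VectorFourier.fourierIntegral_continuous Real.continuous_fourierChar (by fun_prop)
      (integrable_of_mem_domX f)
  unfold fhat
  simp only [braOne_expX]
  fun_prop

/-- The Fourier transform of a vector in the domain of `Z_R`, as a label. -/
def fhatLab (f : DomX 𝔥) : Lab 𝔥 :=
  ⟨fhat f, by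
    unfold fhat
    simp only [braOne_expX]
    refine ⟨MemLp.const_smul ?_ _, ‖(Real.sqrt (2 * Real.pi) : ℂ)⁻¹‖ * ∫ x, ‖f.1 x‖, fun s => ?_⟩
    · have h := (Lp.memLp (𝓕 f.1 : OneParticle 𝔥)).ae_eq (coeFn_fourier f.1 (integrable_of_mem_domX f))
      simpa only [div_eq_inv_mul] using memLp_comp_mul_left h (inv_ne_zero two_pi_ne_zero)
    · rw [norm_smul]
      gcongr
      exact VectorFourier.norm_fourierIntegral_le_integral_norm ..⟩

/-- Fourier inversion. -/
theorem posVec_fhatLab (f : DomX 𝔥) : posVec (fhatLab f) = f.1 := by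
  have h : ((memLp_dilate (fhatLab f)).toLp _ : OneParticle 𝔥) = 𝓕 f.1 := by
    refine Lp.ext ?_
    filter_upwards [(memLp_dilate (fhatLab f)).coeFn_toLp,
      coeFn_fourier f.1 (integrable_of_mem_domX f)] with u h1 h2
    rw [h1, h2]
    change (Real.sqrt (2 * Real.pi) : ℂ) • fhat f (2 * Real.pi * u) = _
    rw [fhat, smul_smul, mul_inv_cancel₀ coe_sqrt_two_pi_ne_zero, one_smul, braOne_expX,
      mul_div_cancel_left₀ _ two_pi_ne_zero]
  rw [posVec, h, FourierPair.fourierInv_fourier_eq]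

theorem mulExp_add (s t : ℝ) (f : OneParticle 𝔥) : mulExp (s + t) f = mulExp s (mulExp t f) := by
  refine Lp.ext ?_
  filter_upwards [(memLp_exp (s + t) (Lp.memLp f)).coeFn_toLp, (memLp_exp t (Lp.memLp f)).coeFn_toLp,
    (memLp_exp s (Lp.memLp (mulExp t f))).coeFn_toLp] with x h1 h2 h3
  change MemLp.toLp _ (memLp_exp (s + t) (Lp.memLp f)) x = MemLp.toLp _ (memLp_exp s (Lp.memLp (mulExp t f))) x
  rw [h1, h3]
  change _ = _ • MemLp.toLp _ (memLp_exp t (Lp.memLp f)) x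
  rw [h2, smul_smul, ← Complex.exp_add]
  congr 2
  push_cast
  ring

theorem mulExp_zero (f : OneParticle 𝔥) : mulExp 0 f = f := by
  refine Lp.ext ?_
  filter_upwards [(memLp_exp 0 (Lp.memLp f)).coeFn_toLp] with x h1
  refine h1.trans ?_
  simp

theorem inner_mulExp (t : ℝ) (f g : OneParticle 𝔥) : ⟪mulExp t f, mulExp t g⟫_ℂ = ⟪f, g⟫_ℂ := by
  change ⟪MemLp.toLp _ (memLp_exp t (Lp.memLp f)), MemLp.toLp _ (memLp_exp t (Lp.memLp g))⟫_ℂ = _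
  rw [inner_toLp, L2.inner_def]
  congr 1
  funext x
  rw [inner_smul_left, inner_smul_right, ← mul_assoc, ← Complex.exp_conj, ← Complex.exp_add]
  simp

theorem inner_mulExp_right (t : ℝ) (f g : OneParticle 𝔥) :
    ⟪f, mulExp t g⟫_ℂ = ⟪mulExp (-t) f, g⟫_ℂ := by
  rw [← inner_mulExp t (mulExp (-t) f) g, ← mulExp_add, add_neg_cancel, mulExp_zero]

theorem expX_add (s t : ℝ) (f : DomX 𝔥) : expX (s + t) f = expX s (expX t f) :=
  Subtype.ext (mulExp_add s t f.1)

/-- Multiplication by `e^{itx}` translates the Fourier transform. -/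
theorem fhatLab_expX (t : ℝ) (f : DomX 𝔥) : fhatLab (expX t f) = shiftLab (-t) (fhatLab f) := by
  refine Subtype.ext (funext fun s => ?_)
  change fhat (expX t f) s = fhat f (s + -t)
  rw [fhat, fhat, ← expX_add]
  congr 4
  ring

theorem denseRange_domX : DenseRange (Subtype.val : DomX 𝔥 → OneParticle 𝔥) := by
  refine Metric.denseRange_iff.2 fun f ε hε => ?_
  obtain ⟨g, hgc, hle, hg, hgm⟩ := (Lp.memLp f).exists_hasCompactSupport_eLpNorm_sub_le
    (by simp) (ε := ENNReal.ofReal (ε / 2)) (by simpa using hε)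
  refine ⟨⟨hgm.toLp g, ?_⟩, ?_⟩
  · have h1 : MemLp (fun x : ℝ => (x : ℂ) • g x) 2 volume :=
      Continuous.memLp_of_hasCompactSupport (by fun_prop) hgc.smul_left
    refine h1.ae_eq ?_
    filter_upwards [hgm.coeFn_toLp] with x hx
    rw [hx]
  · rw [Lp.dist_def]
    have h2 : eLpNorm (fun x => f x - (hgm.toLp g : OneParticle 𝔥) x) 2 volume
        = eLpNorm ((f : ℝ → 𝔥) - g) 2 volume := eLpNorm_congr_ae (by
      filter_upwards [hgm.coeFn_toLp] with x hx
      rw [hx, Pi.sub_apply])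
    change (eLpNorm (fun x => f x - (hgm.toLp g : OneParticle 𝔥) x) 2 volume).toReal < ε
    rw [h2]
    refine (ENNReal.toReal_mono ENNReal.ofReal_ne_top hle).trans_lt ?_
    rw [ENNReal.toReal_ofReal (by positivity)]
    linarith

theorem denseRange_posVec : DenseRange (posVec : Lab 𝔥 → OneParticle 𝔥) :=
  denseRange_domX.mono (by rintro _ ⟨f, rfl⟩; exact ⟨fhatLab f, posVec_fhatLab f⟩)

/-- In the position representation, multiplication by `e^{itx}` is translation. -/
theorem mulExp_posVec (t : ℝ) (p : Lab 𝔥) : mulExp t (posVec p) = posVec (shiftLab (-t) p) := by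
  have h : Total (Subtype.val : DomX 𝔥 → OneParticle 𝔥) := fun y =>
    closure_mono Submodule.subset_span (denseRange_domX y)
  refine h.ext_inner fun f => ?_
  have h1 := inner_posVec (fhatLab (expX (-t) f)) p
  rw [posVec_fhatLab] at h1
  rw [inner_mulExp_right, ← posVec_fhatLab f, inner_posVec]
  rw [posVec_fhatLab]
  refine h1.trans ?_
  rw [fhatLab_expX, ← labInner_shiftLab (-t)]
  congr 1
  refine Subtype.ext (funext fun s => congrArg (fhat f) ?_)
  ring

theorem total_expVec_posVec : Total fun p : Lab 𝔥 => expVec (posVec p) :=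
  total_expVec denseRange_posVec fun z p => ⟨z • p, posVec_smul z p⟩

theorem inner_expVec_posVec (p q : Lab 𝔥) :
    ⟪expVec (posVec p), expVec (posVec q)⟫_ℂ = Complex.exp (labInner p q) := by
  rw [inner_expVec, inner_posVec]

/-! #### Continuity and differentiability of the free evolution -/

theorem inner_mulExp_eq_integral (s t : ℝ) (f : OneParticle 𝔥) : ⟪mulExp s f, mulExp t f⟫_ℂ
    = ∫ x : ℝ, Complex.exp (Complex.I * (t - s : ℝ) * x) * ⟪f x, f x⟫_ℂ := by
  change ⟪MemLp.toLp _ (memLp_exp s (Lp.memLp f)), MemLp.toLp _ (memLp_exp t (Lp.memLp f))⟫_ℂ = _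
  rw [inner_toLp]
  congr 1
  funext x
  rw [inner_smul_left, inner_smul_right, ← mul_assoc, ← Complex.exp_conj, ← Complex.exp_add]
  congr 2
  simp only [map_mul, Complex.conj_I, Complex.conj_ofReal]
  push_cast
  ring

theorem norm_exp_I_mul (t x : ℝ) : ‖Complex.exp (Complex.I * t * x)‖ = 1 := by
  rw [Complex.norm_exp]
  simp

theorem continuous_mulExp (f : OneParticle 𝔥) : Continuous fun t => mulExp t f := by
  refine continuous_of_inner ?_ fun s => ?_
  · simp only [inner_mulExp]
    exact continuous_const
  · simp only [inner_mulExp_eq_integral]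
    refine continuous_of_dominated (bound := fun x => ‖⟪f x, f x⟫_ℂ‖) (fun t => ?_) (fun t => ?_)
      (L2.integrable_inner (𝕜 := ℂ) f f).norm ?_
    · exact (Continuous.aestronglyMeasurable (by fun_prop)).mul
        (L2.integrable_inner (𝕜 := ℂ) f f).1
    · exact Eventually.of_forall fun x => by rw [norm_mul, norm_exp_I_mul, one_mul]
    · exact Eventually.of_forall fun x => by fun_prop

/-- The derivative of the free one-particle evolution, in the norm of `L²`. -/
theorem hasDerivAt_mulExp_zero (f : DomX 𝔥) :
    HasDerivAt (fun t => mulExp t f.1) (Complex.I • (mulX (𝔥 := 𝔥)).toFun f) 0 := by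
  rw [hasDerivAt_iff_tendsto_slope_zero, tendsto_iff_norm_sub_tendsto_zero]
  let D : ℝ → ℝ → ℂ := fun t x => (t : ℂ)⁻¹ * (Complex.exp (Complex.I * t * x) - 1) - Complex.I * x
  have hD : ∀ t : ℝ, ‖t⁻¹ • (mulExp (0 + t) f.1 - mulExp 0 f.1) - Complex.I • (mulX (𝔥 := 𝔥)).toFun f‖
      = Real.sqrt (∫ x, ‖D t x‖ ^ 2 * ‖f.1 x‖ ^ 2) := fun t => by
    rw [@norm_eq_sqrt_re_inner ℂ, zero_add, mulExp_zero, L2.inner_def, ← integral_re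
      (L2.integrable_inner (𝕜 := ℂ) _ _)]
    congr 1
    refine integral_congr_ae ?_
    filter_upwards [Lp.coeFn_sub (t⁻¹ • (mulExp t f.1 - f.1)) (Complex.I • (mulX (𝔥 := 𝔥)).toFun f),
      Lp.coeFn_smul t⁻¹ (mulExp t f.1 - f.1), Lp.coeFn_sub (mulExp t f.1) f.1, coeFn_expX t f,
      Lp.coeFn_smul Complex.I ((mulX (𝔥 := 𝔥)).toFun f),
      (memLp_of_mem_domX f).coeFn_toLp] with x h1 h2 h3 h4 h5 h6
    have h7 : ((mulX (𝔥 := 𝔥)).toFun f : ℝ → 𝔥) x = (x : ℂ) • f.1 x := h6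
    have h8 : (mulExp t f.1 : ℝ → 𝔥) x = Complex.exp (Complex.I * t * x) • f.1 x := h4
    rw [h1, Pi.sub_apply, h2, h5, Pi.smul_apply, Pi.smul_apply, h3, Pi.sub_apply, h7, h8,
      inner_self_eq_norm_sq]
    have h9 : t⁻¹ • (Complex.exp (Complex.I * t * x) • f.1 x - f.1 x) - Complex.I • (x : ℂ) • f.1 x
        = D t x • f.1 x := by
      rw [← Complex.coe_smul]
      simp only [D, Complex.ofReal_inv]
      module
    rw [h9, norm_smul, mul_pow]
  simp only [hD]
  have h0 : Tendsto (fun t => ∫ x, ‖D t x‖ ^ 2 * ‖f.1 x‖ ^ 2) (𝓝[≠] 0) (𝓝 (∫ _ : ℝ, (0 : ℝ))) := by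
    have hx2 : Integrable (fun x : ℝ => 4 * ‖(x : ℂ) • f.1 x‖ ^ 2) volume :=
      ((memLp_two_iff_integrable_sq_norm (memLp_of_mem_domX f).1).1 (memLp_of_mem_domX f)).const_mul 4
    refine tendsto_integral_filter_of_dominated_convergence _ ?_ ?_ hx2 ?_
    · refine Eventually.of_forall fun t => AEStronglyMeasurable.mul ?_ ?_
      · exact (Continuous.aestronglyMeasurable (by fun_prop))
      · exact (Lp.aestronglyMeasurable f.1).norm.pow 2
    · filter_upwards [self_mem_nhdsWithin] with t ht
      refine Eventually.of_forall fun x => ?_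
      have ht0 : 0 < |t| := abs_pos.2 ht
      -- Domination by a multiple of `|x| ‖f x‖`, which is square integrable on the domain of `Z_R`.
      have h1 : ‖D t x‖ ≤ 2 * |x| := by
        refine (norm_sub_le _ _).trans ?_
        have h2 := Real.norm_exp_I_mul_ofReal_sub_one_le (x := t * x)
        rw [Complex.ofReal_mul, ← mul_assoc, Real.norm_eq_abs, abs_mul] at h2
        rw [norm_mul, norm_mul, norm_inv, Complex.norm_real, Complex.norm_real, Complex.norm_I,
          one_mul, Real.norm_eq_abs, Real.norm_eq_abs, two_mul]
        gcongr
        rw [inv_mul_le_iff₀ ht0]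
        exact h2
      rw [Real.norm_eq_abs, abs_of_nonneg (by positivity), norm_smul, mul_pow, Complex.norm_real,
        Real.norm_eq_abs, ← mul_assoc]
      gcongr
      calc ‖D t x‖ ^ 2 ≤ (2 * |x|) ^ 2 := by gcongr
        _ = 4 * |x| ^ 2 := by ring
    · refine Eventually.of_forall fun x => ?_
      have h1 : HasDerivAt (fun t : ℝ => Complex.exp (Complex.I * t * x)) (Complex.I * x) 0 := by
        have h2 : HasDerivAt (fun t : ℝ => Complex.I * (t : ℂ) * x) (Complex.I * x) 0 := by
          simpa using ((Complex.ofRealCLM.hasDerivAt (x := 0)).const_mul Complex.I).mul_const (x : ℂ)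
        simpa using h2.cexp
      have h2 := tendsto_iff_norm_sub_tendsto_zero.1 (hasDerivAt_iff_tendsto_slope_zero.1 h1)
      have h3 := (h2.pow 2).mul_const (‖f.1 x‖ ^ 2)
      simp only [ne_eq, OfNat.ofNat_ne_zero, not_false_eq_true, zero_pow, zero_mul] at h3
      refine h3.congr fun t => ?_
      simp only [D, zero_add, Complex.ofReal_zero, mul_zero, Complex.exp_zero, zero_mul]
      rw [Complex.real_smul, Complex.ofReal_inv]
  have h1 := (Real.continuous_sqrt.tendsto _).comp h0
  simpa [Function.comp_def] using h1

theorem hasDerivAt_mulExp (t : ℝ) (f : DomX 𝔥) :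
    HasDerivAt (fun t => mulExp t f.1) (Complex.I • (mulX (𝔥 := 𝔥)).toFun (expX t f)) t := by
  have h : HasDerivAt (fun t' => mulExp t' (expX t f).1)
      (Complex.I • (mulX (𝔥 := 𝔥)).toFun (expX t f)) (t - t) := by
    rw [sub_self]
    exact hasDerivAt_mulExp_zero _
  have h2 := h.comp_sub_const t t
  refine h2.congr_of_eventuallyEq (Eventually.of_forall fun s => ?_)
  change mulExp s f.1 = mulExp (s - t) (mulExp t f.1)
  rw [← mulExp_add, sub_add_cancel]

end Fourier

/-! ### From semigroups of unitaries to unitary groups -/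

section Groups

variable {H X : Type*} [NormedAddCommGroup H] [InnerProductSpace ℂ H]

theorem norm_eq_of_inner {T : H →L[ℂ] H} (hT : ∀ x y, ⟪T x, T y⟫_ℂ = ⟪x, y⟫_ℂ) (x : H) :
    ‖T x‖ = ‖x‖ := by
  rw [@norm_eq_sqrt_re_inner ℂ, hT, ← @norm_eq_sqrt_re_inner ℂ]

/-- Isometries converge strongly to the identity if their diagonal matrix elements in a total family
converge. -/
theorem Total.tendsto_of_inner {v : X → H} (hv : Total v) {T : ℝ → H →L[ℂ] H} {l : Filter ℝ}
    (hT : ∀ᶠ t in l, ∀ x y, ⟪T t x, T t y⟫_ℂ = ⟪x, y⟫_ℂ)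
    (h : ∀ x, Tendsto (fun t => ⟪v x, T t (v x)⟫_ℂ) l (𝓝 ⟪v x, v x⟫_ℂ)) (z : H) :
    Tendsto (fun t => T t z) l (𝓝 z) := by
  let S : Submodule ℂ H :=
    { carrier := {z | Tendsto (fun t => T t z) l (𝓝 z)}
      add_mem' := fun {a b} ha hb => (Tendsto.add ha hb).congr fun t => (map_add _ _ _).symm
      zero_mem' := by simpa using tendsto_const_nhds
      smul_mem' := fun c a ha => (Tendsto.const_smul ha c).congr fun t => (map_smul _ _ _).symm }
  refine hv.mem_of_isClosed (S := S) ?_ (fun x => ?_) z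
  · refine isClosed_of_closure_subset fun y hy => ?_
    change Tendsto _ _ _
    rw [Metric.tendsto_nhds]
    intro ε hε
    obtain ⟨y', hy', hd⟩ := Metric.mem_closure_iff.1 hy (ε / 3) (by positivity)
    filter_upwards [hT, Metric.tendsto_nhds.1 (show Tendsto _ _ _ from hy') (ε / 3) (by positivity)]
      with t h1 h2
    calc dist (T t y) y ≤ dist (T t y) (T t y') + dist (T t y') y' + dist y' y :=
          dist_triangle4 _ _ _ _
      _ < ε / 3 + ε / 3 + ε / 3 := by
        gcongr
        · rwa [dist_eq_norm, ← map_sub, norm_eq_of_inner h1, ← dist_eq_norm]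
        · rwa [dist_comm]
      _ = ε := by ring
  · change Tendsto _ _ _
    rw [tendsto_iff_norm_sub_tendsto_zero]
    have h1 : Tendsto (fun t => Real.sqrt (2 * ‖v x‖ ^ 2 - 2 * (⟪v x, T t (v x)⟫_ℂ).re)) l
        (𝓝 (Real.sqrt (2 * ‖v x‖ ^ 2 - 2 * (⟪v x, v x⟫_ℂ).re))) := by
      have hc : Continuous fun w : ℂ => Real.sqrt (2 * ‖v x‖ ^ 2 - 2 * w.re) := by fun_prop
      exact (hc.tendsto _).comp (h x)
    have h2 : (⟪v x, v x⟫_ℂ).re = ‖v x‖ ^ 2 := inner_self_eq_norm_sq (𝕜 := ℂ) (v x)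
    rw [h2, sub_self, Real.sqrt_zero] at h1
    refine h1.congr' ?_
    filter_upwards [hT] with t ht
    have h3 := @norm_sub_sq ℂ _ _ _ _ (T t (v x)) (v x)
    rw [norm_eq_of_inner ht, ← inner_re_symm] at h3
    rw [← Real.sqrt_sq (norm_nonneg (T t (v x) - v x)), h3]
    congr 1
    change _ = ‖v x‖ ^ 2 - 2 * (⟪v x, T t (v x)⟫_ℂ).re + ‖v x‖ ^ 2
    ring

variable [CompleteSpace H]

theorem mem_unitary_of_inner {T : H →L[ℂ] H} (hT : ∀ x y, ⟪T x, T y⟫_ℂ = ⟪x, y⟫_ℂ)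
    (hT' : ∀ x y, ⟪T.adjoint x, T.adjoint y⟫_ℂ = ⟪x, y⟫_ℂ) : T ∈ unitary (H →L[ℂ] H) := by
  rw [Unitary.mem_iff, ContinuousLinearMap.star_eq_adjoint]
  constructor
  · ext x
    refine ext_inner_left ℂ fun y => ?_
    rw [mul_apply_eq_comp, ContinuousLinearMap.adjoint_inner_right, hT]
    rfl
  · ext x
    refine ext_inner_left ℂ fun y => ?_
    rw [mul_apply_eq_comp, ← ContinuousLinearMap.adjoint_inner_left, hT']
    rfl

/-- The extension of a semigroup of unitaries to negative times. -/
def groupOf (W : ℝ → H →L[ℂ] H) (t : ℝ) : H →L[ℂ] H := if 0 ≤ t then W t else (W (-t)).adjoint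

theorem groupOf_of_nonneg (W : ℝ → H →L[ℂ] H) {t : ℝ} (ht : 0 ≤ t) : groupOf W t = W t := if_pos ht

theorem groupOf_neg {W : ℝ → H →L[ℂ] H} (h0 : W 0 = 1) {t : ℝ} (ht : 0 ≤ t) :
    groupOf W (-t) = (W t).adjoint := by
  rcases ht.eq_or_lt with rfl | ht
  · rw [neg_zero, groupOf_of_nonneg W le_rfl, h0, ← ContinuousLinearMap.star_eq_adjoint, star_one]
  · rw [groupOf, if_neg (by linarith), neg_neg]

/-- A semigroup of unitaries that is strongly continuous at `0` extends, by adjoints, to a strongly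
continuous group. -/
theorem isUnitaryGroup_groupOf {W : ℝ → H →L[ℂ] H}
    (hu : ∀ t, 0 ≤ t → W t ∈ unitary (H →L[ℂ] H)) (h0 : W 0 = 1)
    (hadd : ∀ s t, 0 ≤ s → 0 ≤ t → W (s + t) = W s * W t)
    (hc : ∀ z, Tendsto (fun t => W t z) (𝓝[≥] 0) (𝓝 z)) : IsUnitaryGroup (groupOf W) := by
  have hneg : ∀ t, 0 ≤ t → groupOf W (-t) = star (W t) := fun t ht => groupOf_neg h0 ht
  have hpos : ∀ t, 0 ≤ t → groupOf W t = W t := fun t ht => groupOf_of_nonneg W ht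
  have hl : ∀ t, 0 ≤ t → star (W t) * W t = 1 := fun t ht => (Unitary.mem_iff.1 (hu t ht)).1
  have hr : ∀ t, 0 ≤ t → W t * star (W t) = 1 := fun t ht => (Unitary.mem_iff.1 (hu t ht)).2
  have hunit : ∀ t, groupOf W t ∈ unitary (H →L[ℂ] H) := fun t => by
    rcases le_total 0 t with ht | ht
    · rw [hpos t ht]; exact hu t ht
    · have := hneg (-t) (by linarith)
      rw [neg_neg] at this
      rw [this]
      exact Unitary.star_mem (hu _ (by linarith))
  -- for `a, b ≥ 0`, the operators at times `a` and `-b` compose in both orders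
  have hmix : ∀ a b, 0 ≤ a → 0 ≤ b → groupOf W (a - b) = W a * star (W b) ∧
      groupOf W (a - b) = star (W b) * W a := fun a b ha hb => by
    rcases le_total b a with h | h
    · have h1 : 0 ≤ a - b := by linarith
      have h2 : W a = W (a - b) * W b := by rw [← hadd _ _ h1 hb, sub_add_cancel]
      have h3 : W a = W b * W (a - b) := by rw [← hadd _ _ hb h1, add_sub_cancel]
      rw [hpos _ h1]
      constructor
      · rw [h2, mul_assoc, hr b hb, mul_one]
      · rw [h3, ← mul_assoc, hl b hb, one_mul]
    · have h1 : 0 ≤ b - a := by linarith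
      have h2 : W b = W (b - a) * W a := by rw [← hadd _ _ h1 ha, sub_add_cancel]
      have h3 : W b = W a * W (b - a) := by rw [← hadd _ _ ha h1, add_sub_cancel]
      have h4 := hneg _ h1
      rw [neg_sub] at h4
      rw [h4]
      constructor
      · rw [h2, star_mul, ← mul_assoc, hr a ha, one_mul]
      · rw [h3, star_mul, mul_assoc, hl a ha, mul_one]
  have hgadd : ∀ s t, groupOf W (s + t) = groupOf W s * groupOf W t := fun s t => by
    rcases le_total 0 s with hs | hs <;> rcases le_total 0 t with ht | ht
    · rw [hpos _ hs, hpos _ ht, hpos _ (by linarith), hadd _ _ hs ht]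
    · have h1 := hneg (-t) (by linarith)
      rw [neg_neg] at h1
      rw [hpos _ hs, h1, ← (hmix s (-t) hs (by linarith)).1, sub_neg_eq_add]
    · have h1 := hneg (-s) (by linarith)
      rw [neg_neg] at h1
      rw [hpos _ ht, h1, ← (hmix t (-s) ht (by linarith)).2, sub_neg_eq_add, add_comm]
    · have h1 := hneg (-s) (by linarith)
      have h2 := hneg (-t) (by linarith)
      have h3 := hneg (-t + -s) (by linarith)
      rw [neg_neg] at h1 h2
      rw [neg_add, neg_neg, neg_neg, hadd _ _ (by linarith) (by linarith), star_mul] at h3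
      rw [h1, h2, ← h3, add_comm]
  refine ⟨hunit, (hpos 0 le_rfl).trans h0, hgadd, fun z => ?_⟩
  have hnorm : ∀ t y, ‖groupOf W t y‖ = ‖y‖ := fun t y => by
    refine norm_eq_of_inner (fun x y => ?_) y
    rw [← ContinuousLinearMap.adjoint_inner_right, ← mul_apply_eq_comp,
      ← ContinuousLinearMap.star_eq_adjoint, (Unitary.mem_iff.1 (hunit t)).1]
    rfl
  have hdiff : ∀ s t, ‖groupOf W s z - groupOf W t z‖ = ‖W |s - t| z - z‖ := by
    have key : ∀ s t, t ≤ s → ‖groupOf W s z - groupOf W t z‖ = ‖W |s - t| z - z‖ := fun s t h => by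
      have h1 : s = t + (s - t) := by ring
      nth_rw 1 [h1]
      rw [hgadd, mul_apply_eq_comp, ← map_sub, hnorm, hpos _ (by linarith),
        abs_of_nonneg (by linarith)]
    intro s t
    rcases le_total t s with h | h
    · exact key s t h
    · rw [norm_sub_rev, key t s h, abs_sub_comm]
  rw [continuous_iff_continuousAt]
  intro t
  rw [ContinuousAt, tendsto_iff_norm_sub_tendsto_zero]
  simp only [hdiff]
  have h1 := tendsto_iff_norm_sub_tendsto_zero.1 (hc z)
  refine h1.comp (tendsto_nhdsWithin_iff.2 ⟨?_, Eventually.of_forall fun s => Set.mem_Ici.2 (abs_nonneg _)⟩)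
  have hcont : Continuous fun s => |s - t| := by fun_prop
  simpa using hcont.tendsto t

end Groups

/-! ### The free evolution -/

section Free

variable {K 𝔥 : Type*} [NormedAddCommGroup K] [InnerProductSpace ℂ K]
  [FiniteDimensional ℂ K] [CompleteSpace K]
  [NormedAddCommGroup 𝔥] [InnerProductSpace ℂ 𝔥] [CompleteSpace 𝔥]

/-- `Γ(e^{itZ_R})` on the Fock space. -/
def freeFock (𝔥 : Type*) [NormedAddCommGroup 𝔥] [InnerProductSpace ℂ 𝔥] [CompleteSpace 𝔥] (t : ℝ) :
    Fock (OneParticle 𝔥) →L[ℂ] Fock (OneParticle 𝔥) :=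
  (exists_secondQuantization (mulExp (𝔥 := 𝔥) t) (inner_mulExp t)).choose

theorem freeFock_fockPow (t : ℝ) (n : ℕ) (f : OneParticle 𝔥) :
    freeFock 𝔥 t (fockPow n f) = fockPow n (mulExp t f) :=
  (exists_secondQuantization (mulExp (𝔥 := 𝔥) t) (inner_mulExp t)).choose_spec.1 n f

theorem freeFock_expVec (t : ℝ) (p : Lab 𝔥) :
    freeFock 𝔥 t (expVec (posVec p)) = expVec (posVec (shiftLab (-t) p)) := by
  rw [← mulExp_posVec]
  exact (exists_secondQuantization (mulExp (𝔥 := 𝔥) t) (inner_mulExp t)).choose_spec.2.1 _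

theorem inner_freeFock (t : ℝ) (x y : Fock (OneParticle 𝔥)) :
    ⟪freeFock 𝔥 t x, freeFock 𝔥 t y⟫_ℂ = ⟪x, y⟫_ℂ :=
  (exists_secondQuantization (mulExp (𝔥 := 𝔥) t) (inner_mulExp t)).choose_spec.2.2 _ _

theorem total_fockPow_id :
    Total fun p : ℕ × OneParticle 𝔥 => fockPow p.1 p.2 := total_fockPow (v := id) denseRange_id

theorem freeFock_add (s t : ℝ) : freeFock 𝔥 (s + t) = freeFock 𝔥 s ∘L freeFock 𝔥 t := by
  refine total_fockPow_id.clm_ext fun ⟨n, f⟩ => ?_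
  rw [ContinuousLinearMap.comp_apply]
  simp only [freeFock_fockPow, mulExp_add]

theorem freeFock_zero : freeFock 𝔥 0 = 1 := by
  refine total_fockPow_id.clm_ext fun ⟨n, f⟩ => ?_
  simp only [freeFock_fockPow, mulExp_zero]
  rfl

variable (K) in
/-- `1 ⊗ Γ(e^{itZ_R})` on the whole space. -/
def freeU (𝔥 : Type*) [NormedAddCommGroup 𝔥] [InnerProductSpace ℂ 𝔥] [CompleteSpace 𝔥] (t : ℝ) :
    TotalSpace K 𝔥 →L[ℂ] TotalSpace K 𝔥 := (freeFock 𝔥 t).lTensor K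

theorem freeU_tmul (t : ℝ) (k : K) (x : Fock (OneParticle 𝔥)) :
    freeU K 𝔥 t (k ⊗ₜ[ℂ] x) = k ⊗ₜ[ℂ] freeFock 𝔥 t x := rfl

theorem total_tmul_fockPow :
    Total fun p : K × ℕ × OneParticle 𝔥 => p.1 ⊗ₜ[ℂ] fockPow p.2.1 p.2.2 := total_fockPow_id.tmul

theorem freeU_add (s t : ℝ) : freeU K 𝔥 (s + t) = freeU K 𝔥 s ∘L freeU K 𝔥 t := by
  refine total_tmul_fockPow.clm_ext fun ⟨k, n, f⟩ => ?_
  rw [ContinuousLinearMap.comp_apply]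
  simp only [freeU_tmul, freeFock_add]
  rfl

theorem freeU_zero : freeU K 𝔥 0 = 1 := by
  refine total_tmul_fockPow.clm_ext fun ⟨k, n, f⟩ => ?_
  simp only [freeU_tmul, freeFock_zero]
  rfl

theorem freeU_neg_freeU (t : ℝ) (x : TotalSpace K 𝔥) : freeU K 𝔥 (-t) (freeU K 𝔥 t x) = x := by
  rw [← ContinuousLinearMap.comp_apply, ← freeU_add, neg_add_cancel, freeU_zero]
  rfl

theorem freeU_freeU_neg (t : ℝ) (x : TotalSpace K 𝔥) : freeU K 𝔥 t (freeU K 𝔥 (-t) x) = x := by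
  rw [← ContinuousLinearMap.comp_apply, ← freeU_add, add_neg_cancel, freeU_zero]
  rfl

theorem inner_freeU (t : ℝ) (x y : TotalSpace K 𝔥) :
    ⟪freeU K 𝔥 t x, freeU K 𝔥 t y⟫_ℂ = ⟪x, y⟫_ℂ := inner_lTensor (inner_freeFock t) x y

theorem inner_freeU_right (t : ℝ) (x y : TotalSpace K 𝔥) :
    ⟪x, freeU K 𝔥 t y⟫_ℂ = ⟪freeU K 𝔥 (-t) x, y⟫_ℂ := by
  rw [← inner_freeU t (freeU K 𝔥 (-t) x), freeU_freeU_neg]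

theorem adjoint_freeU (t : ℝ) :
    (freeU K 𝔥 t).adjoint = freeU K 𝔥 (-t) := by
  ext x
  refine ext_inner_right ℂ fun y => ?_
  rw [ContinuousLinearMap.adjoint_inner_left, inner_freeU_right]

theorem ampl_freeU (S : K →L[ℂ] K) (t : ℝ) (x : TotalSpace K 𝔥) :
    ampl _ S (freeU K 𝔥 t x) = freeU K 𝔥 t (ampl _ S x) := ampl_lTensor S _ x

theorem tendsto_freeU (x : TotalSpace K 𝔥) :
    Tendsto (fun t => freeU K 𝔥 t x) (𝓝 0) (𝓝 x) := by
  refine total_tmul_fockPow.tendsto_of_inner (Eventually.of_forall inner_freeU) ?_ x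
  rintro ⟨k, n, f⟩
  simp only [freeU_tmul, freeFock_fockPow]
  have h : Continuous fun t => (k ⊗ₜ[ℂ] fockPow n (mulExp t f) : TotalSpace K 𝔥) :=
    ((TensorProduct.mkL ℂ K _) k).continuous.comp ((continuous_fockPow n).comp (continuous_mulExp f))
  have h2 := (continuous_const (y := (k ⊗ₜ[ℂ] fockPow n f : TotalSpace K 𝔥))).inner (𝕜 := ℂ) h
  have h3 := h2.tendsto 0
  rwa [mulExp_zero] at h3

theorem freeU_vacuum (t : ℝ) (k : K) :
    freeU K 𝔥 t (k ⊗ₜ[ℂ] vacuum (OneParticle 𝔥)) = k ⊗ₜ[ℂ] vacuum (OneParticle 𝔥) := by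
  rw [freeU_tmul, vacuum_eq 0, freeFock_fockPow, map_zero]

theorem expVec_posVec_zero : expVec (posVec (0 : Lab 𝔥)) = vacuum (OneParticle 𝔥) := by
  rw [← expVec_zero]
  congr 1
  have := posVec_smul 0 (0 : Lab 𝔥)
  rwa [zero_smul, zero_smul] at this

end Free

/-! ### The coupling and its decompositions -/

section Coupling

variable {K 𝔥 : Type*} [NormedAddCommGroup K] [InnerProductSpace ℂ K]
  [FiniteDimensional ℂ K] [CompleteSpace K]
  [NormedAddCommGroup 𝔥] [InnerProductSpace ℂ 𝔥] [CompleteSpace 𝔥]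

/-- The partial matrix element `(1 ⊗ ⟨h|) ν`. -/
def coef (ν : K →L[ℂ] K ⊗[ℂ] 𝔥) (h : 𝔥) : K →L[ℂ] K :=
  LinearMap.toContinuousLinearMap ((TensorProduct.rid ℂ K).toLinearMap ∘ₗ
    LinearMap.lTensor K (innerₛₗ ℂ h) ∘ₗ ν.toLinearMap)

variable {ν : K →L[ℂ] K ⊗[ℂ] 𝔥} {J : Type*} [Fintype J] {C : J → K →L[ℂ] K} {b : J → 𝔥}

theorem IsDecomposition.coef (h : IsDecomposition ν C b) (x : 𝔥) :
    coef ν x = ∑ j, ⟪x, b j⟫_ℂ • C j := by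
  ext k
  change TensorProduct.rid ℂ K (LinearMap.lTensor K (innerₛₗ ℂ x) (ν k)) = _
  rw [h k]
  simp [sum_apply]

theorem IsDecomposition.adjoint_tmul (h : IsDecomposition ν C b) (k : K) (x : 𝔥) :
    ν.adjoint (k ⊗ₜ[ℂ] x) = ∑ j, ⟪b j, x⟫_ℂ • (C j).adjoint k := by
  refine ext_inner_left ℂ fun k' => ?_
  rw [ContinuousLinearMap.adjoint_inner_right, h k', sum_inner, inner_sum]
  refine Finset.sum_congr rfl fun j _ => ?_
  rw [TensorProduct.inner_tmul, inner_smul_right, ContinuousLinearMap.adjoint_inner_right, mul_comm]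

theorem IsDecomposition.adjoint_coef (h : IsDecomposition ν C b) (x : 𝔥) :
    (WhiteNoise.coef ν x).adjoint = ∑ j, ⟪b j, x⟫_ℂ • (C j).adjoint := by
  rw [h.coef, map_sum]
  simp only [map_smulₛₗ, inner_conj_symm]

/-- Every orthonormal basis of `𝔥` gives a decomposition of `ν`. -/
theorem isDecomposition_coef {ι : Type*} [Fintype ι] (ν : K →L[ℂ] K ⊗[ℂ] 𝔥)
    (b : OrthonormalBasis ι ℂ 𝔥) : IsDecomposition ν (fun i => coef ν (b i)) b := by
  intro k
  have h : ∀ x : K ⊗[ℂ] 𝔥, x = ∑ i, (TensorProduct.rid ℂ K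
      (LinearMap.lTensor K (innerₛₗ ℂ (b i)) x)) ⊗ₜ[ℂ] b i := fun x => by
    induction x using TensorProduct.induction_on with
    | zero => simp
    | tmul k y =>
      simp only [LinearMap.lTensor_tmul, TensorProduct.rid_tmul, innerₛₗ_apply_apply,
        TensorProduct.smul_tmul]
      rw [← TensorProduct.tmul_sum, b.sum_repr']
    | add x y hx hy =>
      simp only [map_add, TensorProduct.add_tmul, Finset.sum_add_distrib]
      rw [← hx, ← hy]
  exact h (ν k)

/-- For an orthonormal decomposition, `ν† (S ⊗ 1) ν` has the form of Kraus. -/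
theorem IsDecomposition.adjoint_ampl {ι : Type*} [Fintype ι] {b : ι → 𝔥} {C : ι → K →L[ℂ] K}
    (h : IsDecomposition ν C b) (hb : Orthonormal ℂ b) (S : K →L[ℂ] K) :
    ν.adjoint ∘L ampl 𝔥 S ∘L ν = ∑ i, (C i).adjoint * S * C i := by
  classical
  ext k
  rw [ContinuousLinearMap.comp_apply, ContinuousLinearMap.comp_apply, h k, map_sum, map_sum,
    sum_apply]
  refine Finset.sum_congr rfl fun i _ => ?_
  rw [ampl_tmul, h.adjoint_tmul]
  simp only [orthonormal_iff_ite.1 hb, ite_smul, one_smul, zero_smul, Finset.sum_ite_eq',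
    Finset.mem_univ, if_true]
  rfl

variable [FiniteDimensional ℂ 𝔥]

/-- The generator `-iΥ` of the contraction semigroup. -/
def drift (E : K →L[ℂ] K) (ν : K →L[ℂ] K ⊗[ℂ] 𝔥) : K →L[ℂ] K := (-Complex.I) • upsilon E ν

/-- The coefficients of the noise in the orthonormal basis `stdOrthonormalBasis ℂ 𝔥`. -/
def noiseCoef (ν : K →L[ℂ] K ⊗[ℂ] 𝔥) (i : Fin (Module.finrank ℂ 𝔥)) : K →L[ℂ] K :=
  (-Complex.I) • coef ν (stdOrthonormalBasis ℂ 𝔥 i)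

/-- The generator in a form that does not refer to a basis. -/
theorem gen_eq_coef (E : K →L[ℂ] K) (ν : K →L[ℂ] K ⊗[ℂ] 𝔥) (f g : Lab 𝔥) (s : ℝ) :
    gen (drift E ν) (noiseCoef ν) (stdOrthonormalBasis ℂ 𝔥) f g s
      = (-Complex.I) • (upsilon E ν + coef ν (f.1 s) + (coef ν (g.1 s)).adjoint) := by
  rw [(isDecomposition_coef ν (stdOrthonormalBasis ℂ 𝔥)).coef (f.1 s),
    (isDecomposition_coef ν (stdOrthonormalBasis ℂ 𝔥)).adjoint_coef (g.1 s), gen, sub_eq_add_neg,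
    ← Finset.sum_neg_distrib]
  simp only [drift, noiseCoef, smul_add, Finset.smul_sum, map_smulₛₗ, map_neg, Complex.conj_I,
    neg_neg]
  congr 1
  · congr 1
    exact Finset.sum_congr rfl fun i _ => smul_comm _ _ _
  · refine Finset.sum_congr rfl fun i _ => ?_
    rw [smul_comm, neg_smul]

theorem adjoint_upsilon {E : K →L[ℂ] K} (hE : IsSelfAdjoint E) (ν : K →L[ℂ] K ⊗[ℂ] 𝔥) :
    (upsilon E ν).adjoint = E + (Complex.I / 2) • (ν.adjoint ∘L ν) := by
  have h1 : E.adjoint = E := hE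
  rw [upsilon, map_sub, h1, map_smulₛₗ, ContinuousLinearMap.adjoint_comp,
    ContinuousLinearMap.adjoint_adjoint, map_div₀, Complex.conj_I, map_ofNat, neg_div, neg_smul,
    sub_neg_eq_add]

theorem sum_noiseCoef (ν : K →L[ℂ] K ⊗[ℂ] 𝔥) (S : K →L[ℂ] K) :
    ∑ i, (noiseCoef ν i).adjoint * S * noiseCoef ν i = ν.adjoint ∘L ampl 𝔥 S ∘L ν := by
  rw [(isDecomposition_coef ν (stdOrthonormalBasis ℂ 𝔥)).adjoint_ampl
    (stdOrthonormalBasis ℂ 𝔥).orthonormal]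
  refine Finset.sum_congr rfl fun i _ => ?_
  simp only [noiseCoef, map_smulₛₗ, map_neg, Complex.conj_I, neg_neg, smul_mul_assoc,
    mul_smul_comm, smul_smul]
  simp

/-- The identity `-iΥ + iΥ* = -ν*ν` in the form that makes the cocycle isometric. -/
theorem drift_add_adjoint {E : K →L[ℂ] K} (hE : IsSelfAdjoint E) (ν : K →L[ℂ] K ⊗[ℂ] 𝔥) :
    drift E ν + (drift E ν).adjoint + ∑ i, (noiseCoef ν i).adjoint * noiseCoef ν i = 0 := by
  have h := sum_noiseCoef ν 1
  simp only [mul_one, ampl_one] at h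
  have h1 : ν.adjoint ∘L (1 : K ⊗[ℂ] 𝔥 →L[ℂ] K ⊗[ℂ] 𝔥) ∘L ν = ν.adjoint ∘L ν := rfl
  rw [h, h1, drift, map_smulₛₗ, adjoint_upsilon hE, upsilon, map_neg, Complex.conj_I, neg_neg]
  have h2 : Complex.I * (Complex.I / 2) = -(1 / 2) := by
    rw [mul_div_assoc', Complex.I_mul_I]; ring
  simp only [smul_sub, smul_add, smul_smul, neg_mul, h2, neg_smul]
  module

theorem hpLindblad_drift (E : K →L[ℂ] K) (ν : K →L[ℂ] K ⊗[ℂ] 𝔥) :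
    hpLindblad (drift E ν) (noiseCoef ν) = lindblad E ν := by
  refine ContinuousLinearMap.ext fun S => ?_
  rw [hpLindblad_apply, sum_noiseCoef]
  change _ = Complex.I • ((upsilon E ν).adjoint ∘L S - S ∘L upsilon E ν) + _
  congr 1
  rw [drift, map_smulₛₗ, map_neg, Complex.conj_I, neg_neg, smul_mul_assoc, mul_smul_comm, neg_smul,
    ← sub_eq_add_neg, ← smul_sub]
  rfl

theorem hpLindblad_drift_adjoint (E : K →L[ℂ] K) (ν : K →L[ℂ] K ⊗[ℂ] 𝔥) :
    hpLindblad (drift E ν).adjoint (fun i => -noiseCoef ν i) = lindbladBack E ν := by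
  refine ContinuousLinearMap.ext fun S => ?_
  rw [hpLindblad_apply]
  have h : ∑ i, (-noiseCoef ν i).adjoint * S * -noiseCoef ν i = ν.adjoint ∘L ampl 𝔥 S ∘L ν := by
    rw [← sum_noiseCoef]
    refine Finset.sum_congr rfl fun i _ => ?_
    rw [map_neg]
    noncomm_ring
  rw [h]
  change _ = (-Complex.I) • (upsilon E ν ∘L S - S ∘L (upsilon E ν).adjoint) + _
  congr 1
  rw [drift, map_smulₛₗ, map_neg, Complex.conj_I, neg_neg, map_smulₛₗ, Complex.conj_I,
    ContinuousLinearMap.adjoint_adjoint, smul_mul_assoc, mul_smul_comm, smul_sub, neg_smul,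
    neg_smul, neg_smul, sub_neg_eq_add]
  rfl

end Coupling

/-! ### The unitary group -/

section UnitaryGroup

variable {K 𝔥 : Type*} [NormedAddCommGroup K] [InnerProductSpace ℂ K]
  [FiniteDimensional ℂ K] [CompleteSpace K]
  [NormedAddCommGroup 𝔥] [InnerProductSpace ℂ 𝔥] [CompleteSpace 𝔥] [FiniteDimensional ℂ 𝔥]

/-- `V` is the cocycle in the interaction picture: at every time `t ≥ 0` it has the matrix elements
between exponential vectors that the propagators prescribe. -/
def IsCocycle (E : K →L[ℂ] K) (ν : K →L[ℂ] K ⊗[ℂ] 𝔥)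
    (V : ℝ → TotalSpace K 𝔥 →L[ℂ] TotalSpace K 𝔥) : Prop :=
  ∀ t, 0 ≤ t → HasCocycleMatrix (drift E ν) (noiseCoef ν) (stdOrthonormalBasis ℂ 𝔥)
    (fun p : Lab 𝔥 => expVec (posVec p)) t fun k p => V t (k ⊗ₜ[ℂ] expVec (posVec p))

theorem embedVec_adjoint_apply_inner {F : Type*} [NormedAddCommGroup F] [InnerProductSpace ℂ F]
    [CompleteSpace F] (Ω : F) (k : K) (z : K ⊗[ℂ] F) :
    ⟪k, (embedVec (K := K) Ω).adjoint z⟫_ℂ = ⟪k ⊗ₜ[ℂ] Ω, z⟫_ℂ :=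
  ContinuousLinearMap.adjoint_inner_right _ _ _

/-- The cocycle, together with the free evolution, gives a strongly continuous unitary group that
dilates both Lindblad semigroups. -/
theorem exists_unitaryGroup {E : K →L[ℂ] K} (hE : IsSelfAdjoint E) (ν : K →L[ℂ] K ⊗[ℂ] 𝔥) :
    ∃ U V : ℝ → TotalSpace K 𝔥 →L[ℂ] TotalSpace K 𝔥,
      IsUnitaryGroup U ∧ (∀ t, 0 ≤ t → U (-t) = (U t).adjoint) ∧
      (∀ t, 0 ≤ t → U t = freeU K 𝔥 (-t) ∘L V t) ∧ IsCocycle E ν V ∧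
      (∀ t, 0 ≤ t → ∀ (S : K →L[ℂ] K) k' k,
        ⟪U t (k' ⊗ₜ[ℂ] vacuum (OneParticle 𝔥)), ampl _ S (U t (k ⊗ₜ[ℂ] vacuum (OneParticle 𝔥)))⟫_ℂ
          = ⟪k', NormedSpace.exp ((t : ℂ) • lindblad E ν) S k⟫_ℂ) ∧
      ∀ t, 0 ≤ t → ∀ (S : K →L[ℂ] K) k' k,
        ⟪(U t).adjoint (k' ⊗ₜ[ℂ] vacuum (OneParticle 𝔥)),
          ampl _ S ((U t).adjoint (k ⊗ₜ[ℂ] vacuum (OneParticle 𝔥)))⟫_ℂ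
          = ⟪k', NormedSpace.exp ((t : ℂ) • lindbladBack E ν) S k⟫_ℂ := by
  have he := inner_expVec_posVec (𝔥 := 𝔥)
  have het := total_expVec_posVec (𝔥 := 𝔥)
  have hb := (stdOrthonormalBasis ℂ 𝔥).orthonormal
  have hYL := drift_add_adjoint hE ν
  have hex := fun t : Set.Ici (0 : ℝ) =>
    exists_cocycle (Y := drift E ν) (L := noiseCoef ν) he het hb hYL t.2
  choose V0 hVm hVi hVl hVL using hex
  let V : ℝ → TotalSpace K 𝔥 →L[ℂ] TotalSpace K 𝔥 := fun t => if h : 0 ≤ t then V0 ⟨t, h⟩ else 0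
  have hV : ∀ t (h : 0 ≤ t), V t = V0 ⟨t, h⟩ := fun t h => dif_pos h
  have hco : IsCocycle E ν V := fun t ht => by
    rw [hV t ht]; exact hVm ⟨t, ht⟩
  have hinner : ∀ t, 0 ≤ t → ∀ x y, ⟪V t x, V t y⟫_ℂ = ⟪x, y⟫_ℂ := fun t ht => by
    rw [hV t ht]; exact hVi ⟨t, ht⟩
  have hadj := fun t (ht : 0 ≤ t) => cocycle_adjoint he het hb hYL ht (hco t ht)
  let W : ℝ → TotalSpace K 𝔥 →L[ℂ] TotalSpace K 𝔥 := fun t => freeU K 𝔥 (-t) ∘L V t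
  have hWadj : ∀ t, (W t).adjoint = (V t).adjoint ∘L freeU K 𝔥 t := fun t => by
    rw [ContinuousLinearMap.adjoint_comp, adjoint_freeU, neg_neg]
  have hWu : ∀ t, 0 ≤ t → W t ∈ unitary _ := fun t ht => by
    refine mem_unitary_of_inner (fun x y => ?_) fun x y => ?_
    · exact (inner_freeU _ _ _).trans (hinner t ht x y)
    · rw [hWadj]
      exact ((hadj t ht).1 _ _).trans (inner_freeU _ _ _)
  have hV0 : V 0 = 1 := by
    refine (Total.tmul (K := K) het).clm_ext fun ⟨k, p⟩ => ?_
    refine (Total.tmul (K := K) het).ext_inner fun ⟨k', q⟩ => ?_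
    have h := hco 0 le_rfl k' k q p
    rw [propagator_self] at h
    refine h.trans ?_
    rw [mul_comm, ← he]
    exact (TensorProduct.inner_tmul ..).symm
  have hW0 : W 0 = 1 := by
    simp only [W, neg_zero, freeU_zero, hV0]
    rfl
  -- With `V (s + t) = Γ_t V_s Γ_{-t} V_t`, the free factors of `W (s + t)` cancel.
  have hWadd : ∀ s t, 0 ≤ s → 0 ≤ t → W (s + t) = W s * W t := fun s t hs ht => by
    have h := cocycle_comp (Vt := V t) het hs ht (hco s hs) (hco (s + t) (by linarith))
      (by rw [hV t ht]; exact hVl ⟨t, ht⟩) (Γ := freeFock 𝔥 t) (Γ' := freeFock 𝔥 (-t))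
      (freeFock_expVec t) (inner_freeFock t)
      (fun p => by rw [freeFock_expVec, neg_neg])
    ext x
    have h1 : V (s + t) x = freeU K 𝔥 t (V s (freeU K 𝔥 (-t) (V t x))) := by rw [h]; rfl
    change freeU K 𝔥 (-(s + t)) (V (s + t) x) = freeU K 𝔥 (-s) (V s (freeU K 𝔥 (-t) (V t x)))
    rw [h1, neg_add, freeU_add, ContinuousLinearMap.comp_apply, freeU_neg_freeU]
  -- For isometries, strong continuity at `0` follows from that of the diagonal matrix elements.
  have hVc : ∀ z, Tendsto (fun t => V t z) (𝓝[≥] 0) (𝓝 z) := fun z => by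
    refine (Total.tmul (K := K) het).tendsto_of_inner ?_ (fun ⟨k, p⟩ => ?_) z
    · filter_upwards [self_mem_nhdsWithin] with t ht using hinner t ht
    · obtain ⟨M, hM⟩ := exists_isBddGen (Y := drift E ν) (L := noiseCoef ν)
        (b := stdOrthonormalBasis ℂ 𝔥) p p
      have h1 := (continuousOn_propagator hM (zero_le_one' ℝ)) 0 ⟨le_rfl, zero_le_one⟩
      rw [ContinuousWithinAt, propagator_self, nhdsWithin_Icc_eq_nhdsGE (zero_lt_one' ℝ)] at h1
      have h2 : Continuous fun X : K →L[ℂ] K => Complex.exp (labInner p p) * ⟪k, X k⟫_ℂ := by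
        fun_prop
      have h3 := (h2.tendsto 1).comp h1
      have h4 : ⟪k ⊗ₜ[ℂ] expVec (posVec p), k ⊗ₜ[ℂ] expVec (posVec p)⟫_ℂ
          = Complex.exp (labInner p p) * ⟪k, k⟫_ℂ := by
        rw [mul_comm, ← he]
        exact TensorProduct.inner_tmul ..
      rw [h4]
      refine h3.congr' ?_
      filter_upwards [self_mem_nhdsWithin] with t ht
      exact (hco t ht k k p p).symm
  have hWc : ∀ z, Tendsto (fun t => W t z) (𝓝[≥] 0) (𝓝 z) := fun z => by
    rw [tendsto_iff_norm_sub_tendsto_zero]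
    have h1 := tendsto_iff_norm_sub_tendsto_zero.1 (hVc z)
    have hneg : Tendsto (fun t : ℝ => -t) (𝓝[≥] 0) (𝓝 0) := by
      have : Tendsto (fun t : ℝ => -t) (𝓝 0) (𝓝 (-0)) := (continuous_neg).tendsto 0
      rw [neg_zero] at this
      exact this.mono_left nhdsWithin_le_nhds
    have h2 := tendsto_iff_norm_sub_tendsto_zero.1 ((tendsto_freeU z).comp hneg)
    have h3 := h1.add h2
    rw [add_zero] at h3
    refine squeeze_zero (fun _ => norm_nonneg _) (fun t => ?_) h3
    have h4 : W t z - z = freeU K 𝔥 (-t) (V t z - z) + (freeU K 𝔥 (-t) z - z) := by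
      rw [map_sub]
      simp only [W, ContinuousLinearMap.comp_apply]
      abel
    rw [h4]
    refine (norm_add_le _ _).trans ?_
    rw [norm_eq_of_inner (inner_freeU _)]
    rfl
  refine ⟨groupOf W, V, isUnitaryGroup_groupOf hWu hW0 hWadd hWc, fun t ht => ?_, fun t ht => ?_,
    hco, fun t ht S k' k => ?_, fun t ht S k' k => ?_⟩
  · rw [groupOf_neg hW0 ht, groupOf_of_nonneg W ht]
  · rw [groupOf_of_nonneg W ht]
  · rw [groupOf_of_nonneg W ht]
    simp only [W, ContinuousLinearMap.comp_apply]
    rw [ampl_freeU, inner_freeU, ← hpLindblad_drift, ← expVec_posVec_zero, hV t ht]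
    exact hVL ⟨t, ht⟩ S k' k
  · rw [groupOf_of_nonneg W ht, hWadj]
    simp only [ContinuousLinearMap.comp_apply, freeU_vacuum]
    rw [← hpLindblad_drift_adjoint, ← expVec_posVec_zero]
    exact (hadj t ht).2 S k' k

/-- The vacuum expectation of the cocycle is the contraction semigroup. -/
theorem inner_cocycle_vacuum {E : K →L[ℂ] K} {ν : K →L[ℂ] K ⊗[ℂ] 𝔥}
    {V : ℝ → TotalSpace K 𝔥 →L[ℂ] TotalSpace K 𝔥} (hV : IsCocycle E ν V) {t : ℝ} (ht : 0 ≤ t)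
    (k' k : K) : ⟪k' ⊗ₜ[ℂ] vacuum (OneParticle 𝔥), V t (k ⊗ₜ[ℂ] vacuum (OneParticle 𝔥))⟫_ℂ
      = ⟪k', NormedSpace.exp ((-Complex.I * t) • upsilon E ν) k⟫_ℂ := by
  have h := hV t ht k' k 0 0
  have h1 : gen (drift E ν) (noiseCoef ν) (stdOrthonormalBasis ℂ 𝔥) 0 0 = fun _ => drift E ν := by
    funext s
    simp [gen]
  have h2 : labInner (0 : Lab 𝔥) 0 = 0 := by simp [labInner]
  rw [h1, propagator_const _ ht, h2, Complex.exp_zero, one_mul, drift, smul_smul,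
    mul_comm] at h
  simpa only [expVec_posVec_zero] using h

end UnitaryGroup

/-! ### From exponential vectors to powers -/

section Coefficients

variable {R : Type*} [NormedAddCommGroup R] [InnerProductSpace ℂ R]

/-- An identity between functionals of exponential vectors, read off degree by degree. -/
theorem apply_fockPow_of_expVec {Φ₀ Φ₁ Φ₂ : Fock R →L[ℂ] ℂ} {f : R}
    (h : ∀ z : ℂ, Φ₀ (expVec (z • f)) = Φ₁ (expVec (z • f)) + z * Φ₂ (expVec (z • f))) (n : ℕ) :
    Φ₀ (fockPow n f) = Φ₁ (fockPow n f) + Real.sqrt n * Φ₂ (fockPow (n - 1) f) := by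
  have h2 : ∀ z, HasSum (fun n : ℕ => z ^ n * ((Real.sqrt n.factorial : ℂ)⁻¹ *
      (Real.sqrt n * Φ₂ (fockPow (n - 1) f)))) (z * Φ₂ (expVec (z • f))) := fun z => by
    rw [← hasSum_nat_add_iff' 1]
    have h3 := (hasSum_apply_expVec_smul Φ₂ z f).mul_left z
    simp only [Finset.range_one, Finset.sum_singleton, Nat.cast_zero, Real.sqrt_zero,
      Complex.ofReal_zero, zero_mul, mul_zero, sub_zero]
    refine h3.congr_fun fun n => ?_
    have h4 : (Real.sqrt (n + 1).factorial : ℂ) = Real.sqrt (n + 1 : ℕ) * Real.sqrt n.factorial := by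
      rw [Nat.factorial_succ, Nat.cast_mul, Real.sqrt_mul (by positivity), Complex.ofReal_mul]
    have h5 : (Real.sqrt (n + 1 : ℕ) : ℂ) ≠ 0 := by
      exact_mod_cast (Real.sqrt_pos.2 (by positivity : (0 : ℝ) < ((n + 1 : ℕ) : ℝ))).ne'
    rw [h4, Nat.add_sub_cancel, mul_inv, pow_succ]
    field_simp
  have h3 := eq_of_hasSum_pow (hasSum_apply_expVec_smul Φ₀ · f)
    (b := fun n => (Real.sqrt n.factorial : ℂ)⁻¹ * (Φ₁ (fockPow n f) +
      Real.sqrt n * Φ₂ (fockPow (n - 1) f))) fun z => by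
        rw [h]
        refine ((hasSum_apply_expVec_smul Φ₁ z f).add (h2 z)).congr_fun fun n => ?_
        ring
  have hn : (Real.sqrt n.factorial : ℂ)⁻¹ ≠ 0 := by
    have : (0 : ℝ) < n.factorial := by exact_mod_cast n.factorial_pos
    simpa using (Real.sqrt_pos.2 this).ne'
  exact mul_left_cancel₀ hn (congrFun h3 n)

/-- Integration of a pointwise continuous family of functionals. It is bounded by the uniform
boundedness principle. -/
theorem exists_integral_functional {F : Type*} [NormedAddCommGroup F] [NormedSpace ℂ F]
    [CompleteSpace F] {T : ℝ → F →L[ℂ] ℂ} (hT : ∀ x, Continuous fun s => T s x) {t : ℝ}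
    (ht : 0 ≤ t) : ∃ Φ : F →L[ℂ] ℂ, ∀ x, Φ x = ∫ s in 0..t, T s x := by
  obtain ⟨M, hM⟩ := banach_steinhaus (g := fun s : Set.Icc (0 : ℝ) t => T s) fun x => by
    obtain ⟨C, hC⟩ := isCompact_Icc.exists_bound_of_continuousOn (s := Set.Icc 0 t)
      (hT x).continuousOn
    exact ⟨C, fun s => hC s s.2⟩
  refine ⟨LinearMap.mkContinuous
    { toFun := fun x => ∫ s in 0..t, T s x
      map_add' := fun x y => by
        simp only [map_add]
        exact intervalIntegral.integral_add ((hT x).intervalIntegrable _ _)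
          ((hT y).intervalIntegrable _ _)
      map_smul' := fun c x => by
        simp only [map_smul, RingHom.id_apply]
        exact intervalIntegral.integral_smul _ _ } (M * t) fun x => ?_, fun x => rfl⟩
  have := intervalIntegral.norm_integral_le_of_norm_le_const (a := 0) (b := t)
    (f := fun s => T s x) (C := M * ‖x‖) fun s hs => by
      rw [Set.uIoc_of_le ht] at hs
      exact (T s).le_of_opNorm_le (hM ⟨s, hs.1.le, hs.2⟩) x
  rw [sub_zero, abs_of_nonneg ht] at this
  calc _ ≤ M * ‖x‖ * t := this
    _ = M * t * ‖x‖ := by ring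

end Coefficients

/-! ### The evolution equation on the algebraic domain -/

section Equation

variable {K 𝔥 : Type*} [NormedAddCommGroup K] [InnerProductSpace ℂ K]
  [FiniteDimensional ℂ K] [CompleteSpace K]
  [NormedAddCommGroup 𝔥] [InnerProductSpace ℂ 𝔥] [CompleteSpace 𝔥]

theorem inclD_algPow (k : K) (n : ℕ) (f : DomX 𝔥) :
    inclD K 𝔥 (k ⊗ₜ[ℂ] algPow n f) = k ⊗ₜ[ℂ] fockPow n f.1 := by
  rw [inclD, LinearMap.lTensor_tmul, LinearMap.comp_apply, secondQuant_algPow, fockIncl_algPow]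
  rfl

theorem freeD_algPow (t : ℝ) (k : K) (n : ℕ) (f : DomX 𝔥) :
    freeD K 𝔥 t (k ⊗ₜ[ℂ] algPow n f) = k ⊗ₜ[ℂ] algPow n (expX t f) := by
  rw [freeD, LinearMap.lTensor_tmul, secondQuant_algPow]

theorem inclD_freeD (t : ℝ) (ψ : AlgDom K 𝔥) :
    inclD K 𝔥 (freeD K 𝔥 t ψ) = freeU K 𝔥 t (inclD K 𝔥 ψ) := by
  induction ψ using algPow_induction with
  | h0 => simp only [map_zero]
  | hadd x y hx hy => simp only [map_add, hx, hy]
  | h k n f =>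
    rw [freeD_algPow, inclD_algPow, inclD_algPow, freeU_tmul, freeFock_fockPow]
    rfl

theorem braOne_expX_eq (s : ℝ) (f : DomX 𝔥) :
    braOne (expX (-s) f) = (Real.sqrt (2 * Real.pi) : ℂ) • fhat f s := by
  rw [fhat, smul_smul, mul_inv_cancel₀ coe_sqrt_two_pi_ne_zero, one_smul]

/-- Annihilation lowers the degree and produces the value of the Fourier transform at time `s`. For
`n = 0` the factor `√n` vanishes, so that the truncated difference `n - 1` does not matter. -/
theorem annihExp_algPow (s : ℝ) (b : 𝔥) (k : K) (n : ℕ) (f : DomX 𝔥) :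
    annihExp K s b (k ⊗ₜ[ℂ] algPow n f)
      = ((Real.sqrt n : ℂ) * (Real.sqrt (2 * Real.pi) * ⟪b, fhat f s⟫_ℂ)) •
        (k ⊗ₜ[ℂ] algPow (n - 1) f) := by
  cases n with
  | zero => rw [annihExp, annih_algPow_zero]; simp
  | succ n =>
    rw [annihExp, annih_algPow_succ]
    simp only [LinearMap.comp_apply, LinearMap.lTensor_tmul, LinearEquiv.coe_coe,
      TensorProduct.rid_tmul, braOne_expX_eq, innerₛₗ_apply_apply, inner_smul_right,
      ← TensorProduct.smul_tmul', smul_smul, Nat.add_sub_cancel, Nat.cast_add, Nat.cast_one]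

theorem denseRange_inclD : DenseRange (inclD K 𝔥) := by
  have h : Total fun p : K × ℕ × DomX 𝔥 => p.1 ⊗ₜ[ℂ] fockPow p.2.1 p.2.2.1 :=
    (total_fockPow (denseRange_domX (𝔥 := 𝔥))).tmul
  have h1 : Submodule.span ℂ (Set.range fun p : K × ℕ × DomX 𝔥 => p.1 ⊗ₜ[ℂ] fockPow p.2.1 p.2.2.1)
      ≤ LinearMap.range (inclD K 𝔥) := Submodule.span_le.2 (by
    rintro _ ⟨⟨k, n, f⟩, rfl⟩
    exact ⟨k ⊗ₜ[ℂ] algPow n f, inclD_algPow k n f⟩)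
  intro x
  rw [← LinearMap.coe_range]
  exact closure_mono h1 (h x)

theorem continuous_inclD_annihExp (b : 𝔥) (φ : AlgDom K 𝔥) :
    Continuous fun s => inclD K 𝔥 (annihExp K s b φ) := by
  induction φ using algPow_induction with
  | h0 => simp only [map_zero]; exact continuous_const
  | hadd x y hx hy => simp only [map_add]; exact hx.add hy
  | h k n f =>
    simp only [annihExp_algPow, map_smul]
    have := continuous_fhat f
    fun_prop

variable [FiniteDimensional ℂ 𝔥] {E : K →L[ℂ] K} {ν : K →L[ℂ] K ⊗[ℂ] 𝔥}
  {V : ℝ → TotalSpace K 𝔥 →L[ℂ] TotalSpace K 𝔥}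

/-- The integrated equation between exponential vectors. -/
theorem IsCocycle.inner_expVec (hV : IsCocycle E ν V) {t : ℝ} (ht : 0 ≤ t) (k' k : K)
    (p q : Lab 𝔥) :
    ⟪k' ⊗ₜ[ℂ] expVec (posVec p), V t (k ⊗ₜ[ℂ] expVec (posVec q))⟫_ℂ
      = ⟪k' ⊗ₜ[ℂ] expVec (posVec p), k ⊗ₜ[ℂ] expVec (posVec q)⟫_ℂ
        + ∫ s in 0..t, ⟪(gen (drift E ν) (noiseCoef ν) (stdOrthonormalBasis ℂ 𝔥) p q s).adjoint k'
          ⊗ₜ[ℂ] expVec (posVec p), V s (k ⊗ₜ[ℂ] expVec (posVec q))⟫_ℂ := by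
  obtain ⟨M, hM⟩ := exists_isBddGen (Y := drift E ν) (L := noiseCoef ν)
    (b := stdOrthonormalBasis ℂ 𝔥) p q
  set G := gen (drift E ν) (noiseCoef ν) (stdOrthonormalBasis ℂ 𝔥) p q
  have h1 : ∀ s ∈ Set.uIcc 0 t, ⟪(G s).adjoint k' ⊗ₜ[ℂ] expVec (posVec p),
      V s (k ⊗ₜ[ℂ] expVec (posVec q))⟫_ℂ
        = Complex.exp (labInner p q) * ⟪k', (G s * propagator G 0 s) k⟫_ℂ := fun s hs => by
    rw [Set.uIcc_of_le ht] at hs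
    have := hV s hs.1 ((G s).adjoint k') k p q
    refine this.trans ?_
    rw [ContinuousLinearMap.adjoint_inner_left]
    rfl
  rw [intervalIntegral.integral_congr h1, intervalIntegral.integral_const_mul]
  have h2 : IntervalIntegrable (fun s => G s * propagator G 0 s) volume 0 t :=
    hM.intervalIntegrable_mul ht (continuousOn_propagator hM ht)
  let ℓ : (K →L[ℂ] K) →L[ℂ] ℂ := (innerSL ℂ k') ∘L (ContinuousLinearMap.apply ℂ K k)
  have h3 : ∫ s in 0..t, ⟪k', (G s * propagator G 0 s) k⟫_ℂ
      = ⟪k', (∫ s in 0..t, G s * propagator G 0 s) k⟫_ℂ := ℓ.intervalIntegral_comp_comm h2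
  have h4 : ⟪k' ⊗ₜ[ℂ] expVec (posVec p), k ⊗ₜ[ℂ] expVec (posVec q)⟫_ℂ
      = Complex.exp (labInner p q) * ⟪k', k⟫_ℂ := by
    rw [mul_comm, ← inner_expVec_posVec]
    exact TensorProduct.inner_tmul ..
  rw [h3, h4, ← mul_add, ← inner_add_right]
  refine (hV t ht k' k p q).trans ?_
  rw [propagator_eq hM ht]
  rfl


theorem coef_smul (ν : K →L[ℂ] K ⊗[ℂ] 𝔥) (z : ℂ) (x : 𝔥) :
    coef ν (z • x) = (starRingEnd ℂ) z • coef ν x := by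
  rw [(isDecomposition_coef ν (stdOrthonormalBasis ℂ 𝔥)).coef,
    (isDecomposition_coef ν (stdOrthonormalBasis ℂ 𝔥)).coef x, Finset.smul_sum]
  simp only [inner_smul_left, smul_smul]

theorem continuous_coef (ν : K →L[ℂ] K ⊗[ℂ] 𝔥) : Continuous (coef ν) := by
  have h := fun x => (isDecomposition_coef ν (stdOrthonormalBasis ℂ 𝔥)).coef x
  rw [funext h]
  fun_prop

theorem adjoint_gen_apply (E : K →L[ℂ] K) (ν : K →L[ℂ] K ⊗[ℂ] 𝔥) (p q : Lab 𝔥) (s : ℝ) (k : K) :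
    (gen (drift E ν) (noiseCoef ν) (stdOrthonormalBasis ℂ 𝔥) p q s).adjoint k
      = Complex.I • (upsilon E ν).adjoint k + Complex.I • (coef ν (p.1 s)).adjoint k
        + Complex.I • coef ν (q.1 s) k := by
  rw [gen_eq_coef, map_smulₛₗ, map_add, map_add, ContinuousLinearMap.adjoint_adjoint, map_neg,
    Complex.conj_I, neg_neg, smul_apply, add_apply,
    add_apply, smul_add, smul_add]

theorem fhatLab_smul_apply (z : ℂ) (f : DomX 𝔥) (s : ℝ) : fhat (z • f) s = z • fhat f s := by
  rw [fhat, fhat, map_smul, map_smul, smul_comm]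

theorem continuous_tmul {X F : Type*} [TopologicalSpace X] [NormedAddCommGroup F]
    [InnerProductSpace ℂ F] {κ : X → K} (hκ : Continuous κ) (x : F) :
    Continuous fun s => κ s ⊗ₜ[ℂ] x :=
  (((TensorProduct.mkL ℂ K F).flip x).continuous).comp hκ

/-- The integrated equation between an exponential vector and a power. -/
theorem IsCocycle.inner_expVec_fockPow (hV : IsCocycle E ν V) (hVc : ∀ x, Continuous fun s => V s x)
    {t : ℝ} (ht : 0 ≤ t) (k' k : K) (f g : DomX 𝔥) (m : ℕ) :
    ⟪k' ⊗ₜ[ℂ] expVec f.1, V t (k ⊗ₜ[ℂ] fockPow m g.1)⟫_ℂ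
      = ⟪k' ⊗ₜ[ℂ] expVec f.1, k ⊗ₜ[ℂ] fockPow m g.1⟫_ℂ
        + (∫ s in 0..t, ⟪(Complex.I • (upsilon E ν).adjoint k' +
            Complex.I • (coef ν (fhat f s)).adjoint k') ⊗ₜ[ℂ] expVec f.1,
            V s (k ⊗ₜ[ℂ] fockPow m g.1)⟫_ℂ)
        + Real.sqrt m * ∫ s in 0..t, ⟪(Complex.I • coef ν (fhat g s) k') ⊗ₜ[ℂ] expVec f.1,
            V s (k ⊗ₜ[ℂ] fockPow (m - 1) g.1)⟫_ℂ := by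
  have hcf := continuous_fhat f
  have hcg := continuous_fhat g
  have hcoef := continuous_coef ν
  let T : (ℝ → K) → ℝ → Fock (OneParticle 𝔥) →L[ℂ] ℂ := fun κ s =>
    innerSL ℂ (κ s ⊗ₜ[ℂ] expVec f.1) ∘L V s ∘L TensorProduct.mkL ℂ K _ k
  have hT : ∀ κ : ℝ → K, Continuous κ → ∀ x, Continuous fun s => T κ s x := fun κ hκ x =>
    (continuous_tmul hκ _).inner (hVc _)
  let κ₁ : ℝ → K := fun s => Complex.I • (upsilon E ν).adjoint k' +
    Complex.I • (coef ν (fhat f s)).adjoint k'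
  let κ₂ : ℝ → K := fun s => Complex.I • coef ν (fhat g s) k'
  have hκ₁ : Continuous κ₁ := by
    have h : Continuous fun s => (coef ν (fhat f s)).adjoint :=
      (ContinuousLinearMap.adjoint (𝕜 := ℂ) (E := K) (F := K)).continuous.comp (hcoef.comp hcf)
    fun_prop
  have hκ₂ : Continuous κ₂ := by fun_prop
  obtain ⟨Φ₁, hΦ₁⟩ := exists_integral_functional (hT κ₁ hκ₁) ht
  obtain ⟨Φ₂, hΦ₂⟩ := exists_integral_functional (hT κ₂ hκ₂) ht
  let Φ₀ : Fock (OneParticle 𝔥) →L[ℂ] ℂ :=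
    innerSL ℂ (k' ⊗ₜ[ℂ] expVec f.1) ∘L TensorProduct.mkL ℂ K _ k
  let Φt : Fock (OneParticle 𝔥) →L[ℂ] ℂ :=
    innerSL ℂ (k' ⊗ₜ[ℂ] expVec f.1) ∘L V t ∘L TensorProduct.mkL ℂ K _ k
  have key := apply_fockPow_of_expVec (Φ₀ := Φt) (Φ₁ := Φ₀ + Φ₁) (Φ₂ := Φ₂) (f := g.1) (fun w => by
    have h := hV.inner_expVec ht k' k (fhatLab f) (fhatLab (w • g))
    simp only [posVec_fhatLab] at h
    have h1 : ∀ s, ⟪(gen (drift E ν) (noiseCoef ν) (stdOrthonormalBasis ℂ 𝔥) (fhatLab f)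
        (fhatLab (w • g)) s).adjoint k' ⊗ₜ[ℂ] expVec f.1, V s (k ⊗ₜ[ℂ] expVec (w • g).1)⟫_ℂ
          = T κ₁ s (expVec (w • g).1) + w * T κ₂ s (expVec (w • g).1) := fun s => by
      rw [adjoint_gen_apply]
      change ⟪(κ₁ s + Complex.I • coef ν (fhat (w • g) s) k') ⊗ₜ[ℂ] expVec f.1, _⟫_ℂ = _
      rw [fhatLab_smul_apply, coef_smul, TensorProduct.add_tmul, inner_add_left, smul_apply,
        smul_comm, ← TensorProduct.smul_tmul']
      refine congrArg _ ((inner_smul_left (𝕜 := ℂ) (E := TotalSpace K 𝔥) _ _ _).trans ?_)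
      rw [Complex.conj_conj]
      rfl
    simp only [h1] at h
    rw [intervalIntegral.integral_add ((hT κ₁ hκ₁ _).intervalIntegrable _ _)
      (((hT κ₂ hκ₂ _).const_mul w).intervalIntegrable _ _), intervalIntegral.integral_const_mul,
      ← hΦ₁, ← hΦ₂, ← add_assoc] at h
    exact h) m
  rw [add_apply, hΦ₁, hΦ₂] at key
  exact key

/-- The integrated equation between powers. -/
theorem IsCocycle.inner_fockPow (hV : IsCocycle E ν V) (hVc : ∀ x, Continuous fun s => V s x)
    {t : ℝ} (ht : 0 ≤ t) (k' k : K) (f g : DomX 𝔥) (n m : ℕ) :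
    ⟪V t (k ⊗ₜ[ℂ] fockPow m g.1), k' ⊗ₜ[ℂ] fockPow n f.1⟫_ℂ
      = ⟪k ⊗ₜ[ℂ] fockPow m g.1, k' ⊗ₜ[ℂ] fockPow n f.1⟫_ℂ
        + (∫ s in 0..t, ⟪V s (k ⊗ₜ[ℂ] fockPow m g.1),
            (Complex.I • (upsilon E ν).adjoint k') ⊗ₜ[ℂ] fockPow n f.1⟫_ℂ)
        + Real.sqrt m * (∫ s in 0..t, ⟪V s (k ⊗ₜ[ℂ] fockPow (m - 1) g.1),
            (Complex.I • coef ν (fhat g s) k') ⊗ₜ[ℂ] fockPow n f.1⟫_ℂ)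
        + Real.sqrt n * ∫ s in 0..t, ⟪V s (k ⊗ₜ[ℂ] fockPow m g.1),
            (Complex.I • (coef ν (fhat f s)).adjoint k') ⊗ₜ[ℂ] fockPow (n - 1) f.1⟫_ℂ := by
  have hcf := continuous_fhat f
  have hcg := continuous_fhat g
  have hcoef := continuous_coef ν
  let T : TotalSpace K 𝔥 → (ℝ → K) → ℝ → Fock (OneParticle 𝔥) →L[ℂ] ℂ := fun x κ s =>
    innerSL ℂ (V s x) ∘L TensorProduct.mkL ℂ K _ (κ s)
  have hT : ∀ x, ∀ κ : ℝ → K, Continuous κ → ∀ y, Continuous fun s => T x κ s y := fun x κ hκ y =>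
    (hVc _).inner (continuous_tmul hκ _)
  let κ₁ : ℝ → K := fun s => Complex.I • (upsilon E ν).adjoint k'
  let κ₂ : ℝ → K := fun s => Complex.I • coef ν (fhat g s) k'
  let κ₃ : ℝ → K := fun s => Complex.I • (coef ν (fhat f s)).adjoint k'
  have hκ₁ : Continuous κ₁ := continuous_const
  have hκ₂ : Continuous κ₂ := by fun_prop
  have hκ₃ : Continuous κ₃ := by
    have h : Continuous fun s => (coef ν (fhat f s)).adjoint :=
      (ContinuousLinearMap.adjoint (𝕜 := ℂ) (E := K) (F := K)).continuous.comp (hcoef.comp hcf)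
    fun_prop
  set x := k ⊗ₜ[ℂ] fockPow m g.1 with hx
  set x' := k ⊗ₜ[ℂ] fockPow (m - 1) g.1 with hx'
  obtain ⟨Φ₁, hΦ₁⟩ := exists_integral_functional (hT x κ₁ hκ₁) ht
  obtain ⟨Φ₂, hΦ₂⟩ := exists_integral_functional (hT x' κ₂ hκ₂) ht
  obtain ⟨Φ₃, hΦ₃⟩ := exists_integral_functional (hT x κ₃ hκ₃) ht
  let Φ₀ : Fock (OneParticle 𝔥) →L[ℂ] ℂ := innerSL ℂ x ∘L TensorProduct.mkL ℂ K _ k'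
  let Φt : Fock (OneParticle 𝔥) →L[ℂ] ℂ := innerSL ℂ (V t x) ∘L TensorProduct.mkL ℂ K _ k'
  have key := apply_fockPow_of_expVec (Φ₀ := Φt) (Φ₁ := Φ₀ + Φ₁ + (Real.sqrt m : ℂ) • Φ₂) (Φ₂ := Φ₃)
    (f := f.1) (fun z => by
    have h := congrArg (starRingEnd ℂ) (hV.inner_expVec_fockPow hVc ht k' k (z • f) g m)
    have hconj : ∀ a b : TotalSpace K 𝔥, (starRingEnd ℂ) ⟪a, b⟫_ℂ = ⟪b, a⟫_ℂ := fun a b =>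
      inner_conj_symm (𝕜 := ℂ) (E := TotalSpace K 𝔥) _ _
    have hint : ∀ u : ℝ → ℂ, (starRingEnd ℂ) (∫ s in 0..t, u s)
        = ∫ s in 0..t, (starRingEnd ℂ) (u s) := fun u => by
      rw [intervalIntegral.intervalIntegral_conj]
    rw [map_add, map_add, map_mul, hint, hint, Complex.conj_ofReal] at h
    simp only [hconj] at h
    have h1 : ∀ s, ⟪V s x, (Complex.I • (upsilon E ν).adjoint k' +
            Complex.I • (coef ν (fhat (z • f) s)).adjoint k') ⊗ₜ[ℂ] expVec (z • f).1⟫_ℂ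
          = T x κ₁ s (expVec (z • f).1) + z * T x κ₃ s (expVec (z • f).1) := fun s => by
      rw [fhatLab_smul_apply, coef_smul, map_smulₛₗ, Complex.conj_conj, smul_apply, smul_comm,
        TensorProduct.add_tmul, inner_add_right, ← TensorProduct.smul_tmul' z]
      exact congrArg _ (inner_smul_right (𝕜 := ℂ) (E := TotalSpace K 𝔥) _ _ _)
    simp only [← hx, ← hx', h1] at h
    rw [intervalIntegral.integral_add ((hT x κ₁ hκ₁ _).intervalIntegrable _ _)
      (((hT x κ₃ hκ₃ _).const_mul z).intervalIntegrable _ _), intervalIntegral.integral_const_mul,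
      ← hΦ₁, ← hΦ₃] at h
    have h2 := hΦ₂ (expVec (z • f).1)
    change _ = ∫ s in 0..t, ⟪V s x', κ₂ s ⊗ₜ[ℂ] expVec (z • f).1⟫_ℂ at h2
    rw [← h2] at h
    change ⟪V t x, k' ⊗ₜ[ℂ] expVec (z • f).1⟫_ℂ = (⟪x, k' ⊗ₜ[ℂ] expVec (z • f).1⟫_ℂ
      + Φ₁ (expVec (z • f).1) + Real.sqrt m * Φ₂ (expVec (z • f).1)) + z * Φ₃ (expVec (z • f).1)
    rw [h]
    ring) n
  rw [add_apply, add_apply, smul_apply, hΦ₁, hΦ₂, hΦ₃] at key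
  exact key

end Equation

/-! ### The evolution equation as a form -/

section Rate

variable {K 𝔥 : Type*} [NormedAddCommGroup K] [InnerProductSpace ℂ K]
  [FiniteDimensional ℂ K] [CompleteSpace K]
  [NormedAddCommGroup 𝔥] [InnerProductSpace ℂ 𝔥] [CompleteSpace 𝔥] [FiniteDimensional ℂ 𝔥]
  {J : Type*} [Fintype J]

/-- `inner_smul_left` with the instances of `TotalSpace` fixed, for use in rewriting. -/
theorem inner_smul_total_left (c : ℂ) (x y : TotalSpace K 𝔥) :
    ⟪c • x, y⟫_ℂ = (starRingEnd ℂ) c * ⟪x, y⟫_ℂ := inner_smul_left (𝕜 := ℂ) (E := TotalSpace K 𝔥) _ _ _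

/-- `inner_smul_right` with the instances of `TotalSpace` fixed, for use in rewriting. -/
theorem inner_smul_total_right (c : ℂ) (x y : TotalSpace K 𝔥) :
    ⟪x, c • y⟫_ℂ = c * ⟪x, y⟫_ℂ := inner_smul_right (𝕜 := ℂ) (E := TotalSpace K 𝔥) _ _ _

/-- `inner_conj_symm` with the instances of `TotalSpace` fixed, for use in rewriting. -/
theorem conj_inner_total (x y : TotalSpace K 𝔥) : (starRingEnd ℂ) ⟪x, y⟫_ℂ = ⟪y, x⟫_ℂ :=
  inner_conj_symm (𝕜 := ℂ) (E := TotalSpace K 𝔥) _ _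

/-- `S ⊗ 1` on the algebraic domain. -/
def kAct (S : K →L[ℂ] K) : Module.End ℂ (AlgDom K 𝔥) :=
  LinearMap.rTensor (AlgFock (DomX 𝔥)) S.toLinearMap

@[simp]
theorem kAct_tmul (S : K →L[ℂ] K) (k : K) (x : AlgFock (DomX 𝔥)) :
    kAct S (k ⊗ₜ[ℂ] x) = S k ⊗ₜ[ℂ] x := rfl

theorem inclD_kAct (S : K →L[ℂ] K) (ψ : AlgDom K 𝔥) :
    inclD K 𝔥 (kAct S ψ) = ampl _ S (inclD K 𝔥 ψ) := by
  induction ψ using TensorProduct.induction_on with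
  | zero => simp only [map_zero]
  | add x y hx hy => simp only [map_add, hx, hy]
  | tmul k x => rfl

theorem annihExp_kAct (s : ℝ) (b : 𝔥) (S : K →L[ℂ] K) (ψ : AlgDom K 𝔥) :
    annihExp K s b (kAct S ψ) = kAct S (annihExp K s b ψ) := by
  induction ψ using algPow_induction with
  | h0 => simp only [map_zero]
  | hadd x y hx hy => simp only [map_add, hx, hy]
  | h k n f => simp only [kAct_tmul, annihExp_algPow, map_smul]

/-- The expression for `i ∂ₛ ⟪ψ, V s φ⟫` when `V` is the cocycle. -/
def rate (E : K →L[ℂ] K) (ν : K →L[ℂ] K ⊗[ℂ] 𝔥) (C : J → K →L[ℂ] K) (b : J → 𝔥)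
    (V : ℝ → TotalSpace K 𝔥 →L[ℂ] TotalSpace K 𝔥) (ψ φ : AlgDom K 𝔥) (s : ℝ) : ℂ :=
  ⟪inclD K 𝔥 ψ, ampl _ (upsilon E ν) (V s (inclD K 𝔥 φ))⟫_ℂ
    + (Real.sqrt (2 * Real.pi) : ℂ)⁻¹ * ∑ j,
      (⟪inclD K 𝔥 (annihExp K s (b j) ψ), ampl _ (C j) (V s (inclD K 𝔥 φ))⟫_ℂ
        + ⟪inclD K 𝔥 ψ, ampl _ (C j).adjoint (V s (inclD K 𝔥 (annihExp K s (b j) φ)))⟫_ℂ)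

variable {E : K →L[ℂ] K} {ν : K →L[ℂ] K ⊗[ℂ] 𝔥} {C : J → K →L[ℂ] K} {b : J → 𝔥}
  {V : ℝ → TotalSpace K 𝔥 →L[ℂ] TotalSpace K 𝔥}

theorem rate_add_left (ψ ψ' φ : AlgDom K 𝔥) (s : ℝ) :
    rate E ν C b V (ψ + ψ') φ s = rate E ν C b V ψ φ s + rate E ν C b V ψ' φ s := by
  simp only [rate, map_add, inner_add_left, Finset.sum_add_distrib]
  ring

theorem rate_add_right (ψ φ φ' : AlgDom K 𝔥) (s : ℝ) :
    rate E ν C b V ψ (φ + φ') s = rate E ν C b V ψ φ s + rate E ν C b V ψ φ' s := by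
  simp only [rate, map_add, inner_add_right, Finset.sum_add_distrib]
  ring

/-- Isometries that depend strongly continuously on time may be applied to continuous paths. -/
theorem continuous_apply_of_isometry {H : Type*} [NormedAddCommGroup H] [InnerProductSpace ℂ H]
    {V : ℝ → H →L[ℂ] H} (hVc : ∀ x, Continuous fun s => V s x) (hVn : ∀ s x, ‖V s x‖ = ‖x‖)
    {u : ℝ → H} (hu : Continuous u) : Continuous fun s => V s (u s) := by
  rw [continuous_iff_continuousAt]
  intro s
  rw [ContinuousAt, tendsto_iff_norm_sub_tendsto_zero]
  have h1 := tendsto_iff_norm_sub_tendsto_zero.1 (hu.tendsto s)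
  have h2 := tendsto_iff_norm_sub_tendsto_zero.1 ((hVc (u s)).tendsto s)
  have h3 := h1.add h2
  rw [add_zero] at h3
  refine squeeze_zero (fun _ => norm_nonneg _) (fun r => ?_) h3
  have h4 : V r (u r) - V s (u s) = V r (u r - u s) + (V r (u s) - V s (u s)) := by
    rw [map_sub]; abel
  rw [h4]
  exact (norm_add_le _ _).trans (by rw [hVn])

theorem continuous_rate (hVc : ∀ x, Continuous fun s => V s x) (hVn : ∀ s x, ‖V s x‖ = ‖x‖)
    (ψ φ : AlgDom K 𝔥) : Continuous (rate E ν C b V ψ φ) := by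
  have h1 := fun j => continuous_inclD_annihExp (b j) ψ
  have h2 := fun j => continuous_apply_of_isometry hVc hVn (continuous_inclD_annihExp (b j) φ)
  have h3 := hVc (inclD K 𝔥 φ)
  exact (continuous_const.inner ((ampl _ _).continuous.comp h3)).add
    (continuous_const.mul (continuous_finsetSum _ fun j _ =>
      ((h1 j).inner ((ampl _ _).continuous.comp h3)).add
        (continuous_const.inner ((ampl _ _).continuous.comp (h2 j)))))

/-- The annihilation part of the noise, which depends on the decomposition only through `ν`. -/
theorem sum_ampl_annihExp (h : IsDecomposition ν C b) (s : ℝ) (k : K) (n : ℕ) (f : DomX 𝔥) :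
    (Real.sqrt (2 * Real.pi) : ℂ)⁻¹ • ∑ j, ampl _ (C j).adjoint
        (inclD K 𝔥 (annihExp K s (b j) (k ⊗ₜ[ℂ] algPow n f)))
      = (Real.sqrt n : ℂ) • ((coef ν (fhat f s)).adjoint k ⊗ₜ[ℂ] fockPow (n - 1) f.1) := by
  simp only [annihExp_algPow, map_smul, inclD_algPow, ampl_tmul]
  rw [h.adjoint_coef, sum_apply, TensorProduct.sum_tmul, Finset.smul_sum, Finset.smul_sum]
  refine Finset.sum_congr rfl fun j _ => ?_
  rw [smul_apply, ← TensorProduct.smul_tmul', smul_smul, smul_smul]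
  congr 1
  field_simp [coe_sqrt_two_pi_ne_zero]

/-- The creation part of the noise, moved to the left-hand vector; it too depends on the
decomposition only through `ν`. -/
theorem sum_inner_annihExp (h : IsDecomposition ν C b) (s : ℝ) (k : K) (n : ℕ) (f : DomX 𝔥)
    (T : TotalSpace K 𝔥 →L[ℂ] TotalSpace K 𝔥) (y : TotalSpace K 𝔥) :
    (Real.sqrt (2 * Real.pi) : ℂ)⁻¹ * ∑ j, ⟪T (inclD K 𝔥 (annihExp K s (b j) (k ⊗ₜ[ℂ] algPow n f))),
        ampl _ (C j) y⟫_ℂ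
      = (Real.sqrt n : ℂ) * ⟪T (k ⊗ₜ[ℂ] fockPow (n - 1) f.1), ampl _ (coef ν (fhat f s)) y⟫_ℂ := by
  have h1 : ampl (Fock (OneParticle 𝔥)) (coef ν (fhat f s)) y
      = ∑ j, ⟪fhat f s, b j⟫_ℂ • ampl _ (C j) y := by
    rw [h.coef]
    let ℓ : (K →L[ℂ] K) →ₗ[ℂ] TotalSpace K 𝔥 :=
      { toFun := fun S => ampl (Fock (OneParticle 𝔥)) S y
        map_add' := fun S T => by rw [ampl_add, add_apply]
        map_smul' := fun c S => by rw [ampl_smul]; rfl }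
    change ℓ _ = ∑ j, ⟪fhat f s, b j⟫_ℂ • ℓ (C j)
    rw [map_sum]
    exact Finset.sum_congr rfl fun j _ => map_smul ℓ _ _
  rw [h1, inner_sum, Finset.mul_sum, Finset.mul_sum]
  refine Finset.sum_congr rfl fun j _ => ?_
  simp only [annihExp_algPow, map_smul, inclD_algPow, inner_smul_total_left,
    inner_smul_total_right, map_mul, Complex.conj_ofReal, inner_conj_symm]
  field_simp [coe_sqrt_two_pi_ne_zero]

/-- The integrated evolution equation for the cocycle, as a form on the algebraic domain. -/
theorem IsCocycle.inner_inclD (hV : IsCocycle E ν V) (hVc : ∀ x, Continuous fun s => V s x)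
    (hVn : ∀ s x, ‖V s x‖ = ‖x‖) (h : IsDecomposition ν C b) {t : ℝ} (ht : 0 ≤ t)
    (ψ φ : AlgDom K 𝔥) :
    ⟪inclD K 𝔥 ψ, V t (inclD K 𝔥 φ)⟫_ℂ = ⟪inclD K 𝔥 ψ, inclD K 𝔥 φ⟫_ℂ
      + ∫ s in 0..t, -Complex.I * rate E ν C b V ψ φ s := by
  have hc : ∀ ψ φ : AlgDom K 𝔥, IntervalIntegrable (fun s => -Complex.I * rate E ν C b V ψ φ s)
      volume 0 t := fun ψ φ => ((continuous_rate hVc hVn ψ φ).const_mul _).intervalIntegrable _ _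
  induction ψ using algPow_induction with
  | h0 => simp [rate]
  | hadd x y hx hy =>
    simp only [map_add, inner_add_left, rate_add_left, mul_add]
    rw [intervalIntegral.integral_add (hc _ _) (hc _ _), hx, hy]
    ring
  | h k' n f =>
    induction φ using algPow_induction with
    | h0 => simp [rate]
    | hadd x y hx hy =>
      simp only [map_add, inner_add_right, rate_add_right, mul_add]
      rw [intervalIntegral.integral_add (hc _ _) (hc _ _), hx, hy]
      ring
    | h k m g =>
      have key := hV.inner_fockPow hVc ht k' k f g n m
      have hcoef := continuous_coef ν
      have hcf := continuous_fhat f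
      have hcg := continuous_fhat g
      have hint : ∀ (x : TotalSpace K 𝔥) (κ : ℝ → K) (y : Fock (OneParticle 𝔥)), Continuous κ →
          IntervalIntegrable (fun s => ⟪V s x, κ s ⊗ₜ[ℂ] y⟫_ℂ) volume 0 t := fun x κ y hκ =>
        ((hVc x).inner (continuous_tmul hκ y)).intervalIntegrable _ _
      have hadj : Continuous fun s => (coef ν (fhat f s)).adjoint :=
        (ContinuousLinearMap.adjoint (𝕜 := ℂ) (E := K) (F := K)).continuous.comp (hcoef.comp hcf)
      rw [← intervalIntegral.integral_const_mul, ← intervalIntegral.integral_const_mul,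
        add_assoc, add_assoc, ← intervalIntegral.integral_add
          ((hint _ _ _ (by fun_prop)).const_mul _) ((hint _ _ _ (by fun_prop)).const_mul _),
        ← intervalIntegral.integral_add (hint _ _ _ (by fun_prop))
          (((hint _ _ _ (by fun_prop)).const_mul _).add ((hint _ _ _ (by fun_prop)).const_mul _))] at key
      have h2 := congrArg (starRingEnd ℂ) key
      rw [map_add, conj_inner_total, conj_inner_total, ← intervalIntegral.intervalIntegral_conj] at h2
      rw [inclD_algPow, inclD_algPow, h2]
      congr 1
      refine intervalIntegral.integral_congr fun s _ => ?_
      have h3 : rate E ν C b V (k' ⊗ₜ[ℂ] algPow n f) (k ⊗ₜ[ℂ] algPow m g) s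
          = (starRingEnd ℂ) (⟪V s (k ⊗ₜ[ℂ] fockPow m g.1),
              (upsilon E ν).adjoint k' ⊗ₜ[ℂ] fockPow n f.1⟫_ℂ
            + (Real.sqrt m * ⟪V s (k ⊗ₜ[ℂ] fockPow (m - 1) g.1),
              coef ν (fhat g s) k' ⊗ₜ[ℂ] fockPow n f.1⟫_ℂ
            + Real.sqrt n * ⟪V s (k ⊗ₜ[ℂ] fockPow m g.1),
              (coef ν (fhat f s)).adjoint k' ⊗ₜ[ℂ] fockPow (n - 1) f.1⟫_ℂ)) := by
        rw [rate, ← ampl_tmul, ← ampl_tmul, ← sum_inner_annihExp h s k m g, ← inner_smul_total_right,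
          ← sum_ampl_annihExp h s k' n f]
        simp only [map_add, map_mul, map_sum, conj_inner_total, inner_smul_total_right, inner_sum, map_inv₀,
          Complex.conj_ofReal, Finset.sum_add_distrib, inclD_algPow]
        simp only [← ampl_adjoint, ContinuousLinearMap.adjoint_inner_left,
          ContinuousLinearMap.adjoint_inner_right]
        ring
      rw [h3]
      simp only [← TensorProduct.smul_tmul', inner_smul_total_right]
      simp only [map_add, map_mul, Complex.conj_I, Complex.conj_ofReal]
      ring

/-- The evolution equation for the cocycle, as a form on the algebraic domain. -/
theorem IsCocycle.hasDerivAt (hV : IsCocycle E ν V) (hVc : ∀ x, Continuous fun s => V s x)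
    (hVn : ∀ s x, ‖V s x‖ = ‖x‖) (h : IsDecomposition ν C b) {t : ℝ} (ht : 0 < t)
    (ψ φ : AlgDom K 𝔥) :
    HasDerivAt (fun s => ⟪inclD K 𝔥 ψ, V s (inclD K 𝔥 φ)⟫_ℂ)
      (-Complex.I * rate E ν C b V ψ φ t) t := by
  have hc : Continuous fun s => -Complex.I * rate E ν C b V ψ φ s :=
    (continuous_rate hVc hVn ψ φ).const_mul _
  have h1 := intervalIntegral.integral_hasDerivAt_right (hc.intervalIntegrable 0 t)
    (hc.stronglyMeasurableAtFilter _ _) hc.continuousAt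
  refine (h1.const_add ⟪inclD K 𝔥 ψ, inclD K 𝔥 φ⟫_ℂ).congr_of_eventuallyEq ?_
  filter_upwards [lt_mem_nhds ht] with s hs
  exact hV.inner_inclD hVc hVn h hs.le ψ φ

/-- The product rule for a differentiable path and a continuous, weakly differentiable one. -/
theorem hasDerivAt_inner_of_weak {H : Type*} [NormedAddCommGroup H] [InnerProductSpace ℂ H]
    {u v : ℝ → H} {u' : H} {d : ℂ} {s : ℝ} (hu : HasDerivAt u u' s) (hv : ContinuousAt v s)
    (hw : HasDerivAt (fun r => ⟪u s, v r⟫_ℂ) d s) :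
    HasDerivAt (fun r => ⟪u r, v r⟫_ℂ) (⟪u', v s⟫_ℂ + d) s := by
  have h1 : HasDerivAt (fun r => ⟪u r - u s, v r⟫_ℂ) ⟪u', v s⟫_ℂ s := by
    rw [hasDerivAt_iff_tendsto_slope] at hu ⊢
    have h2 : Tendsto (fun r => ⟪slope u s r, v r⟫_ℂ) (𝓝[≠] s) (𝓝 ⟪u', v s⟫_ℂ) :=
      hu.inner (hv.tendsto.mono_left nhdsWithin_le_nhds)
    refine h2.congr fun r => ?_
    rw [slope_def_module, slope_def_module, sub_self, inner_zero_left, sub_zero,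
      ← Complex.coe_smul, inner_smul_left, Complex.conj_ofReal, ← Complex.coe_smul, smul_eq_mul]
  refine (h1.add hw).congr_of_eventuallyEq (Eventually.of_forall fun r => ?_)
  change ⟪u r, v r⟫_ℂ = ⟪u r - u s, v r⟫_ℂ + ⟪u s, v r⟫_ℂ
  rw [inner_sub_left]
  ring

end Rate

/-! ### Integration over simplices -/

section Simplex

variable {n : ℕ} {t : ℝ}

theorem measurableSet_simplex (n : ℕ) (t : ℝ) : MeasurableSet (simplex n t) := by
  have h : simplex n t = (⋂ i, ⋂ j, ⋂ (_ : i < j), {τ : Fin n → ℝ | τ i < τ j})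
      ∩ ⋂ p, ({τ : Fin n → ℝ | 0 < τ p} ∩ {τ | τ p < t}) := by
    ext τ
    simp only [simplex, StrictMono, Set.mem_inter_iff, Set.mem_iInter, Set.mem_ofPred_eq]
  rw [h]
  refine MeasurableSet.inter (MeasurableSet.iInter fun i => MeasurableSet.iInter fun j =>
    MeasurableSet.iInter fun _ => measurableSet_lt (by fun_prop) (by fun_prop)) ?_
  exact MeasurableSet.iInter fun p => (measurableSet_lt (by fun_prop) (by fun_prop)).inter
    (measurableSet_lt (by fun_prop) (by fun_prop))

theorem Continuous.integrableOn_simplex {F : (Fin n → ℝ) → ℂ} (hF : Continuous F) (t : ℝ) :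
    IntegrableOn F (simplex n t) :=
  (hF.continuousOn.integrableOn_compact
    (isCompact_Icc (a := fun _ : Fin n => (0 : ℝ)) (b := fun _ => t))).mono_set
    fun _ hτ => ⟨fun p => (hτ.2 p).1.le, fun p => (hτ.2 p).2.le⟩

theorem snoc_mem_simplex {τ : Fin n → ℝ} {s : ℝ} :
    (Fin.snoc τ s : Fin (n + 1) → ℝ) ∈ simplex (n + 1) t ↔ s ∈ Set.Ioo 0 t ∧ τ ∈ simplex n s := by
  constructor
  · rintro ⟨hm, hb⟩
    have hs := hb (Fin.last n)
    rw [Fin.snoc_last] at hs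
    refine ⟨hs, fun i j hij => ?_, fun p => ⟨?_, ?_⟩⟩
    · have := hm (Fin.castSucc_lt_castSucc_iff.2 hij)
      simpa using this
    · have := (hb p.castSucc).1
      simpa using this
    · have := hm (Fin.castSucc_lt_last p)
      simpa using this
  · rintro ⟨hs, hm, hb⟩
    refine ⟨fun i j => ?_, fun p => ?_⟩
    · refine Fin.lastCases (fun hij => ?_) (fun j hij => ?_) j
      · obtain ⟨i, rfl⟩ := Fin.exists_castSucc_eq.2 hij.ne
        simpa using (hb i).2
      · obtain ⟨i, rfl⟩ := Fin.exists_castSucc_eq.2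
          (hij.trans (Fin.castSucc_lt_last j)).ne
        simpa using hm (Fin.castSucc_lt_castSucc_iff.1 hij)
    · refine Fin.lastCases ?_ (fun p => ?_) p
      · simpa using hs
      · simpa using ⟨(hb p).1, (hb p).2.trans hs.2⟩

theorem integral_simplex_zero (F : (Fin 0 → ℝ) → ℂ) (t : ℝ) :
    ∫ τ in simplex 0 t, F τ = F Fin.elim0 := by
  have h : simplex 0 t = Set.univ := Set.eq_univ_of_forall fun τ =>
    ⟨fun i => i.elim0, fun i => i.elim0⟩
  rw [h, setIntegral_univ, volume_pi, Measure.pi_of_empty (x := Fin.elim0), integral_dirac]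

/-- Integrating over the simplex by fixing the largest coordinate first. -/
theorem integral_simplex_succ {F : (Fin (n + 1) → ℝ) → ℂ} (hF : Continuous F) (ht : 0 ≤ t) :
    IntervalIntegrable (fun s => ∫ τ in simplex n s, F (Fin.snoc τ s)) volume 0 t ∧
    ∫ τ in simplex (n + 1) t, F τ = ∫ s in 0..t, ∫ τ in simplex n s, F (Fin.snoc τ s) := by
  let e := MeasurableEquiv.piFinSuccAbove (fun _ : Fin (n + 1) => ℝ) (Fin.last n)
  have he : MeasurePreserving e.symm (volume.prod volume) volume :=
    (volume_preserving_piFinSuccAbove (fun _ : Fin (n + 1) => ℝ) (Fin.last n)).symm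
  have hes : ∀ z : ℝ × (Fin n → ℝ), e.symm z = Fin.snoc z.2 z.1 := fun z =>
    Fin.insertNth_last' z.1 z.2
  let G := (simplex (n + 1) t).indicator F
  have hG : Integrable G := (integrable_indicator_iff (measurableSet_simplex _ _)).2
    (Continuous.integrableOn_simplex hF t)
  have hG' : Integrable (fun z : ℝ × (Fin n → ℝ) => G (e.symm z)) (volume.prod volume) :=
    (he.integrable_comp_emb e.symm.measurableEmbedding).2 hG
  have hin : ∀ s, ∫ τ, G (e.symm (s, τ))
      = (Set.Ioo 0 t).indicator (fun s => ∫ τ in simplex n s, F (Fin.snoc τ s)) s := fun s => by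
    by_cases hs : s ∈ Set.Ioo 0 t
    · rw [Set.indicator_of_mem hs, ← integral_indicator (measurableSet_simplex n s)]
      refine integral_congr_ae (Eventually.of_forall fun τ => ?_)
      simp only [hes, G]
      by_cases hτ : τ ∈ simplex n s
      · rw [Set.indicator_of_mem hτ, Set.indicator_of_mem (snoc_mem_simplex.2 ⟨hs, hτ⟩)]
      · rw [Set.indicator_of_notMem hτ,
          Set.indicator_of_notMem fun h => hτ (snoc_mem_simplex.1 h).2]
    · rw [Set.indicator_of_notMem hs]
      refine integral_eq_zero_of_ae (Eventually.of_forall fun τ => ?_)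
      simp only [hes, G]
      exact Set.indicator_of_notMem (fun h => hs (snoc_mem_simplex.1 h).1) _
  have h1 := hG'.integral_prod_left
  simp only [hin] at h1
  rw [integrable_indicator_iff measurableSet_Ioo] at h1
  refine ⟨?_, ?_⟩
  · rw [intervalIntegrable_iff_integrableOn_Ioo_of_le ht]
    exact h1
  · rw [← integral_indicator (measurableSet_simplex _ _), ← he.integral_comp
      e.symm.measurableEmbedding, integral_prod _ hG']
    simp only [hin]
    rw [integral_indicator measurableSet_Ioo, intervalIntegral.integral_of_le ht,
      integral_Ioc_eq_integral_Ioo]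

end Simplex

/-! ### The terms of the series -/

section Dyson

variable {K 𝔥 : Type*} [NormedAddCommGroup K] [InnerProductSpace ℂ K]
  [FiniteDimensional ℂ K] [CompleteSpace K]
  [NormedAddCommGroup 𝔥] [InnerProductSpace ℂ 𝔥] [CompleteSpace 𝔥] [FiniteDimensional ℂ 𝔥]
  {J : Type*} [Fintype J]

/-- The integrand of the series for the cocycle: `dysonIntegrand` without the free evolution. -/
def dysonForm (Y : K →L[ℂ] K) (C : J → K →L[ℂ] K) (b : J → 𝔥) (n : ℕ) (t : ℝ)
    (ψ φ : AlgDom K 𝔥) (τ : Fin n → ℝ) : ℂ :=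
  ∑ j : Fin n → J, ∑ ε : Fin n → Bool,
    (-Complex.I) ^ n * ((Real.sqrt (2 * Real.pi) : ℂ)⁻¹) ^ n *
      ⟪inclD K 𝔥 (annihProd τ (b ∘ j) ε true ψ),
        ampl _ (word Y n τ (fun p => signed (C (j p)) (ε p)) t)
          (inclD K 𝔥 (annihProd τ (b ∘ j) ε false φ))⟫_ℂ

theorem dysonIntegrand_eq (Y : K →L[ℂ] K) (C : J → K →L[ℂ] K) (b : J → 𝔥) (t : ℝ)
    (ψ φ : AlgDom K 𝔥) (n : ℕ) :
    dysonIntegrand Y C b t ψ φ n = dysonForm Y C b n t (freeD K 𝔥 t ψ) φ := rfl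

variable {Y : K →L[ℂ] K} {C : J → K →L[ℂ] K} {b : J → 𝔥} {n : ℕ} {t : ℝ}

theorem dysonForm_add_left (ψ ψ' φ : AlgDom K 𝔥) (τ : Fin n → ℝ) :
    dysonForm Y C b n t (ψ + ψ') φ τ = dysonForm Y C b n t ψ φ τ + dysonForm Y C b n t ψ' φ τ := by
  simp only [dysonForm, map_add, inner_add_left, mul_add, Finset.sum_add_distrib]

theorem dysonForm_add_right (ψ φ φ' : AlgDom K 𝔥) (τ : Fin n → ℝ) :
    dysonForm Y C b n t ψ (φ + φ') τ = dysonForm Y C b n t ψ φ τ + dysonForm Y C b n t ψ φ' τ := by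
  simp only [dysonForm, map_add, inner_add_right, mul_add, Finset.sum_add_distrib]

theorem dysonForm_smul_left (z : ℂ) (ψ φ : AlgDom K 𝔥) (τ : Fin n → ℝ) :
    dysonForm Y C b n t (z • ψ) φ τ = (starRingEnd ℂ) z * dysonForm Y C b n t ψ φ τ := by
  simp only [dysonForm, map_smul, inner_smul_total_left, Finset.mul_sum]
  refine Finset.sum_congr rfl fun j _ => Finset.sum_congr rfl fun ε _ => ?_
  ring

theorem dysonForm_smul_right (z : ℂ) (ψ φ : AlgDom K 𝔥) (τ : Fin n → ℝ) :
    dysonForm Y C b n t ψ (z • φ) τ = z * dysonForm Y C b n t ψ φ τ := by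
  simp only [dysonForm, map_smul, inner_smul_total_right, Finset.mul_sum]
  refine Finset.sum_congr rfl fun j _ => Finset.sum_congr rfl fun ε _ => ?_
  ring

/-- `S ↦ S ⊗ 1` as a continuous linear map. -/
def amplL (F : Type*) [NormedAddCommGroup F] [InnerProductSpace ℂ F] :
    (K →L[ℂ] K) →L[ℂ] (K ⊗[ℂ] F →L[ℂ] K ⊗[ℂ] F) :=
  LinearMap.toContinuousLinearMap
    { toFun := ampl F
      map_add' := ampl_add
      map_smul' := ampl_smul }

theorem continuous_word (n : ℕ) (c : Fin n → K →L[ℂ] K) :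
    Continuous fun q : (Fin n → ℝ) × ℝ => word Y n q.1 c q.2 := by
  have he : Continuous fun s : ℝ => NormedSpace.exp ((-Complex.I * (s : ℂ)) • Y) := by
    have h := continuous_exp_ofReal_smul ((-Complex.I) • Y)
    simpa only [smul_smul, mul_comm] using h
  induction n with
  | zero => exact he.comp continuous_snd
  | succ n ih =>
    have h1 : Continuous fun q : (Fin (n + 1) → ℝ) × ℝ => q.2 - q.1 (Fin.last n) := by fun_prop
    have h2 : Continuous fun q : (Fin (n + 1) → ℝ) × ℝ => (Fin.init q.1, q.1 (Fin.last n)) := by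
      refine Continuous.prodMk (continuous_pi fun i => ?_) (by fun_prop)
      change Continuous fun q : (Fin (n + 1) → ℝ) × ℝ => q.1 i.castSucc
      fun_prop
    exact ((he.comp h1).mul continuous_const).mul ((ih (Fin.init c)).comp h2)

theorem exists_annihExp_prod_algPow {ι : Type*} (b : ι → 𝔥) (l : List ι) (k : K) (m : ℕ)
    (f : DomX 𝔥) : ∃ γ : (ι → ℝ) → ℂ, Continuous γ ∧ ∀ τ : ι → ℝ,
      (l.map fun p => annihExp K (τ p) (b p)).prod (k ⊗ₜ[ℂ] algPow m f)
        = γ τ • (k ⊗ₜ[ℂ] algPow (m - l.length) f) := by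
  induction l with
  | nil => exact ⟨fun _ => 1, continuous_const, fun τ => by simp⟩
  | cons p l ih =>
    obtain ⟨γ, hγ, h⟩ := ih
    have hf := continuous_fhat f
    refine ⟨fun τ => γ τ * ((Real.sqrt ((m - l.length : ℕ)) : ℂ) *
      (Real.sqrt (2 * Real.pi) * ⟪b p, fhat f (τ p)⟫_ℂ)), by fun_prop, fun τ => ?_⟩
    rw [List.map_cons, List.prod_cons, Module.End.mul_apply, h, map_smul, annihExp_algPow,
      smul_smul, List.length_cons, Nat.sub_sub]

theorem continuous_inclD_annihProd (b : Fin n → 𝔥) (ε : Fin n → Bool) (e : Bool)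
    (ψ : AlgDom K 𝔥) : Continuous fun τ => inclD K 𝔥 (annihProd τ b ε e ψ) := by
  induction ψ using algPow_induction with
  | h0 => simp only [map_zero]; exact continuous_const
  | hadd x y hx hy => simp only [map_add]; exact hx.add hy
  | h k m f =>
    obtain ⟨γ, hγ, h⟩ := exists_annihExp_prod_algPow (K := K) b
      ((List.finRange n).filter fun p => ε p == e) k m f
    simp only [annihProd, h, map_smul]
    exact Continuous.smul (M := ℂ) (X := TotalSpace K 𝔥) hγ continuous_const

/-- The integrand is continuous on all of `ℝⁿ`, and hence integrable on bounded sets. -/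
theorem continuous_dysonForm (ψ φ : AlgDom K 𝔥) : Continuous (dysonForm Y C b n t ψ φ) := by
  unfold dysonForm
  refine continuous_finsetSum _ fun j _ => continuous_finsetSum _ fun ε _ => ?_
  refine continuous_const.mul ((continuous_inclD_annihProd _ _ _ ψ).inner ?_)
  have h1 : Continuous fun τ : Fin n → ℝ => word Y n τ (fun p => signed (C (j p)) (ε p)) t :=
    (continuous_word n _).comp (by fun_prop : Continuous fun τ : Fin n → ℝ => (τ, t))
  exact ((amplL (Fock (OneParticle 𝔥))).continuous.comp h1).clm_apply
    (continuous_inclD_annihProd _ _ _ φ)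

theorem annihProd_kAct (τ : Fin n → ℝ) (b : Fin n → 𝔥) (ε : Fin n → Bool) (e : Bool)
    (S : K →L[ℂ] K) (ψ : AlgDom K 𝔥) :
    annihProd τ b ε e (kAct S ψ) = kAct S (annihProd τ b ε e ψ) := by
  unfold annihProd
  generalize (List.finRange n).filter (fun p => ε p == e) = l
  induction l with
  | nil => simp
  | cons p l ih => rw [List.map_cons, List.prod_cons, Module.End.mul_apply, ih, annihExp_kAct,
      Module.End.mul_apply]

theorem annihProd_snoc (τ : Fin n → ℝ) (s : ℝ) (b : Fin (n + 1) → 𝔥) (ε : Fin (n + 1) → Bool)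
    (e : Bool) : annihProd (K := K) (Fin.snoc τ s : Fin (n + 1) → ℝ) b ε e
      = annihProd τ (Fin.init b) (Fin.init ε) e
        * if ε (Fin.last n) = e then annihExp K s (b (Fin.last n)) else 1 := by
  unfold annihProd
  rw [List.finRange_succ_last, List.filter_append, List.map_append, List.prod_append,
    List.filter_map, List.map_map]
  congr 1
  · congr 1
    refine List.map_congr_left fun p _ => ?_
    simp [Fin.init]
  · by_cases h : ε (Fin.last n) = e <;> simp [h]

theorem sum_snoc {A : Type*} [Fintype A] {M : Type*} [AddCommMonoid M] (F : (Fin (n + 1) → A) → M) :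
    ∑ j, F j = ∑ i : A, ∑ j : Fin n → A, F (Fin.snoc j i) := by
  rw [← (Fin.snocEquiv fun _ => A).sum_comp, Fintype.sum_prod_type]
  rfl

/-- Moving the leftmost factors of an operator on `K` to the left-hand vector. -/
theorem inner_ampl_mul (X w : K →L[ℂ] K) (τ : Fin n → ℝ) (b : Fin n → 𝔥) (ε : Fin n → Bool)
    (e : Bool) (ψ : AlgDom K 𝔥) (y : TotalSpace K 𝔥) :
    ⟪inclD K 𝔥 (annihProd τ b ε e ψ), ampl _ (X * w) y⟫_ℂ
      = ⟪inclD K 𝔥 (annihProd τ b ε e (kAct X.adjoint ψ)), ampl _ w y⟫_ℂ := by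
  rw [annihProd_kAct, inclD_kAct, ← ampl_adjoint, ContinuousLinearMap.adjoint_inner_left, ampl_mul]
  rfl

/-- The recursion for the integrand: splitting off the factors at the latest time. -/
theorem dysonForm_snoc (ψ φ : AlgDom K 𝔥) (τ : Fin n → ℝ) (s : ℝ) :
    dysonForm Y C b (n + 1) t ψ φ (Fin.snoc τ s)
      = (-Complex.I * (Real.sqrt (2 * Real.pi) : ℂ)⁻¹) * ∑ i,
        (dysonForm Y C b n s (kAct (NormedSpace.exp ((-Complex.I * (t - s : ℝ)) • Y) * C i).adjoint
            (annihExp K s (b i) ψ)) φ τ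
          + dysonForm Y C b n s
            (kAct (NormedSpace.exp ((-Complex.I * (t - s : ℝ)) • Y) * (C i).adjoint).adjoint ψ)
            (annihExp K s (b i) φ) τ) := by
  unfold dysonForm
  rw [sum_snoc, Finset.mul_sum]
  refine Finset.sum_congr rfl fun i _ => ?_
  rw [← Finset.sum_add_distrib, Finset.mul_sum]
  refine Finset.sum_congr rfl fun j _ => ?_
  rw [sum_snoc, Fintype.sum_bool, ← Finset.sum_add_distrib, ← Finset.sum_add_distrib,
    Finset.mul_sum]
  refine Finset.sum_congr rfl fun ε _ => ?_
  have hb : Fin.init (b ∘ (Fin.snoc j i : Fin (n + 1) → J)) = b ∘ j := by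
    funext p; simp [Fin.init]
  have hw : ∀ e : Bool, Fin.init (fun p : Fin (n + 1) => signed (C ((Fin.snoc j i : Fin (n + 1) → J) p))
      ((Fin.snoc ε e : Fin (n + 1) → Bool) p)) = fun p => signed (C (j p)) (ε p) := fun e => by
    funext p; simp [Fin.init]
  have hε : ∀ e : Bool, Fin.init (Fin.snoc ε e : Fin (n + 1) → Bool) = ε := fun e => by
    funext p; simp [Fin.init]
  have hτ : Fin.init (Fin.snoc τ s : Fin (n + 1) → ℝ) = τ := by
    funext p; simp [Fin.init]
  simp only [annihProd_snoc, word, hb, hw, hε, hτ, Fin.snoc_last, Function.comp_apply, if_true,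
    Bool.true_eq_false, Bool.false_eq_true, if_false, mul_one, Module.End.mul_apply, inner_ampl_mul]
  simp only [signed, if_true, Bool.false_eq_true, if_false]
  ring

/-- The terms of the series for the cocycle. -/
def dysonTerm (Y : K →L[ℂ] K) (C : J → K →L[ℂ] K) (b : J → 𝔥) (n : ℕ) (t : ℝ)
    (ψ φ : AlgDom K 𝔥) : ℂ :=
  ∫ τ in simplex n t, dysonForm Y C b n t ψ φ τ

theorem integrableOn_dysonForm (ψ φ : AlgDom K 𝔥) (r : ℝ) :
    IntegrableOn (dysonForm Y C b n t ψ φ) (simplex n r) :=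
  Continuous.integrableOn_simplex (continuous_dysonForm ψ φ) r

theorem dysonTerm_add_left (ψ ψ' φ : AlgDom K 𝔥) :
    dysonTerm Y C b n t (ψ + ψ') φ = dysonTerm Y C b n t ψ φ + dysonTerm Y C b n t ψ' φ := by
  simp only [dysonTerm, dysonForm_add_left]
  exact integral_add (integrableOn_dysonForm _ _ _) (integrableOn_dysonForm _ _ _)

theorem dysonTerm_add_right (ψ φ φ' : AlgDom K 𝔥) :
    dysonTerm Y C b n t ψ (φ + φ') = dysonTerm Y C b n t ψ φ + dysonTerm Y C b n t ψ φ' := by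
  simp only [dysonTerm, dysonForm_add_right]
  exact integral_add (integrableOn_dysonForm _ _ _) (integrableOn_dysonForm _ _ _)

theorem dysonTerm_smul_left (z : ℂ) (ψ φ : AlgDom K 𝔥) :
    dysonTerm Y C b n t (z • ψ) φ = (starRingEnd ℂ) z * dysonTerm Y C b n t ψ φ := by
  simp only [dysonTerm, dysonForm_smul_left]
  exact integral_const_mul _ _

theorem dysonTerm_smul_right (z : ℂ) (ψ φ : AlgDom K 𝔥) :
    dysonTerm Y C b n t ψ (z • φ) = z * dysonTerm Y C b n t ψ φ := by
  simp only [dysonTerm, dysonForm_smul_right]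
  exact integral_const_mul _ _

theorem dysonTerm_zero_left (φ : AlgDom K 𝔥) : dysonTerm Y C b n t 0 φ = 0 := by
  simpa using dysonTerm_smul_left (Y := Y) (C := C) (b := b) (n := n) (t := t) 0 0 φ

theorem dysonTerm_zero_right (ψ : AlgDom K 𝔥) : dysonTerm Y C b n t ψ 0 = 0 := by
  simpa using dysonTerm_smul_right (Y := Y) (C := C) (b := b) (n := n) (t := t) 0 ψ 0

theorem dysonTerm_zero (ψ φ : AlgDom K 𝔥) : dysonTerm Y C b 0 t ψ φ
    = ⟪inclD K 𝔥 ψ, ampl _ (NormedSpace.exp ((-Complex.I * t) • Y)) (inclD K 𝔥 φ)⟫_ℂ := by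
  rw [dysonTerm, integral_simplex_zero, dysonForm, Fintype.sum_unique, Fintype.sum_unique]
  simp [annihProd, word]

/-- The recursion `dysonForm_snoc`, integrated over the earlier times. -/
theorem integral_dysonForm_snoc (ψ φ : AlgDom K 𝔥) (s : ℝ) :
    ∫ τ in simplex n s, dysonForm Y C b (n + 1) t ψ φ (Fin.snoc τ s)
      = (-Complex.I * (Real.sqrt (2 * Real.pi) : ℂ)⁻¹) * ∑ i,
        (dysonTerm Y C b n s (kAct (NormedSpace.exp ((-Complex.I * (t - s : ℝ)) • Y) * C i).adjoint
            (annihExp K s (b i) ψ)) φ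
          + dysonTerm Y C b n s
            (kAct (NormedSpace.exp ((-Complex.I * (t - s : ℝ)) • Y) * (C i).adjoint).adjoint ψ)
            (annihExp K s (b i) φ)) := by
  simp only [dysonForm_snoc]
  rw [integral_const_mul, integral_finsetSum]
  · congr 1
    refine Finset.sum_congr rfl fun i _ => ?_
    exact integral_add (integrableOn_dysonForm _ _ _) (integrableOn_dysonForm _ _ _)
  · intro i _
    exact (integrableOn_dysonForm _ _ _).add (integrableOn_dysonForm _ _ _)

end Dyson

/-! ### Summation of the series -/

section Summation

variable {K 𝔥 : Type*} [NormedAddCommGroup K] [InnerProductSpace ℂ K]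
  [FiniteDimensional ℂ K] [CompleteSpace K]
  [NormedAddCommGroup 𝔥] [InnerProductSpace ℂ 𝔥] [CompleteSpace 𝔥] [FiniteDimensional ℂ 𝔥]
  {J : Type*} [Fintype J]
  {E : K →L[ℂ] K} {ν : K →L[ℂ] K ⊗[ℂ] 𝔥} {C : J → K →L[ℂ] K} {b : J → 𝔥}
  {V : ℝ → TotalSpace K 𝔥 →L[ℂ] TotalSpace K 𝔥}

theorem hasDerivAt_inner_clm {A H : Type*} [NormedAddCommGroup A] [NormedSpace ℂ A]
    [NormedAddCommGroup H] [InnerProductSpace ℂ H] (L : A →L[ℂ] H) {X : ℝ → A} {X' : A}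
    {v : ℝ → H} {d : ℂ} {s : ℝ} (hX : HasDerivAt X X' s) (hv : ContinuousAt v s)
    (hw : HasDerivAt (fun r => ⟪L (X s), v r⟫_ℂ) d s) :
    HasDerivAt (fun r => ⟪L (X r), v r⟫_ℂ) (⟪L X', v s⟫_ℂ + d) s :=
  hasDerivAt_inner_of_weak ((L.restrictScalars ℝ).hasFDerivAt.comp_hasDerivAt s hX) hv hw

theorem hasDerivAt_exp_sub (Y : K →L[ℂ] K) (t s : ℝ) :
    HasDerivAt (fun s : ℝ => NormedSpace.exp ((-Complex.I * (t - s : ℝ)) • Y))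
      (NormedSpace.exp ((-Complex.I * (t - s : ℝ)) • Y) * (Complex.I • Y)) s := by
  have h := (hasDerivAt_exp_ofReal_smul ((-Complex.I) • Y) (t - s)).scomp s
    ((hasDerivAt_id s).const_sub t)
  have hc : Commute (Complex.I • Y) (NormedSpace.exp (((t - s : ℝ) : ℂ) • (-Complex.I) • Y)) :=
    let := NormedAlgebra.restrictScalars ℚ ℂ (K →L[ℂ] K)
    ((((Commute.refl Y).smul_right _).smul_right _).smul_left _).exp_right
  have h1 : ∀ r : ℝ, (-Complex.I * (r : ℂ)) • Y = (r : ℂ) • (-Complex.I) • Y := fun r => by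
    rw [smul_smul, mul_comm]
  simp only [h1, ← hc.eq]
  refine HasDerivAt.congr_deriv h ?_
  rw [neg_one_smul, neg_smul, neg_mul, neg_neg]

/-- Variation of constants: the evolution equation for the cocycle, with the drift integrated. -/
theorem IsCocycle.inner_eq_add_integral (hV : IsCocycle E ν V)
    (hVc : ∀ x, Continuous fun s => V s x) (hVn : ∀ s x, ‖V s x‖ = ‖x‖)
    (h : IsDecomposition ν C b) {t : ℝ} (ht : 0 ≤ t) (ψ φ : AlgDom K 𝔥) :
    ⟪inclD K 𝔥 ψ, V t (inclD K 𝔥 φ)⟫_ℂ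
      = ⟪inclD K 𝔥 ψ, ampl _ (NormedSpace.exp ((-Complex.I * t) • upsilon E ν)) (inclD K 𝔥 φ)⟫_ℂ
        + ∫ s in 0..t, (-Complex.I * (Real.sqrt (2 * Real.pi) : ℂ)⁻¹) * ∑ i,
          (⟪inclD K 𝔥 (kAct (NormedSpace.exp ((-Complex.I * (t - s : ℝ)) • upsilon E ν)
              * C i).adjoint (annihExp K s (b i) ψ)), V s (inclD K 𝔥 φ)⟫_ℂ
            + ⟪inclD K 𝔥 (kAct (NormedSpace.exp ((-Complex.I * (t - s : ℝ)) • upsilon E ν)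
              * (C i).adjoint).adjoint ψ), V s (inclD K 𝔥 (annihExp K s (b i) φ))⟫_ℂ) := by
  set X : ℝ → K →L[ℂ] K := fun s =>
    NormedSpace.exp ((-Complex.I * (t - s : ℝ)) • upsilon E ν) with hXdef
  set c : ℂ := (Real.sqrt (2 * Real.pi) : ℂ)⁻¹ with hc
  have hX : ∀ s, HasDerivAt X (X s * (Complex.I • upsilon E ν)) s := hasDerivAt_exp_sub _ t
  have hXc : Continuous X := continuous_iff_continuousAt.2 fun s => (hX s).continuousAt
  have hXt : X t = 1 := by
    let := NormedAlgebra.restrictScalars ℚ ℂ (K →L[ℂ] K)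
    simp [hXdef]
  let L : (K →L[ℂ] K) →L[ℂ] TotalSpace K 𝔥 := (ContinuousLinearMap.apply ℂ (TotalSpace K 𝔥)
    (inclD K 𝔥 ψ)) ∘L amplL (Fock (OneParticle 𝔥))
  have hL : ∀ S : K →L[ℂ] K, L S = inclD K 𝔥 (kAct S ψ) := fun S => (inclD_kAct S ψ).symm
  have hcont : Continuous fun s => ⟪L (X s).adjoint, V s (inclD K 𝔥 φ)⟫_ℂ :=
    (L.continuous.comp ((ContinuousLinearMap.adjoint (𝕜 := ℂ) (E := K) (F := K)).continuous.comp
      hXc)).inner (hVc _)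
  -- The derivative of the drift cancels the term with `Υ` in the evolution equation.
  have hderiv : ∀ s ∈ Set.Ioo 0 t, HasDerivAt (fun s => ⟪L (X s).adjoint, V s (inclD K 𝔥 φ)⟫_ℂ)
      ((-Complex.I * c) * ∑ i, (⟪inclD K 𝔥 (kAct (X s * C i).adjoint (annihExp K s (b i) ψ)),
          V s (inclD K 𝔥 φ)⟫_ℂ
        + ⟪inclD K 𝔥 (kAct (X s * (C i).adjoint).adjoint ψ),
          V s (inclD K 𝔥 (annihExp K s (b i) φ))⟫_ℂ)) s := fun s hs => by
    have hw := hV.hasDerivAt hVc hVn h hs.1 (kAct (X s).adjoint ψ) φ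
    rw [← hL] at hw
    refine (hasDerivAt_inner_clm L (hX s).star (hVc _).continuousAt hw).congr_deriv ?_
    have hmul : ∀ (S T : K →L[ℂ] K) (ψ : AlgDom K 𝔥) (y : TotalSpace K 𝔥),
        ⟪inclD K 𝔥 (kAct (S * T).adjoint ψ), y⟫_ℂ
          = ⟪inclD K 𝔥 (kAct S.adjoint ψ), ampl _ T y⟫_ℂ := fun S T ψ y => by
      rw [inclD_kAct, inclD_kAct, ← ampl_adjoint, ← ampl_adjoint, ampl_mul,
        ContinuousLinearMap.adjoint_inner_left, ContinuousLinearMap.adjoint_inner_left]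
      rfl
    simp only [ContinuousLinearMap.star_eq_adjoint, hL, rate, hmul, annihExp_kAct, ampl_smul, smul_apply, inner_smul_total_right, hc]
    ring
  have hint : Continuous fun s => (-Complex.I * c) *
      ∑ i, (⟪inclD K 𝔥 (kAct (X s * C i).adjoint (annihExp K s (b i) ψ)), V s (inclD K 𝔥 φ)⟫_ℂ
        + ⟪inclD K 𝔥 (kAct (X s * (C i).adjoint).adjoint ψ),
          V s (inclD K 𝔥 (annihExp K s (b i) φ))⟫_ℂ) := by
    have hk : ∀ (S : ℝ → K →L[ℂ] K) (ψ : ℝ → AlgDom K 𝔥), Continuous S →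
        (Continuous fun s => inclD K 𝔥 (ψ s)) →
        Continuous fun s => inclD K 𝔥 (kAct (S s).adjoint (ψ s)) := fun S ψ hS hψ => by
      simp only [inclD_kAct]
      exact ((amplL _).continuous.comp ((ContinuousLinearMap.adjoint (𝕜 := ℂ) (E := K)
        (F := K)).continuous.comp hS)).clm_apply hψ
    refine continuous_const.mul (continuous_finsetSum _ fun i _ => Continuous.add ?_ ?_)
    · exact (hk _ _ (hXc.mul continuous_const) (continuous_inclD_annihExp _ _)).inner (hVc _)
    · exact (hk _ _ (hXc.mul continuous_const) continuous_const).inner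
        (continuous_apply_of_isometry hVc hVn (continuous_inclD_annihExp _ _))
  have key := intervalIntegral.integral_eq_sub_of_hasDerivAt_of_le ht hcont.continuousOn hderiv
    (hint.intervalIntegrable _ _)
  have h0 : ⟪L (X 0).adjoint, V 0 (inclD K 𝔥 φ)⟫_ℂ = ⟪inclD K 𝔥 ψ,
      ampl _ (NormedSpace.exp ((-Complex.I * t) • upsilon E ν)) (inclD K 𝔥 φ)⟫_ℂ := by
    rw [hL, hV.inner_inclD hVc hVn h le_rfl, intervalIntegral.integral_same, add_zero, inclD_kAct,
      ← ampl_adjoint, ContinuousLinearMap.adjoint_inner_left]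
    simp only [hXdef, sub_zero]
  have ht : ⟪L (X t).adjoint, V t (inclD K 𝔥 φ)⟫_ℂ = ⟪inclD K 𝔥 ψ, V t (inclD K 𝔥 φ)⟫_ℂ := by
    rw [hL, hXt, inclD_kAct, ← ampl_adjoint, ampl_one, ContinuousLinearMap.adjoint_inner_left,
      one_apply_eq_self]
  rw [h0, ht] at key
  exact (sub_eq_iff_eq_add'.1 key.symm)

/-- Partial sums of the series, by induction on a bound `N` for the total degree: the recursion for
the terms is the variation of constants formula, and annihilation lowers the degree of one of the
two vectors. In particular the terms of order greater than `n + m` do not contribute. -/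
theorem IsCocycle.inner_eq_sum_dysonTerm (hV : IsCocycle E ν V)
    (hVc : ∀ x, Continuous fun s => V s x) (hVn : ∀ s x, ‖V s x‖ = ‖x‖)
    (h : IsDecomposition ν C b) (N : ℕ) {t : ℝ} (ht : 0 ≤ t) (k' k : K) (f g : DomX 𝔥)
    {n m : ℕ} (hN : n + m < N) :
    ⟪inclD K 𝔥 (k' ⊗ₜ[ℂ] algPow n f), V t (inclD K 𝔥 (k ⊗ₜ[ℂ] algPow m g))⟫_ℂ
      = ∑ l ∈ Finset.range N,
        dysonTerm (upsilon E ν) C b l t (k' ⊗ₜ[ℂ] algPow n f) (k ⊗ₜ[ℂ] algPow m g) := by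
  induction N generalizing t k' k n m with
  | zero => omega
  | succ N ih =>
    have hl : ∀ s, 0 ≤ s → ∀ i (S : K →L[ℂ] K),
        ⟪inclD K 𝔥 (kAct S (annihExp K s (b i) (k' ⊗ₜ[ℂ] algPow n f))),
          V s (inclD K 𝔥 (k ⊗ₜ[ℂ] algPow m g))⟫_ℂ
        = ∑ l ∈ Finset.range N, dysonTerm (upsilon E ν) C b l s
          (kAct S (annihExp K s (b i) (k' ⊗ₜ[ℂ] algPow n f))) (k ⊗ₜ[ℂ] algPow m g) := by
      intro s hs i S
      cases n with
      | zero => simp [annihExp_algPow, dysonTerm_zero_left]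
      | succ n =>
        simp only [annihExp_algPow, map_smul, kAct_tmul, inner_smul_total_left,
          dysonTerm_smul_left, ← Finset.mul_sum]
        rw [ih hs (S k') k (by omega)]
    have hr : ∀ s, 0 ≤ s → ∀ i (S : K →L[ℂ] K),
        ⟪inclD K 𝔥 (kAct S (k' ⊗ₜ[ℂ] algPow n f)),
          V s (inclD K 𝔥 (annihExp K s (b i) (k ⊗ₜ[ℂ] algPow m g)))⟫_ℂ
        = ∑ l ∈ Finset.range N, dysonTerm (upsilon E ν) C b l s
          (kAct S (k' ⊗ₜ[ℂ] algPow n f)) (annihExp K s (b i) (k ⊗ₜ[ℂ] algPow m g)) := by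
      intro s hs i S
      cases m with
      | zero => simp [annihExp_algPow, dysonTerm_zero_right]
      | succ m =>
        simp only [annihExp_algPow, map_smul, kAct_tmul, inner_smul_total_right,
          dysonTerm_smul_right, ← Finset.mul_sum]
        rw [ih hs (S k') k (by omega)]
    have hF := fun l => integral_simplex_succ (n := l)
      (continuous_dysonForm (Y := upsilon E ν) (C := C) (b := b) (n := l + 1) (t := t)
        (k' ⊗ₜ[ℂ] algPow n f) (k ⊗ₜ[ℂ] algPow m g)) ht
    have hT : ∀ l, dysonTerm (upsilon E ν) C b (l + 1) t (k' ⊗ₜ[ℂ] algPow n f)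
        (k ⊗ₜ[ℂ] algPow m g) = ∫ s in 0..t, ∫ τ in simplex l s, dysonForm (upsilon E ν) C b (l + 1) t
          (k' ⊗ₜ[ℂ] algPow n f) (k ⊗ₜ[ℂ] algPow m g) (Fin.snoc τ s) := fun l => (hF l).2
    rw [Finset.sum_range_succ', add_comm, dysonTerm_zero, Finset.sum_congr rfl fun l _ => hT l,
      ← intervalIntegral.integral_finsetSum fun l _ => (hF l).1,
      hV.inner_eq_add_integral hVc hVn h ht]
    congr 1
    refine intervalIntegral.integral_congr fun s hs => ?_
    rw [Set.uIcc_of_le ht] at hs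
    simp only [integral_dysonForm_snoc, ← Finset.mul_sum, hl s hs.1, hr s hs.1]
    rw [Finset.sum_comm]
    simp only [Finset.sum_add_distrib]

/-- On the algebraic domain the series is a finite sum, whose value is the cocycle. -/
theorem IsCocycle.hasSum_dysonTerm (hV : IsCocycle E ν V)
    (hVc : ∀ x, Continuous fun s => V s x) (hVn : ∀ s x, ‖V s x‖ = ‖x‖)
    (h : IsDecomposition ν C b) {t : ℝ} (ht : 0 ≤ t) (ψ φ : AlgDom K 𝔥) :
    HasSum (fun n => dysonTerm (upsilon E ν) C b n t ψ φ)
      ⟪inclD K 𝔥 ψ, V t (inclD K 𝔥 φ)⟫_ℂ := by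
  induction ψ using algPow_induction with
  | h0 => simp [dysonTerm_zero_left, hasSum_zero]
  | hadd x y hx hy =>
    simp only [map_add, inner_add_left, dysonTerm_add_left]
    exact hx.add hy
  | h k' n f =>
    induction φ using algPow_induction with
    | h0 => simp [dysonTerm_zero_right, hasSum_zero]
    | hadd x y hx hy =>
      simp only [map_add, inner_add_right, dysonTerm_add_right]
      exact hx.add hy
    | h k m g =>
      have key := fun N hN => hV.inner_eq_sum_dysonTerm hVc hVn h N ht k' k f g (n := n) (m := m) hN
      rw [key (n + m + 1) (by omega)]
      refine hasSum_sum_of_ne_finset_zero fun l hl => ?_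
      have hl' : n + m < l := by simpa [Finset.mem_range] using hl
      -- The partial sums up to `l` and up to `l + 1` agree, so the term of order `l` is zero.
      have h1 := key (l + 1) (by omega)
      rw [Finset.sum_range_succ, ← key l hl'] at h1
      simpa using h1

end Summation

/-! ### The derivative of the free evolution -/

section FreeDerivative

variable {K 𝔥 : Type*} [NormedAddCommGroup K] [InnerProductSpace ℂ K]
  [FiniteDimensional ℂ K] [CompleteSpace K]
  [NormedAddCommGroup 𝔥] [InnerProductSpace ℂ 𝔥] [CompleteSpace 𝔥] [FiniteDimensional ℂ 𝔥]

theorem hasDerivAt_fockPow {R : Type*} [NormedAddCommGroup R] [InnerProductSpace ℂ R] (n : ℕ)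
    {g : ℝ → R} {g' : R} {t : ℝ} (hg : HasDerivAt g g' t) :
    HasDerivAt (fun t => fockPow n (g t))
      (∑ i, symTprodL n (Function.update (fun _ => g t) i g')) t := by
  have h1 : HasDerivAt (fun t => fun _ : Fin n => g t) (fun _ => g') t :=
    hasDerivAt_pi.2 fun _ => hg
  have h2 := (((symTprodL (R := R) n).hasFDerivAt
    (fun _ : Fin n => g t)).restrictScalars ℝ).comp_hasDerivAt t h1
  refine HasDerivAt.congr_deriv h2 ?_
  exact ContinuousMultilinearMap.linearDeriv_apply _ _ _

theorem fockIncl_dGamma_algPow {V R : Type*} [AddCommGroup V] [Module ℂ V] [NormedAddCommGroup R]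
    [InnerProductSpace ℂ R] (n : ℕ) (J A : V →ₗ[ℂ] R) (f : V) :
    fockIncl R (dGamma J A (algPow n f))
      = ∑ i, symTprodL n (Function.update (fun _ => J f) i (A f)) := by
  rw [dGamma_algPow, fockIncl_lof, map_sum]
  rfl

theorem dGammaX_algPow (k : K) (n : ℕ) (f : DomX 𝔥) :
    dGammaX K 𝔥 (k ⊗ₜ[ℂ] algPow n f) = k ⊗ₜ[ℂ] ∑ i, symTprodL n
      (Function.update (fun _ => f.1) i ((mulX (𝔥 := 𝔥)).toFun f)) :=
  congrArg (k ⊗ₜ[ℂ] ·) (fockIncl_dGamma_algPow n (DomX 𝔥).subtype (mulX (𝔥 := 𝔥)).toFun f)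

theorem hasDerivAt_fockPow_mulExp (n : ℕ) (f : DomX 𝔥) (t : ℝ) :
    HasDerivAt (fun t => fockPow n (mulExp t f.1)) (Complex.I • ∑ i, symTprodL n
      (Function.update (fun _ => (expX t f).1) i ((mulX (𝔥 := 𝔥)).toFun (expX t f)))) t := by
  refine (hasDerivAt_fockPow n (hasDerivAt_mulExp t f)).congr_deriv ?_
  rw [Finset.smul_sum]
  exact Finset.sum_congr rfl fun i _ => (symTprodL n).map_update_smul _ _ _ _

theorem inclD_freeD_algPow (t : ℝ) (k : K) (n : ℕ) (f : DomX 𝔥) :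
    inclD K 𝔥 (freeD K 𝔥 t (k ⊗ₜ[ℂ] algPow n f)) = k ⊗ₜ[ℂ] fockPow n (mulExp t f.1) := by
  rw [freeD_algPow, inclD_algPow]
  rfl

/-- The product rule for the free evolution and a weakly differentiable path. -/
theorem hasDerivAt_inner_freeD {v : ℝ → TotalSpace K 𝔥} {d : AlgDom K 𝔥 → ℂ} {s : ℝ}
    (hv : ContinuousAt v s) (hd : ∀ ψ, HasDerivAt (fun r => ⟪inclD K 𝔥 ψ, v r⟫_ℂ) (d ψ) s)
    (ψ : AlgDom K 𝔥) :
    HasDerivAt (fun r => ⟪inclD K 𝔥 (freeD K 𝔥 r ψ), v r⟫_ℂ)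
      (-Complex.I * ⟪dGammaX K 𝔥 (freeD K 𝔥 s ψ), v s⟫_ℂ + d (freeD K 𝔥 s ψ)) s := by
  have hadd : ∀ ψ ψ', d (ψ + ψ') = d ψ + d ψ' := fun ψ ψ' => by
    refine (hd (ψ + ψ')).unique ?_
    simp only [map_add, inner_add_left]
    exact (hd ψ).add (hd ψ')
  have hzero : d 0 = 0 := by simpa using hadd 0 0
  induction ψ using algPow_induction with
  | h0 =>
    simp only [map_zero, hzero, inner_zero_left, mul_zero, add_zero]
    exact hasDerivAt_const _ _
  | hadd x y hx hy =>
    simp only [map_add, inner_add_left, hadd]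
    exact (hx.add hy).congr_deriv (by ring)
  | h k n f =>
    have hw := hd (freeD K 𝔥 s (k ⊗ₜ[ℂ] algPow n f))
    simp only [inclD_freeD_algPow] at hw ⊢
    have key := hasDerivAt_inner_clm (TensorProduct.mkL ℂ K (Fock (OneParticle 𝔥)) k)
      (hasDerivAt_fockPow_mulExp n f s) hv hw
    refine key.congr_deriv (congrArg (· + _) ?_)
    rw [map_smul, freeD_algPow, dGammaX_algPow]
    refine (inner_smul_total_left _ _ _).trans ?_
    rw [Complex.conj_I]
    rfl

theorem continuous_freeU (x : TotalSpace K 𝔥) : Continuous fun t => freeU K 𝔥 t x := by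
  rw [continuous_iff_continuousAt]
  intro t
  have h1 : Tendsto (fun s : ℝ => s - t) (𝓝 t) (𝓝 0) := by
    have : Continuous fun s : ℝ => s - t := by fun_prop
    simpa using this.tendsto t
  have h2 := ((freeU K 𝔥 t).continuous.tendsto x).comp ((tendsto_freeU x).comp h1)
  refine h2.congr fun s => ?_
  simp only [Function.comp_apply]
  rw [← ContinuousLinearMap.comp_apply, ← freeU_add, add_sub_cancel]

theorem continuous_inclD_freeD (ψ : AlgDom K 𝔥) : Continuous fun s => inclD K 𝔥 (freeD K 𝔥 s ψ) := by
  simp only [inclD_freeD]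
  exact continuous_freeU _

theorem mulX_expX (t : ℝ) (f : DomX 𝔥) :
    (mulX (𝔥 := 𝔥)).toFun (expX t f) = mulExp t ((mulX (𝔥 := 𝔥)).toFun f) := by
  refine Lp.ext ?_
  have h1 := (memLp_of_mem_domX (expX t f)).coeFn_toLp
  have h2 := (memLp_exp t (Lp.memLp ((mulX (𝔥 := 𝔥)).toFun f))).coeFn_toLp
  have h3 := (memLp_of_mem_domX f).coeFn_toLp
  filter_upwards [h1, h2, h3, coeFn_expX t f] with x h1 h2 h3 h4
  refine h1.trans (Eq.trans ?_ h2.symm)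
  have h5 : ((mulX (𝔥 := 𝔥)).toFun f : ℝ → 𝔥) x = (x : ℂ) • f.1 x := h3
  rw [h4, h5, smul_comm]

/-- Continuity in the norm of the Fock space of the image under the unbounded `dΓ(Z_R)`, which
commutes with the free evolution. -/
theorem continuous_dGammaX_freeD (ψ : AlgDom K 𝔥) :
    Continuous fun s => dGammaX K 𝔥 (freeD K 𝔥 s ψ) := by
  induction ψ using algPow_induction with
  | h0 => simp only [map_zero]; exact continuous_const
  | hadd x y hx hy => simp only [map_add]; exact hx.add hy
  | h k n f =>
    simp only [freeD_algPow, dGammaX_algPow]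
    refine (TensorProduct.mkL ℂ K (Fock (OneParticle 𝔥)) k).continuous.comp
      (continuous_finsetSum _ fun i _ => (symTprodL n).cont.comp ?_)
    simp only [mulX_expX]
    exact (continuous_pi fun _ => continuous_mulExp f.1).update i (continuous_mulExp _)

theorem freeD_zero (ψ : AlgDom K 𝔥) : freeD K 𝔥 0 ψ = ψ := by
  induction ψ using algPow_induction with
  | h0 => simp only [map_zero]
  | hadd x y hx hy => simp only [map_add, hx, hy]
  | h k n f =>
    rw [freeD_algPow]
    congr 2
    exact Subtype.ext (mulExp_zero f.1)

/-- The free evolution takes the annihilation operator at time `s` to the one at time `0`. -/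
theorem annihExp_freeD (s : ℝ) (b : 𝔥) (ψ : AlgDom K 𝔥) :
    annihExp K s b (freeD K 𝔥 s ψ) = freeD K 𝔥 s (annihExp K 0 b ψ) := by
  induction ψ using algPow_induction with
  | h0 => simp only [map_zero]
  | hadd x y hx hy => simp only [map_add, hx, hy]
  | h k n f =>
    have h : fhat (expX s f) s = fhat f 0 := by
      rw [fhat, fhat, ← expX_add, neg_add_cancel, neg_zero]
    simp only [freeD_algPow, annihExp_algPow, map_smul, h]

/-- `dΓ(Z_R)` is symmetric, because the free evolution is unitary. -/
theorem inner_dGammaX (ψ φ : AlgDom K 𝔥) :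
    ⟪dGammaX K 𝔥 ψ, inclD K 𝔥 φ⟫_ℂ = ⟪inclD K 𝔥 ψ, dGammaX K 𝔥 φ⟫_ℂ := by
  have h : ∀ ψ φ : AlgDom K 𝔥, HasDerivAt (fun r => ⟪inclD K 𝔥 (freeD K 𝔥 r ψ), inclD K 𝔥 φ⟫_ℂ)
      (-Complex.I * ⟪dGammaX K 𝔥 ψ, inclD K 𝔥 φ⟫_ℂ) 0 := fun ψ φ => by
    have := hasDerivAt_inner_freeD (v := fun _ => inclD K 𝔥 φ) (d := fun _ => 0) (s := 0)
      continuousAt_const (fun _ => hasDerivAt_const _ _) ψ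
    rwa [freeD_zero, add_zero] at this
  have h1 := h ψ φ
  have h2 : HasDerivAt (fun r => ⟪inclD K 𝔥 (freeD K 𝔥 r ψ), inclD K 𝔥 φ⟫_ℂ)
      (-(starRingEnd ℂ) (-Complex.I * ⟪dGammaX K 𝔥 φ, inclD K 𝔥 ψ⟫_ℂ)) 0 := by
    have h3 := h φ ψ
    rw [← neg_zero] at h3
    have h4 := (HasDerivAt.scomp (0 : ℝ) h3 (hasDerivAt_neg (0 : ℝ))).star
    refine (h4.congr_deriv (by simp)).congr_of_eventuallyEq (Eventually.of_forall fun r => ?_)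
    change _ = (starRingEnd ℂ) ⟪inclD K 𝔥 (freeD K 𝔥 (-r) φ), inclD K 𝔥 ψ⟫_ℂ
    change ⟪inclD K 𝔥 (freeD K 𝔥 r ψ), inclD K 𝔥 φ⟫_ℂ = _
    rw [conj_inner_total, inclD_freeD, inclD_freeD, inner_freeU_right, neg_neg]
  have h3 := h1.unique h2
  rw [map_mul, conj_inner_total, map_neg, Complex.conj_I, neg_neg, ← neg_mul] at h3
  exact mul_left_cancel₀ (neg_ne_zero.2 Complex.I_ne_zero) h3

end FreeDerivative

/-! ### Differentiation of the matrix elements of the group -/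

section Differentiation

variable {K 𝔥 : Type*} [NormedAddCommGroup K] [InnerProductSpace ℂ K]
  [FiniteDimensional ℂ K] [CompleteSpace K]
  [NormedAddCommGroup 𝔥] [InnerProductSpace ℂ 𝔥] [CompleteSpace 𝔥] [FiniteDimensional ℂ 𝔥]
  {J : Type*} [Fintype J]
  {E : K →L[ℂ] K} {ν : K →L[ℂ] K ⊗[ℂ] 𝔥} {C : J → K →L[ℂ] K} {b : J → 𝔥}
  {V : ℝ → TotalSpace K 𝔥 →L[ℂ] TotalSpace K 𝔥}

/-- The annihilation operator of `|1⟩ ⊗ ν`, in terms of a decomposition of `ν`. -/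
theorem annihNu_eq (h : IsDecomposition ν C b) (ψ : AlgDom K 𝔥) :
    annihNu ν ψ = ∑ j, kAct (C j).adjoint (annihExp K 0 (b j) ψ) := by
  induction ψ using algPow_induction with
  | h0 => simp only [map_zero, Finset.sum_const_zero]
  | hadd x y hx hy => simp only [map_add, hx, hy, Finset.sum_add_distrib]
  | h k n f =>
    cases n with
    | zero => rw [annihNu, annih_algPow_zero]; simp [annihExp_algPow]
    | succ n =>
      have h1 : braOne f = (Real.sqrt (2 * Real.pi) : ℂ) • fhat f 0 := by
        rw [← braOne_expX_eq, neg_zero]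
        congr 1
        exact (Subtype.ext (mulExp_zero f.1)).symm
      rw [annihNu, annih_algPow_succ]
      simp only [LinearMap.comp_apply, LinearMap.lTensor_tmul, annihExp_algPow, map_smul,
        kAct_tmul, ContinuousLinearMap.coe_coe, h.adjoint_tmul, h1, inner_smul_right,
        TensorProduct.sum_tmul, Finset.smul_sum, Nat.add_sub_cancel, Nat.cast_add, Nat.cast_one]
      refine Finset.sum_congr rfl fun j _ => ?_
      rw [← TensorProduct.smul_tmul', smul_smul]

/-- `Z⁻` is the adjoint form of `Z⁺`. -/
theorem conj_formPlus (E : K →L[ℂ] K) (ν : K →L[ℂ] K ⊗[ℂ] 𝔥) (ψ φ : AlgDom K 𝔥) :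
    (starRingEnd ℂ) (formPlus E ν φ ψ) = formMinus E ν ψ φ := by
  simp only [formPlus, formMinus, formCommon, map_add, map_mul, conj_inner_total, map_inv₀,
    Complex.conj_ofReal, inner_dGammaX]
  rw [← ampl_adjoint, ContinuousLinearMap.adjoint_inner_right]
  ring

/-- The derivative of `⟪ψ, U_t φ⟫` for `t > 0`, as an expression in the cocycle. -/
def groupRate (E : K →L[ℂ] K) (ν : K →L[ℂ] K ⊗[ℂ] 𝔥)
    (V : ℝ → TotalSpace K 𝔥 →L[ℂ] TotalSpace K 𝔥) (ψ φ : AlgDom K 𝔥) (s : ℝ) : ℂ :=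
  -Complex.I * ⟪dGammaX K 𝔥 (freeD K 𝔥 s ψ), V s (inclD K 𝔥 φ)⟫_ℂ
    + -Complex.I * rate E ν (fun i => coef ν (stdOrthonormalBasis ℂ 𝔥 i)) (stdOrthonormalBasis ℂ 𝔥)
      V (freeD K 𝔥 s ψ) φ s

/-- The product rule: the free evolution contributes `dΓ(Z_R)`, the cocycle contributes `rate`. -/
theorem IsCocycle.hasDerivAt_freeD (hV : IsCocycle E ν V) (hVc : ∀ x, Continuous fun s => V s x)
    (hVn : ∀ s x, ‖V s x‖ = ‖x‖) {t : ℝ} (ht : 0 < t) (ψ φ : AlgDom K 𝔥) :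
    HasDerivAt (fun s => ⟪inclD K 𝔥 (freeD K 𝔥 s ψ), V s (inclD K 𝔥 φ)⟫_ℂ)
      (groupRate E ν V ψ φ t) t :=
  hasDerivAt_inner_freeD (hVc _).continuousAt
    (fun ψ => hV.hasDerivAt hVc hVn (isDecomposition_coef ν (stdOrthonormalBasis ℂ 𝔥)) ht ψ φ) ψ

/-- The derivative extends continuously to the origin: after the free evolution, the annihilation
operators on the left act at time `0`, and those on the right act on a fixed vector. -/
theorem continuous_groupRate (hVc : ∀ x, Continuous fun s => V s x) (hVn : ∀ s x, ‖V s x‖ = ‖x‖)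
    (ψ φ : AlgDom K 𝔥) : Continuous (groupRate E ν V ψ φ) := by
  have h2 := fun b : 𝔥 => continuous_apply_of_isometry hVc hVn (continuous_inclD_annihExp b φ)
  have h3 := hVc (inclD K 𝔥 φ)
  have h4 := fun ψ : AlgDom K 𝔥 => continuous_inclD_freeD ψ
  unfold groupRate rate
  simp only [annihExp_freeD]
  refine (continuous_const.mul ((continuous_dGammaX_freeD ψ).inner h3)).add
    (continuous_const.mul ?_)
  exact ((h4 _).inner ((ampl _ _).continuous.comp h3)).add
    (continuous_const.mul (continuous_finsetSum _ fun j _ =>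
      ((h4 _).inner ((ampl _ _).continuous.comp h3)).add
        ((h4 _).inner ((ampl _ _).continuous.comp (h2 _)))))

/-- At `t = 0` the derivative is the form `-iZ⁺`. -/
theorem groupRate_zero (hV0 : V 0 = 1) (ψ φ : AlgDom K 𝔥) :
    groupRate E ν V ψ φ 0 = -Complex.I * formPlus E ν ψ φ := by
  have h := annihNu_eq (isDecomposition_coef ν (stdOrthonormalBasis ℂ 𝔥))
  have hV : ∀ x, V 0 x = x := fun x => by rw [hV0]; rfl
  simp only [groupRate, rate, formPlus, formCommon, freeD_zero, hV, h, map_sum, inclD_kAct,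
    inner_sum, sum_inner, inner_dGammaX, Finset.sum_add_distrib]
  simp only [← ampl_adjoint, ContinuousLinearMap.adjoint_inner_left]
  ring

/-- A continuous function whose derivative extends continuously to the origin from each side. -/
theorem differentiability_of_onesided {F Dp Dm : ℝ → ℂ} (hF : Continuous F)
    (hp : ∀ t, 0 < t → HasDerivAt F (Dp t) t) (hm : ∀ t, t < 0 → HasDerivAt F (Dm t) t)
    (cp : Continuous Dp) (cm : Continuous Dm) :
    (∀ t, t ≠ 0 → DifferentiableAt ℝ F t) ∧ ContinuousOn (deriv F) {0}ᶜ ∧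
    Tendsto (deriv F) (𝓝[>] 0) (𝓝 (Dp 0)) ∧
    Tendsto (fun t : ℝ => (t : ℂ)⁻¹ * (F t - F 0)) (𝓝[>] 0) (𝓝 (Dp 0)) ∧
    Tendsto (deriv F) (𝓝[<] 0) (𝓝 (Dm 0)) ∧
    Tendsto (fun t : ℝ => (t : ℂ)⁻¹ * (F t - F 0)) (𝓝[<] 0) (𝓝 (Dm 0)) := by
  have hlp : Tendsto (deriv F) (𝓝[>] 0) (𝓝 (Dp 0)) := by
    refine ((cp.tendsto 0).mono_left nhdsWithin_le_nhds).congr' ?_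
    filter_upwards [self_mem_nhdsWithin] with t ht using (hp t ht).deriv.symm
  have hlm : Tendsto (deriv F) (𝓝[<] 0) (𝓝 (Dm 0)) := by
    refine ((cm.tendsto 0).mono_left nhdsWithin_le_nhds).congr' ?_
    filter_upwards [self_mem_nhdsWithin] with t ht using (hm t ht).deriv.symm
  have hs : slope F 0 = fun t : ℝ => (t : ℂ)⁻¹ * (F t - F 0) := funext fun t => by
    rw [slope_def_module, sub_zero, ← Complex.coe_smul, Complex.ofReal_inv, smul_eq_mul]
  refine ⟨fun t ht => ?_, fun t ht => ?_, hlp, ?_, hlm, ?_⟩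
  · rcases ht.lt_or_gt with h | h
    · exact (hm t h).differentiableAt
    · exact (hp t h).differentiableAt
  · refine ContinuousAt.continuousWithinAt ?_
    rcases lt_or_gt_of_ne (show t ≠ 0 from ht) with h | h
    · refine cm.continuousAt.congr ?_
      filter_upwards [gt_mem_nhds h] with s hs using (hm s hs).deriv.symm
    · refine cp.continuousAt.congr ?_
      filter_upwards [lt_mem_nhds h] with s hs using (hp s hs).deriv.symm
  · have := hasDerivWithinAt_Ici_of_tendsto_deriv (s := Set.Ioi 0)
      (fun t ht => (hp t ht).differentiableAt.differentiableWithinAt) hF.continuousWithinAt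
      self_mem_nhdsWithin hlp
    rw [hasDerivWithinAt_iff_tendsto_slope, hs, Set.Ici_sdiff_left] at this
    exact this
  · have := hasDerivWithinAt_Iic_of_tendsto_deriv (s := Set.Iio 0)
      (fun t ht => (hm t ht).differentiableAt.differentiableWithinAt) hF.continuousWithinAt
      self_mem_nhdsWithin hlm
    rw [hasDerivWithinAt_iff_tendsto_slope, hs, Set.Iic_sdiff_right] at this
    exact this

end Differentiation

/-! ### Properties of the group -/

section Group

variable {K 𝔥 : Type*} [NormedAddCommGroup K] [InnerProductSpace ℂ K]
  [FiniteDimensional ℂ K] [CompleteSpace K]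
  [NormedAddCommGroup 𝔥] [InnerProductSpace ℂ 𝔥] [CompleteSpace 𝔥] [FiniteDimensional ℂ 𝔥]
  {E : K →L[ℂ] K} {ν : K →L[ℂ] K ⊗[ℂ] 𝔥} {U : ℝ → TotalSpace K 𝔥 →L[ℂ] TotalSpace K 𝔥}

/-- The group `U` in the interaction picture, at all times. -/
def interaction (U : ℝ → TotalSpace K 𝔥 →L[ℂ] TotalSpace K 𝔥) (t : ℝ) :
    TotalSpace K 𝔥 →L[ℂ] TotalSpace K 𝔥 := freeU K 𝔥 t ∘L U t

theorem norm_unitary_apply {H : Type*} [NormedAddCommGroup H] [InnerProductSpace ℂ H]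
    [CompleteSpace H] {T : H →L[ℂ] H} (hT : T ∈ unitary (H →L[ℂ] H)) (x : H) : ‖T x‖ = ‖x‖ := by
  have h : T.adjoint (T x) = x := congrArg (fun S : H →L[ℂ] H => S x) hT.1
  refine norm_eq_of_inner (T := T) (fun x y => ?_) x
  have h : T.adjoint (T y) = y := congrArg (fun S : H →L[ℂ] H => S y) hT.1
  rw [← ContinuousLinearMap.adjoint_inner_right, h]

theorem IsUnitaryGroup.norm_interaction (hU : IsUnitaryGroup U) (t : ℝ) (x : TotalSpace K 𝔥) :
    ‖interaction U t x‖ = ‖x‖ :=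
  (norm_eq_of_inner (inner_freeU t) _).trans (norm_unitary_apply (hU.unitary t) x)

theorem IsUnitaryGroup.continuous_interaction (hU : IsUnitaryGroup U) (x : TotalSpace K 𝔥) :
    Continuous fun t => interaction U t x :=
  continuous_apply_of_isometry continuous_freeU (fun t => norm_eq_of_inner (inner_freeU t))
    (hU.continuous x)

theorem IsUnitaryGroup.interaction_zero (hU : IsUnitaryGroup U) : interaction U 0 = 1 := by
  rw [interaction, freeU_zero, hU.zero]
  rfl

theorem inner_freeD_interaction (t : ℝ) (ψ : AlgDom K 𝔥) (y : TotalSpace K 𝔥) :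
    ⟪inclD K 𝔥 (freeD K 𝔥 t ψ), interaction U t y⟫_ℂ = ⟪inclD K 𝔥 ψ, U t y⟫_ℂ := by
  rw [inclD_freeD]
  exact inner_freeU _ _ _

/-- Differentiability of the matrix elements away from the origin, and their one-sided derivatives
at the origin. Negative times are reduced to positive ones by `⟪ψ, U_t φ⟫ = conj ⟪φ, U_{-t} ψ⟫`. -/
theorem IsUnitaryGroup.differentiability (hU : IsUnitaryGroup U)
    (hadj : ∀ t, 0 ≤ t → U (-t) = (U t).adjoint) (hV : IsCocycle E ν (interaction U))
    (ψ φ : AlgDom K 𝔥) :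
    (∀ t : ℝ, t ≠ 0 → DifferentiableAt ℝ (fun s => ⟪inclD K 𝔥 ψ, U s (inclD K 𝔥 φ)⟫_ℂ) t) ∧
    ContinuousOn (deriv fun s : ℝ => ⟪inclD K 𝔥 ψ, U s (inclD K 𝔥 φ)⟫_ℂ) {0}ᶜ ∧
    Tendsto (deriv fun s : ℝ => ⟪inclD K 𝔥 ψ, U s (inclD K 𝔥 φ)⟫_ℂ) (𝓝[>] 0)
      (𝓝 (-Complex.I * formPlus E ν ψ φ)) ∧
    Tendsto (fun t : ℝ => (t : ℂ)⁻¹ * ⟪inclD K 𝔥 ψ, (U t - 1) (inclD K 𝔥 φ)⟫_ℂ) (𝓝[>] 0)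
      (𝓝 (-Complex.I * formPlus E ν ψ φ)) ∧
    Tendsto (deriv fun s : ℝ => ⟪inclD K 𝔥 ψ, U s (inclD K 𝔥 φ)⟫_ℂ) (𝓝[<] 0)
      (𝓝 (-Complex.I * formMinus E ν ψ φ)) ∧
    Tendsto (fun t : ℝ => (t : ℂ)⁻¹ * ⟪inclD K 𝔥 ψ, (U t - 1) (inclD K 𝔥 φ)⟫_ℂ) (𝓝[<] 0)
      (𝓝 (-Complex.I * formMinus E ν ψ φ)) := by
  have hp : ∀ (ψ φ : AlgDom K 𝔥) t, 0 < t → HasDerivAt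
      (fun s => ⟪inclD K 𝔥 ψ, U s (inclD K 𝔥 φ)⟫_ℂ) (groupRate E ν (interaction U) ψ φ t) t :=
    fun ψ φ t ht => by
      have := hV.hasDerivAt_freeD hU.continuous_interaction hU.norm_interaction ht ψ φ
      simpa only [inner_freeD_interaction] using this
  have hc : ∀ ψ φ : AlgDom K 𝔥, Continuous (groupRate E ν (interaction U) ψ φ) :=
    continuous_groupRate hU.continuous_interaction hU.norm_interaction
  have hm : ∀ t, t < 0 → HasDerivAt (fun s => ⟪inclD K 𝔥 ψ, U s (inclD K 𝔥 φ)⟫_ℂ)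
      (-(starRingEnd ℂ) (groupRate E ν (interaction U) φ ψ (-t))) t := fun t ht => by
    have h1 := (HasDerivAt.scomp t (hp φ ψ (-t) (neg_pos.2 ht)) (hasDerivAt_neg t)).star
    refine (h1.congr_deriv (by simp)).congr_of_eventuallyEq ?_
    filter_upwards [gt_mem_nhds ht] with s hs
    change ⟪inclD K 𝔥 ψ, U s (inclD K 𝔥 φ)⟫_ℂ
      = (starRingEnd ℂ) ⟪inclD K 𝔥 φ, U (-s) (inclD K 𝔥 ψ)⟫_ℂ
    have h2 := hadj (-s) (neg_pos.2 hs).le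
    rw [neg_neg] at h2
    rw [conj_inner_total, h2, ContinuousLinearMap.adjoint_inner_right]
  have h0 := groupRate_zero (E := E) (ν := ν) hU.interaction_zero
  have key := differentiability_of_onesided
    (continuous_const.inner (hU.continuous (inclD K 𝔥 φ))) (hp ψ φ) hm (hc ψ φ)
    (Complex.continuous_conj.comp ((hc φ ψ).comp continuous_neg)).neg
  have h1 : -(starRingEnd ℂ) (groupRate E ν (interaction U) φ ψ (-0))
      = -Complex.I * formMinus E ν ψ φ := by
    rw [neg_zero, h0, map_mul, conj_formPlus, map_neg, Complex.conj_I, neg_neg, neg_mul]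
  have h2 : ∀ t, ⟪inclD K 𝔥 ψ, (U t - 1) (inclD K 𝔥 φ)⟫_ℂ
      = ⟪inclD K 𝔥 ψ, U t (inclD K 𝔥 φ)⟫_ℂ - ⟪inclD K 𝔥 ψ, U 0 (inclD K 𝔥 φ)⟫_ℂ := fun t => by
    rw [hU.zero]
    exact inner_sub_right (𝕜 := ℂ) (E := TotalSpace K 𝔥) _ _ _
  simp only [h0, h1, ← h2] at key
  exact key

theorem isometry_embedVec : Isometry (embedVec (K := K) (vacuum (OneParticle 𝔥))) := by
  refine AddMonoidHomClass.isometry_of_norm _ fun k => ?_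
  change ‖k ⊗ₜ[ℂ] vacuum (OneParticle 𝔥)‖ = ‖k‖
  rw [TensorProduct.norm_tmul, norm_vacuum, mul_one]

/-- The vacuum expectation of the group is the contraction semigroup. -/
theorem inner_embedVec_of_isCocycle (hV : IsCocycle E ν (interaction U))
    {t : ℝ} (ht : 0 ≤ t) (k' k : K) :
    ⟪k', ((embedVec (vacuum (OneParticle 𝔥))).adjoint ∘L U t
        ∘L embedVec (vacuum (OneParticle 𝔥))) k⟫_ℂ
      = ⟪k', NormedSpace.exp ((-Complex.I * t) • upsilon E ν) k⟫_ℂ := by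
  have h := inner_freeU t (k' ⊗ₜ[ℂ] vacuum (OneParticle 𝔥)) (U t (k ⊗ₜ[ℂ] vacuum (OneParticle 𝔥)))
  rw [freeU_vacuum] at h
  exact (embedVec_adjoint_apply_inner _ _ _).trans (h.symm.trans (inner_cocycle_vacuum hV ht k' k))

end Group

end WhiteNoise

end

open WhiteNoise in
theorem mainTheorem3 {K 𝔥 : Type*}
    [NormedAddCommGroup K] [InnerProductSpace ℂ K] [FiniteDimensional ℂ K] [CompleteSpace K]
    [NormedAddCommGroup 𝔥] [InnerProductSpace ℂ 𝔥] [FiniteDimensional ℂ 𝔥] [CompleteSpace 𝔥]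
    (E : K →L[ℂ] K) (hE : IsSelfAdjoint E) (ν : K →L[ℂ] K ⊗[ℂ] 𝔥) :
    DenseRange (inclD K 𝔥) ∧
    ∃ U : ℝ → TotalSpace K 𝔥 →L[ℂ] TotalSpace K 𝔥,
      IsUnitaryGroup U ∧
      (∀ (J : Type) [Fintype J] (C : J → K →L[ℂ] K) (b : J → 𝔥), IsDecomposition ν C b →
        ∀ t : ℝ, 0 ≤ t → ∀ ψ φ : AlgDom K 𝔥,
          (∀ n, IntegrableOn (dysonIntegrand (upsilon E ν) C b t ψ φ n) (simplex n t)) ∧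
          HasSum (fun n => ∫ τ in simplex n t, dysonIntegrand (upsilon E ν) C b t ψ φ n τ)
            ⟪inclD K 𝔥 ψ, U t (inclD K 𝔥 φ)⟫_ℂ) ∧
      (∀ t : ℝ, 0 ≤ t → U (-t) = (U t).adjoint) ∧
      (∀ ψ φ : AlgDom K 𝔥,
        (∀ t : ℝ, t ≠ 0 →
          DifferentiableAt ℝ (fun s => ⟪inclD K 𝔥 ψ, U s (inclD K 𝔥 φ)⟫_ℂ) t) ∧
        ContinuousOn (deriv fun s : ℝ => ⟪inclD K 𝔥 ψ, U s (inclD K 𝔥 φ)⟫_ℂ) {0}ᶜ ∧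
        Tendsto (deriv fun s : ℝ => ⟪inclD K 𝔥 ψ, U s (inclD K 𝔥 φ)⟫_ℂ) (𝓝[>] 0)
          (𝓝 (-Complex.I * formPlus E ν ψ φ)) ∧
        Tendsto (fun t : ℝ => (t : ℂ)⁻¹ * ⟪inclD K 𝔥 ψ, (U t - 1) (inclD K 𝔥 φ)⟫_ℂ) (𝓝[>] 0)
          (𝓝 (-Complex.I * formPlus E ν ψ φ)) ∧
        Tendsto (deriv fun s : ℝ => ⟪inclD K 𝔥 ψ, U s (inclD K 𝔥 φ)⟫_ℂ) (𝓝[<] 0)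
          (𝓝 (-Complex.I * formMinus E ν ψ φ)) ∧
        Tendsto (fun t : ℝ => (t : ℂ)⁻¹ * ⟪inclD K 𝔥 ψ, (U t - 1) (inclD K 𝔥 φ)⟫_ℂ) (𝓝[<] 0)
          (𝓝 (-Complex.I * formMinus E ν ψ φ))) ∧
      IsUnitaryDilation U (embedVec (vacuum (OneParticle 𝔥)))
        (fun t => NormedSpace.exp ((-Complex.I * t) • upsilon E ν)) ∧
      IsLangevinSchrodinger U (vacuum (OneParticle 𝔥))
        (fun t => NormedSpace.exp ((t : ℂ) • lindblad E ν)) ∧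
      IsLangevinSchrodinger (fun t => U (-t)) (vacuum (OneParticle 𝔥))
        (fun t => NormedSpace.exp ((t : ℂ) • lindbladBack E ν)) := by
  obtain ⟨U, V, hU, hadj, hUV, hV, hforward, hbackward⟩ := exists_unitaryGroup hE ν
  have hco : IsCocycle E ν (interaction U) := fun t ht => by
    have h : interaction U t = V t := by
      ext x
      simp only [interaction, hUV t ht, ContinuousLinearMap.comp_apply, freeU_freeU_neg]
    have := hV t ht
    rwa [← h] at this
  have hrev : IsUnitaryGroup fun t => U (-t) :=
    { unitary := fun t => hU.unitary _
      zero := by rw [neg_zero, hU.zero]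
      add := fun s t => by rw [neg_add, hU.add]
      continuous := fun ψ => (hU.continuous ψ).comp continuous_neg }
  refine ⟨denseRange_inclD, U, hU, fun J _ C b hd t ht ψ φ => ⟨fun n => ?_, ?_⟩, hadj,
    hU.differentiability hadj hco, ⟨hU, isometry_embedVec, fun t ht => ?_⟩,
    ⟨hU, norm_vacuum, fun t ht S => ?_⟩, ⟨hrev, norm_vacuum, fun t ht S => ?_⟩⟩
  · rw [dysonIntegrand_eq]
    exact integrableOn_dysonForm _ _ _
  · have h := hco.hasSum_dysonTerm hU.continuous_interaction hU.norm_interaction hd ht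
      (freeD K 𝔥 t ψ) φ
    rwa [inner_freeD_interaction] at h
  · ext k
    exact ext_inner_left ℂ fun k' => inner_embedVec_of_isCocycle hco ht k' k
  · ext k
    refine ext_inner_left ℂ fun k' => ?_
    rw [← hforward t ht S k' k, hadj t ht]
    simp only [ContinuousLinearMap.comp_apply, embedVec_adjoint_apply_inner]
    rw [ContinuousLinearMap.adjoint_inner_right]
    rfl
  · ext k
    refine ext_inner_left ℂ fun k' => ?_
    rw [← hbackward t ht S k' k, neg_neg, hadj t ht]
    simp only [ContinuousLinearMap.comp_apply, embedVec_adjoint_apply_inner]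
    rw [ContinuousLinearMap.adjoint_inner_left]
    rfl
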